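/- Let $\mathbf X=(X_{ij})_{i,j=1}^n$, $n\ge 1$, be a real random matrix that satisfies condition (C0) with parameters $\rho$ and $M_4$, that is: (a) the pairs $(X_{ij},X_{ji})$, $1\le i<j\le n$, are independent identically distributed random vectors; (b) $\mathbb E X_{ij}=0$, $\mathbb E X_{ij}^2=1$ and $\mathbb E|X_{ij}|^4\le M_4$ for $i\ne j$; (c) $\mathbb E(X_{ij}X_{ji})=\rho$ for $i\ne j$; (d) the diagonal entries $X_{ii}$ are independent identically distributed, the diagonal is independent of the off-diagonal entries, $\mathbb E X_{ii}=0$ and $\mathbb E X_{ii}^2<\infty$. Assume $|\rho|<1$ and let $K>1$. There are constants $C(\rho),C_1(\rho)>0$, which depend only on $\rho$, $K$ and $M_4$, such that for every $n\ge1$, every such matrix $\mathbf X$, every $z\in\mathbb C$ and every $\varepsilon>0$ the matrix $\mathbf A=\mathbf X-z\mathbf I$ satisfies $$\mathbb P\bigl(s_n(\mathbf A)\le\varepsilon n^{-1/2},\ \|\mathbf A\|\le 3K\sqrt n\bigr)\le C(\rho)\,\varepsilon^{1/8}+C_1(\rho)\,n^{-1/8}.$$ Here $s_1(\mathbf A)\ge\dots\ge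 s_n(\mathbf A)$ are the singular values of $\mathbf A$, so that $s_n(\mathbf A)=\inf_{\|x\|_2=1}\|\mathbf A x\|_2$, and $\|\mathbf A\|=\sup_{\|x\|_2=1}\|\mathbf A x\|_2$ is the spectral norm. -/

import Mathlib

open MeasureTheory ProbabilityTheory

/-- Condition (C0) on a real random `n × n` matrix `X`, with correlation `ρ` and a bound `M₄` for
the fourth moments of the off-diagonal entries. "The pairs are i.i.d." is read over `i < j`: the
pair `(X i j, X j i)` is listed once, so `X i j` and `X j i` may have different laws. The moments
are written for all pairs, which by identical distribution is the same as for one pair. -/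
structure ConditionC0 {Ω : Type*} [MeasurableSpace Ω] (P : Measure Ω) {n : ℕ}
    (X : Ω → Matrix (Fin n) (Fin n) ℝ) (ρ M₄ : ℝ) : Prop where
  measurable : ∀ i j, Measurable fun ω => X ω i j
  /-- a) the pairs `(X i j, X j i)`, `i < j`, are independent -/
  pairs_indep : iIndepFun
    (fun (p : {p : Fin n × Fin n // p.1 < p.2}) ω => (X ω p.1.1 p.1.2, X ω p.1.2 p.1.1)) P
  /-- a) the pairs `(X i j, X j i)`, `i < j`, are identically distributed -/
  pairs_identDistrib : ∀ i j k l : Fin n, i < j → k < l →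
    IdentDistrib (fun ω => (X ω i j, X ω j i)) (fun ω => (X ω k l, X ω l k)) P P
  /-- b) the off-diagonal entries have finite fourth moments -/
  memLp_four : ∀ i j, i ≠ j → MemLp (fun ω => X ω i j) 4 P
  /-- b) the off-diagonal entries are centred -/
  mean_eq_zero : ∀ i j, i ≠ j → ∫ ω, X ω i j ∂P = 0
  /-- b) the off-diagonal entries have unit variance -/
  second_moment : ∀ i j, i ≠ j → ∫ ω, X ω i j ^ 2 ∂P = 1
  /-- b) the fourth moments of the off-diagonal entries are at most `M₄` -/
  fourth_moment : ∀ i j, i ≠ j → ∫ ω, X ω i j ^ 4 ∂P ≤ M₄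
  /-- c) the correlation within a pair is `ρ` -/
  correlation : ∀ i j, i ≠ j → ∫ ω, X ω i j * X ω j i ∂P = ρ
  abs_correlation_le : |ρ| ≤ 1
  /-- d) the diagonal entries are independent -/
  diag_indep : iIndepFun (fun (i : Fin n) ω => X ω i i) P
  /-- d) the diagonal entries are identically distributed -/
  diag_identDistrib : ∀ i k : Fin n, IdentDistrib (fun ω => X ω i i) (fun ω => X ω k k) P P
  /-- d) the diagonal is independent of the off-diagonal entries -/
  diag_indep_offDiag : IndepFun (fun ω (i : Fin n) => X ω i i)
    (fun ω (p : {p : Fin n × Fin n // p.1 ≠ p.2}) => X ω p.1.1 p.1.2) P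
  /-- d) the diagonal entries have finite second moment -/
  diag_memLp_two : ∀ i, MemLp (fun ω => X ω i i) 2 P
  /-- d) the diagonal entries are centred -/
  diag_mean_eq_zero : ∀ i, ∫ ω, X ω i i ∂P = 0

/-- The shifted matrix `X - z I`, as a complex matrix. -/
noncomputable def shiftedMatrix {n : ℕ} (X : Matrix (Fin n) (Fin n) ℝ) (z : ℂ) :
    Matrix (Fin n) (Fin n) ℂ :=
  X.map (fun x : ℝ => (x : ℂ)) - z • (1 : Matrix (Fin n) (Fin n) ℂ)

/-- The spectral norm of a complex square matrix: its operator norm on Euclidean space. -/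
noncomputable def spectralNorm2 {n : ℕ} (A : Matrix (Fin n) (Fin n) ℂ) : ℝ :=
  ‖Matrix.toEuclideanCLM (n := Fin n) (𝕜 := ℂ) A‖

/-- The smallest singular value `s_n(A)` of an `n × n` matrix, `n ≥ 1`. Mathlib lists the singular
values in decreasing order, starting at index `0`. -/
noncomputable def smallestSingularValue {n : ℕ} (A : Matrix (Fin n) (Fin n) ℂ) : ℝ :=
  (Matrix.toEuclideanLin A).singularValues (n - 1)

/-!
The diagonal is independent of the other entries, so that conditioning on it makes it deterministic.
A vector is called spread if a fixed proportion of its coordinates have at least a fixed multiple of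
their typical size; this is the incompressibility of Rudelson and Vershynin.

A unit vector which is not spread is close to one of exponentially few points of a grid, each
supported on few coordinates. The coordinates of the image outside this support are nondegenerate
and independent, so the image of a given grid point is small with a probability which is
exponentially small at a rate independent of the grid. Hence a fine choice of the parameters lets
the union bound win. The same bound, applied to the matrix and its transpose, shows that `A⁻¹ w` is
spread with high probability for a fixed vector `w`.

If a spread unit vector has a small image, then for every large coordinate `k` the distance of the
`k`-th column from the span of the others is small. This distance is the modulus of the Schur
complement `z - vᵀ G u` divided by the norm of `(1, -vᵀ G)`, where `G` is the inverse of the minor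
and is independent of the pair `(u, v)` of bordering vectors. Resampling the coordinates of `(u, v)`
in a block `J` replaces the quadratic form by one that is linear in the other coordinates; its
coefficient vectors are `G` and its transpose applied to differences of samples, hence spread, and
Esseen's inequality bounds the probability that the linear form is small. The Cauchy–Schwarz
inequality behind the resampling halves the exponents of `ε` and `n`, and the bounds on the norms of
`(1, -vᵀ G)` and of the coefficient vectors cost further powers of `ε`.
-/

/-- A pair of centred real random variables with unit variances, fourth moments at most `M` and
correlation at most `ρ` in absolute value: the law of the entries at two transposed positions. -/
structure PairMoments {Ω : Type*} [MeasurableSpace Ω] (P : Measure Ω) (U V : Ω → ℝ)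
    (ρ M : ℝ) : Prop where
  measurable_left : Measurable U
  measurable_right : Measurable V
  memLp_left : MemLp U 4 P
  memLp_right : MemLp V 4 P
  mean_left : ∫ ω, U ω ∂P = 0
  mean_right : ∫ ω, V ω ∂P = 0
  var_left : ∫ ω, U ω ^ 2 ∂P = 1
  var_right : ∫ ω, V ω ^ 2 ∂P = 1
  fourth_left : ∫ ω, U ω ^ 4 ∂P ≤ M
  fourth_right : ∫ ω, V ω ^ 4 ∂P ≤ M
  corr : |∫ ω, U ω * V ω ∂P| ≤ ρ

/-- A family of independent pairs, each of which satisfies the moment conditions `PairMoments` with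
the same constants; the two members of a pair may be dependent. -/
structure IndepPairs {Ω : Type*} [MeasurableSpace Ω] (P : Measure Ω) {ι : Type*}
    (U V : ι → Ω → ℝ) (ρ M : ℝ) : Prop where
  indep : iIndepFun (fun i ω => (U i ω, V i ω)) P
  moments : ∀ i, PairMoments P (U i) (V i) ρ M

section LinearCombinations

lemma integrable_pow_four_of_memLp {Ω : Type*} [MeasurableSpace Ω] {P : Measure Ω} {W : Ω → ℝ}
    (h : MemLp W 4 P) : Integrable (fun ω => W ω ^ 4) P :=
  (h.integrable_norm_pow (p := 4) four_ne_zero).congr <| .of_forall fun ω =>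
    (show Even 4 by decide).pow_abs (W ω)

namespace PairMoments

variable {Ω : Type*} [MeasurableSpace Ω] {P : Measure Ω} {U V : Ω → ℝ} {ρ M : ℝ}

lemma symm (h : PairMoments P U V ρ M) : PairMoments P V U ρ M where
  measurable_left := h.measurable_right
  measurable_right := h.measurable_left
  memLp_left := h.memLp_right
  memLp_right := h.memLp_left
  mean_left := h.mean_right
  mean_right := h.mean_left
  var_left := h.var_right
  var_right := h.var_left
  fourth_left := h.fourth_right
  fourth_right := h.fourth_left
  corr := by simpa only [mul_comm] using h.corr

lemma comp_measurePreserving {Ω' : Type*} [MeasurableSpace Ω'] {Q : Measure Ω'}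
    (h : PairMoments P U V ρ M) {f : Ω' → Ω} (hf : MeasurePreserving f Q P) :
    PairMoments Q (fun ω => U (f ω)) (fun ω => V (f ω)) ρ M := by
  have hU := h.measurable_left
  have hV := h.measurable_right
  have integral_comp : ∀ g : Ω → ℝ, Measurable g → ∫ ω, g (f ω) ∂Q = ∫ ω, g ω ∂P := fun g hg => by
    rw [← hf.map_eq, integral_map hf.measurable.aemeasurable hg.aestronglyMeasurable]
  exact
    { measurable_left := hU.comp hf.measurable
      measurable_right := hV.comp hf.measurable
      memLp_left := h.memLp_left.comp_measurePreserving hf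
      memLp_right := h.memLp_right.comp_measurePreserving hf
      mean_left := (integral_comp U hU).trans h.mean_left
      mean_right := (integral_comp V hV).trans h.mean_right
      var_left := (integral_comp _ (hU.pow_const 2)).trans h.var_left
      var_right := (integral_comp _ (hV.pow_const 2)).trans h.var_right
      fourth_left := (integral_comp _ (hU.pow_const 4)).trans_le h.fourth_left
      fourth_right := (integral_comp _ (hV.pow_const 4)).trans_le h.fourth_right
      corr := by rw [integral_comp (fun ω => U ω * V ω) (hU.mul hV)]; exact h.corr }

lemma map (h : PairMoments P U V ρ M) :
    PairMoments (P.map fun ω => (U ω, V ω)) Prod.fst Prod.snd ρ M := by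
  have hm : Measurable fun ω => (U ω, V ω) := h.measurable_left.prodMk h.measurable_right
  have integral_law : ∀ f : ℝ × ℝ → ℝ, Measurable f →
      ∫ z, f z ∂(P.map fun ω => (U ω, V ω)) = ∫ ω, f (U ω, V ω) ∂P := fun f hf =>
    integral_map hm.aemeasurable hf.aestronglyMeasurable
  exact
    { measurable_left := measurable_fst
      measurable_right := measurable_snd
      memLp_left := (memLp_map_measure_iff measurable_fst.aestronglyMeasurable hm.aemeasurable).2
        h.memLp_left
      memLp_right := (memLp_map_measure_iff measurable_snd.aestronglyMeasurable hm.aemeasurable).2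
        h.memLp_right
      mean_left := (integral_law _ measurable_fst).trans h.mean_left
      mean_right := (integral_law _ measurable_snd).trans h.mean_right
      var_left := (integral_law _ (measurable_fst.pow_const 2)).trans h.var_left
      var_right := (integral_law _ (measurable_snd.pow_const 2)).trans h.var_right
      fourth_left := (integral_law _ (measurable_fst.pow_const 4)).trans_le h.fourth_left
      fourth_right := (integral_law _ (measurable_snd.pow_const 4)).trans_le h.fourth_right
      corr := by
        rw [integral_law (fun z => z.1 * z.2) (measurable_fst.mul measurable_snd)]
        exact h.corr }

lemma memLp_comb (h : PairMoments P U V ρ M) (a b : ℝ) :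
    MemLp (fun ω => a * U ω + b * V ω) 4 P :=
  (h.memLp_left.const_mul a).add (h.memLp_right.const_mul b)

lemma fourth_moment_comb_le (h : PairMoments P U V ρ M) (a b : ℝ) :
    ∫ ω, (a * U ω + b * V ω) ^ 4 ∂P ≤ 8 * M * (a ^ 2 + b ^ 2) ^ 2 := by
  have hU := integrable_pow_four_of_memLp h.memLp_left
  have hV := integrable_pow_four_of_memLp h.memLp_right
  have hM : 0 ≤ M := le_trans (integral_nonneg fun ω => by positivity) h.fourth_left
  calc ∫ ω, (a * U ω + b * V ω) ^ 4 ∂P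
      ≤ ∫ ω, (8 * a ^ 4 * U ω ^ 4 + 8 * b ^ 4 * V ω ^ 4) ∂P := by
        refine integral_mono (integrable_pow_four_of_memLp (h.memLp_comb a b))
          ((hU.const_mul _).add (hV.const_mul _)) fun ω =>
          (Even.add_pow_le (by decide)).trans_eq ?_
        ring
    _ = 8 * a ^ 4 * ∫ ω, U ω ^ 4 ∂P + 8 * b ^ 4 * ∫ ω, V ω ^ 4 ∂P := by
        rw [integral_add (hU.const_mul _) (hV.const_mul _), integral_const_mul,
          integral_const_mul]
    _ ≤ 8 * a ^ 4 * M + 8 * b ^ 4 * M := by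
        gcongr
        exacts [h.fourth_left, h.fourth_right]
    _ = 8 * M * (a ^ 4 + b ^ 4) := by ring
    _ ≤ 8 * M * (a ^ 2 + b ^ 2) ^ 2 := by
        gcongr
        nlinarith [mul_nonneg (sq_nonneg a) (sq_nonneg b)]

variable [IsProbabilityMeasure P]

lemma memLp_two_left (h : PairMoments P U V ρ M) : MemLp U 2 P :=
  h.memLp_left.mono_exponent (by norm_num)

lemma integrable_left (h : PairMoments P U V ρ M) : Integrable U P :=
  h.memLp_left.integrable (by norm_num)

lemma mean_comb (h : PairMoments P U V ρ M) (a b : ℝ) :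
    ∫ ω, (a * U ω + b * V ω) ∂P = 0 := by
  rw [integral_add (h.integrable_left.const_mul a) (h.symm.integrable_left.const_mul b),
    integral_const_mul, integral_const_mul, h.mean_left, h.mean_right, mul_zero, mul_zero, add_zero]

lemma second_moment_comb (h : PairMoments P U V ρ M) (a b : ℝ) :
    ∫ ω, (a * U ω + b * V ω) ^ 2 ∂P = a ^ 2 + b ^ 2 + 2 * a * b * ∫ ω, U ω * V ω ∂P := by
  have hU := h.memLp_two_left.integrable_sq
  have hV := h.symm.memLp_two_left.integrable_sq
  have hUV : Integrable (fun ω => U ω * V ω) P :=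
    h.memLp_two_left.integrable_mul h.symm.memLp_two_left
  have hUV_sq : Integrable (fun ω => a ^ 2 * U ω ^ 2 + b ^ 2 * V ω ^ 2) P :=
    (hU.const_mul _).add (hV.const_mul _)
  have hexpand : ∀ ω, (a * U ω + b * V ω) ^ 2
      = a ^ 2 * U ω ^ 2 + b ^ 2 * V ω ^ 2 + 2 * a * b * (U ω * V ω) := fun ω => by ring
  simp_rw [hexpand]
  rw [integral_add hUV_sq (hUV.const_mul _),
    integral_add (hU.const_mul _) (hV.const_mul _), integral_const_mul, integral_const_mul,
    integral_const_mul, h.var_left, h.var_right, mul_one, mul_one]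

lemma le_second_moment_comb (h : PairMoments P U V ρ M) (a b : ℝ) :
    (1 - ρ) * (a ^ 2 + b ^ 2) ≤ ∫ ω, (a * U ω + b * V ω) ^ 2 ∂P := by
  rw [h.second_moment_comb]
  obtain ⟨hneg, hpos⟩ := abs_le.1 h.corr
  nlinarith [mul_nonneg (sub_nonneg.2 hpos) (sq_nonneg (a - b)),
    mul_nonneg (neg_le_iff_add_nonneg.1 hneg) (sq_nonneg (a + b))]

lemma second_moment_comb_le (h : PairMoments P U V ρ M) (hρ : ρ ≤ 1) (a b : ℝ) :
    ∫ ω, (a * U ω + b * V ω) ^ 2 ∂P ≤ 2 * (a ^ 2 + b ^ 2) := by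
  rw [h.second_moment_comb]
  obtain ⟨hneg, hpos⟩ := abs_le.1 (h.corr.trans hρ)
  nlinarith [mul_nonneg (sub_nonneg.2 hpos) (sq_nonneg (a + b)),
    mul_nonneg (neg_le_iff_add_nonneg.1 hneg) (sq_nonneg (a - b))]

end PairMoments

end LinearCombinations

section CharacteristicFunction

lemma cos_le_quartic (x : ℝ) :
    Real.cos x ≤ 1 - 2 / Real.pi ^ 2 * x ^ 2 + 2 / Real.pi ^ 4 * x ^ 4 := by
  rcases le_or_gt |x| Real.pi with h | h
  · have := Real.cos_le_one_sub_mul_cos_sq h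
    have : 0 ≤ 2 / Real.pi ^ 4 * x ^ 4 := by positivity
    linarith
  · have hsq : Real.pi ^ 2 ≤ x ^ 2 := by
      rw [← sq_abs x]
      gcongr
    have hfactor : 2 / Real.pi ^ 4 * x ^ 4 - 2 / Real.pi ^ 2 * x ^ 2
        = 2 / Real.pi ^ 4 * x ^ 2 * (x ^ 2 - Real.pi ^ 2) := by
      field_simp
    have : 0 ≤ 2 / Real.pi ^ 4 * x ^ 2 * (x ^ 2 - Real.pi ^ 2) :=
      mul_nonneg (by positivity) (sub_nonneg.2 hsq)
    linarith [Real.cos_le_one x]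

lemma abs_sin_sub_self_le_sq (y : ℝ) : |Real.sin y - y| ≤ y ^ 2 := by
  wlog hy : 0 ≤ y generalizing y
  · have := this (-y) (by linarith)
    rwa [Real.sin_neg, neg_sq, ← neg_sub', abs_neg] at this
  rw [abs_of_nonpos (sub_nonpos.2 (Real.sin_le hy))]
  rcases le_or_gt y 2 with h | h
  · nlinarith [Real.sin_ge_sub_cube hy, sq_nonneg y]
  · nlinarith [Real.neg_one_le_sin y]

variable {Ω : Type*} [MeasurableSpace Ω] {P : Measure Ω} [IsProbabilityMeasure P] {Y : Ω → ℝ}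

lemma integrable_cos (hY : AEStronglyMeasurable Y P) : Integrable (fun ω => Real.cos (Y ω)) P :=
  .of_bound (Real.continuous_cos.comp_aestronglyMeasurable hY) 1
    (.of_forall fun _ => Real.abs_cos_le_one _)

lemma integrable_sin (hY : AEStronglyMeasurable Y P) : Integrable (fun ω => Real.sin (Y ω)) P :=
  .of_bound (Real.continuous_sin.comp_aestronglyMeasurable hY) 1
    (.of_forall fun _ => Real.abs_sin_le_one _)

lemma norm_integral_exp_mul_I_sq (hY : AEStronglyMeasurable Y P) :
    ‖∫ ω, Complex.exp ((Y ω : ℝ) * Complex.I) ∂P‖ ^ 2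
      = (∫ ω, Real.cos (Y ω) ∂P) ^ 2 + (∫ ω, Real.sin (Y ω) ∂P) ^ 2 := by
  have hsplit : ∫ ω, Complex.exp ((Y ω : ℝ) * Complex.I) ∂P
      = (∫ ω, Real.cos (Y ω) ∂P : ℝ) + (∫ ω, Real.sin (Y ω) ∂P : ℝ) * Complex.I := by
    rw [← integral_complex_ofReal, ← integral_complex_ofReal, ← integral_mul_const,
      ← integral_add (integrable_cos hY).ofReal ((integrable_sin hY).ofReal.mul_const _)]
    simp_rw [Complex.exp_mul_I, Complex.ofReal_cos, Complex.ofReal_sin]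
  rw [hsplit, ← Complex.normSq_eq_norm_sq, Complex.normSq_add_mul_I]

lemma integral_cos_le (hY : MemLp Y 4 P) :
    ∫ ω, Real.cos (Y ω) ∂P ≤ 1 - 2 / Real.pi ^ 2 * (∫ ω, Y ω ^ 2 ∂P)
      + 2 / Real.pi ^ 4 * ∫ ω, Y ω ^ 4 ∂P := by
  have hY2 : Integrable (fun ω => Y ω ^ 2) P := (hY.mono_exponent (by norm_num)).integrable_sq
  have hY4 := integrable_pow_four_of_memLp hY
  have hquadratic : Integrable (fun ω => 1 - 2 / Real.pi ^ 2 * Y ω ^ 2) P :=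
    (integrable_const _).sub (hY2.const_mul _)
  calc ∫ ω, Real.cos (Y ω) ∂P
      ≤ ∫ ω, (1 - 2 / Real.pi ^ 2 * Y ω ^ 2 + 2 / Real.pi ^ 4 * Y ω ^ 4) ∂P :=
        integral_mono (integrable_cos hY.aestronglyMeasurable)
          (hquadratic.add (hY4.const_mul _)) fun ω => cos_le_quartic _
    _ = _ := by
        rw [integral_add hquadratic (hY4.const_mul _), integral_sub (integrable_const _)
          (hY2.const_mul _), integral_const_mul, integral_const_mul, integral_const,
          probReal_univ, one_smul]

lemma one_sub_le_integral_cos (hY : MemLp Y 2 P) :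
    1 - (∫ ω, Y ω ^ 2 ∂P) / 2 ≤ ∫ ω, Real.cos (Y ω) ∂P := by
  calc 1 - (∫ ω, Y ω ^ 2 ∂P) / 2 = ∫ ω, (1 - Y ω ^ 2 / 2) ∂P := by
        rw [integral_sub (integrable_const _) (hY.integrable_sq.div_const _), integral_div,
          integral_const, probReal_univ, one_smul]
    _ ≤ _ := integral_mono ((integrable_const _).sub (hY.integrable_sq.div_const _))
        (integrable_cos hY.aestronglyMeasurable) fun ω => Real.one_sub_sq_div_two_le_cos

lemma abs_integral_sin_le (hY : MemLp Y 2 P) (hmean : ∫ ω, Y ω ∂P = 0) :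
    |∫ ω, Real.sin (Y ω) ∂P| ≤ ∫ ω, Y ω ^ 2 ∂P := by
  have hY1 : Integrable Y P := hY.integrable (by norm_num)
  have hsin := integrable_sin hY.aestronglyMeasurable
  calc |∫ ω, Real.sin (Y ω) ∂P| = |∫ ω, (Real.sin (Y ω) - Y ω) ∂P| := by
        rw [integral_sub hsin hY1, hmean, sub_zero]
    _ ≤ ∫ ω, |Real.sin (Y ω) - Y ω| ∂P := abs_integral_le_integral_abs
    _ ≤ ∫ ω, Y ω ^ 2 ∂P := integral_mono (hsin.sub hY1).abs hY.integrable_sq fun ω =>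
        abs_sin_sub_self_le_sq _

lemma norm_integral_exp_mul_I_le_exp (hY : MemLp Y 4 P) (hmean : ∫ ω, Y ω ∂P = 0) {κ D s : ℝ}
    (hκ : κ ≤ 1) (hs : 0 ≤ s) (hsκ : s ≤ κ / 10) (hDs : D * s ≤ κ / 2)
    (hupper : ∫ ω, Y ω ^ 2 ∂P ≤ 2 * s)
    (hlower : κ * s - D * s ^ 2
      ≤ 2 / Real.pi ^ 2 * (∫ ω, Y ω ^ 2 ∂P) - 2 / Real.pi ^ 4 * ∫ ω, Y ω ^ 4 ∂P) :
    ‖∫ ω, Complex.exp ((Y ω : ℝ) * Complex.I) ∂P‖ ≤ Real.exp (-(κ / 4) * s) := by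
  have hY2 : MemLp Y 2 P := hY.mono_exponent (by norm_num)
  refine (pow_le_pow_iff_left₀ (norm_nonneg _) (Real.exp_nonneg _) two_ne_zero).1 ?_
  rw [norm_integral_exp_mul_I_sq hY.aestronglyMeasurable, ← Real.exp_nat_mul]
  have hcos : (∫ ω, Real.cos (Y ω) ∂P) ^ 2 ≤ (1 - κ * s / 2) ^ 2 := by
    refine pow_le_pow_left₀ (le_trans (by linarith) (one_sub_le_integral_cos hY2))
      ((integral_cos_le hY).trans ?_) 2
    nlinarith
  have hsin : (∫ ω, Real.sin (Y ω) ∂P) ^ 2 ≤ (2 * s) ^ 2 := by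
    rw [← sq_abs]
    gcongr
    exact (abs_integral_sin_le hY2 hmean).trans hupper
  have hexp := Real.add_one_le_exp (((2 : ℕ) : ℝ) * (-(κ / 4) * s))
  push_cast at hexp ⊢
  nlinarith [mul_nonneg hs (sub_nonneg.2 hsκ), mul_nonneg (sq_nonneg s) (sub_nonneg.2 hκ)]

theorem exists_norm_charFun_comb_le {ρ : ℝ} (hρ0 : 0 ≤ ρ) (hρ : ρ < 1) (M : ℝ) :
    ∃ c t : ℝ, 0 < c ∧ 0 < t ∧ ∀ (Ω : Type*) [MeasurableSpace Ω] (P : Measure Ω)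
      [IsProbabilityMeasure P] (U V : Ω → ℝ), PairMoments P U V ρ M → ∀ a b : ℝ,
      a ^ 2 + b ^ 2 ≤ t →
      ‖∫ ω, Complex.exp ((a * U ω + b * V ω : ℝ) * Complex.I) ∂P‖
        ≤ Real.exp (-c * (a ^ 2 + b ^ 2)) := by
  set κ : ℝ := 2 / Real.pi ^ 2 * (1 - ρ) with hκ
  have : 0 < κ := mul_pos (by positivity) (sub_pos.2 hρ)
  have hκ1 : κ ≤ 1 := by
    have : 2 / Real.pi ^ 2 ≤ 1 := by
      rw [div_le_one (by positivity)]
      nlinarith [Real.pi_gt_three]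
    exact mul_le_one₀ this (sub_nonneg.2 hρ.le) (by linarith)
  set D : ℝ := 2 / Real.pi ^ 4 * (8 * |M|) with hD
  have : 0 ≤ D := by positivity
  refine ⟨κ / 4, min (κ / 10) (κ / (2 * (D + 1))), by positivity, by positivity,
    fun Ω _ P _ U V h a b hs => ?_⟩
  have hs0 : 0 ≤ a ^ 2 + b ^ 2 := by positivity
  refine norm_integral_exp_mul_I_le_exp (h.memLp_comb a b) (h.mean_comb a b) (D := D) hκ1 hs0
    (hs.trans (min_le_left _ _)) ?_ (h.second_moment_comb_le hρ.le a b) ?_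
  · have hsD := hs.trans (min_le_right _ _)
    rw [le_div_iff₀ (by positivity)] at hsD
    linarith
  · have hsecond := h.le_second_moment_comb a b
    have hfourth : ∫ ω, (a * U ω + b * V ω) ^ 4 ∂P ≤ 8 * |M| * (a ^ 2 + b ^ 2) ^ 2 :=
      (h.fourth_moment_comb_le a b).trans (by gcongr; exact le_abs_self M)
    calc κ * (a ^ 2 + b ^ 2) - D * (a ^ 2 + b ^ 2) ^ 2
        = 2 / Real.pi ^ 2 * ((1 - ρ) * (a ^ 2 + b ^ 2))
          - 2 / Real.pi ^ 4 * (8 * |M| * (a ^ 2 + b ^ 2) ^ 2) := by rw [hκ, hD]; ring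
      _ ≤ _ := by gcongr

theorem exists_norm_charFun_sum_le {ρ : ℝ} (hρ0 : 0 ≤ ρ) (hρ : ρ < 1) (M : ℝ) :
    ∃ c t : ℝ, 0 < c ∧ 0 < t ∧ ∀ (Ω : Type*) [MeasurableSpace Ω] (P : Measure Ω)
      [IsProbabilityMeasure P] (ι : Type*) [Fintype ι] (U V : ι → Ω → ℝ), IndepPairs P U V ρ M →
      ∀ (a b : ι → ℝ) (S : Finset ι), (∀ i ∈ S, a i ^ 2 + b i ^ 2 ≤ t) →
      ‖∫ ω, Complex.exp ((∑ i, (a i * U i ω + b i * V i ω) : ℝ) * Complex.I) ∂P‖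
        ≤ Real.exp (-c * ∑ i ∈ S, (a i ^ 2 + b i ^ 2)) := by
  classical
  obtain ⟨c, t, hc, ht, H⟩ := exists_norm_charFun_comb_le hρ0 hρ M
  refine ⟨c, t, hc, ht, fun Ω _ P _ ι _ U V hUV a b S hS => ?_⟩
  let f : ι → ℝ × ℝ → ℂ := fun i z => Complex.exp ((a i * z.1 + b i * z.2 : ℝ) * Complex.I)
  have hprod : ∫ ω, Complex.exp ((∑ i, (a i * U i ω + b i * V i ω) : ℝ) * Complex.I) ∂P
      = ∏ i, ∫ ω, f i (U i ω, V i ω) ∂P := by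
    rw [← hUV.indep.integral_fun_prod_comp
      (fun i => ((hUV.moments i).measurable_left.prodMk
        (hUV.moments i).measurable_right).aemeasurable)
      (fun i => by simp only [f]; fun_prop)]
    simp_rw [Complex.ofReal_sum, Finset.sum_mul, Complex.exp_sum, f]
  have hle_one : ∀ i, ‖∫ ω, f i (U i ω, V i ω) ∂P‖ ≤ 1 := fun i => by
    refine (norm_integral_le_of_norm_le_const (C := 1) (.of_forall fun ω => ?_)).trans (by simp)
    exact (Complex.norm_exp_ofReal_mul_I _).le
  rw [hprod, norm_prod, Finset.mul_sum, Real.exp_sum, ← Finset.prod_mul_prod_compl S]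
  calc _ ≤ (∏ i ∈ S, Real.exp (-c * (a i ^ 2 + b i ^ 2))) * 1 := by
        gcongr with i hi
        · exact H Ω P (U i) (V i) (hUV.moments i) (a i) (b i) (hS i hi)
        · exact Finset.prod_le_one (fun i _ => norm_nonneg _) fun i _ => hle_one i
    _ = _ := mul_one _

end CharacteristicFunction

section Esseen

lemma integral_one_sub_mul_cos {y : ℝ} (hy : y ≠ 0) :
    ∫ t in (0 : ℝ)..1, (1 - t) * Real.cos (t * y) = (1 - Real.cos y) / y ^ 2 := by
  have hderiv : ∀ t ∈ Set.uIcc (0 : ℝ) 1, HasDerivAt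
      (fun t => (1 - t) * Real.sin (t * y) / y - Real.cos (t * y) / y ^ 2)
      ((1 - t) * Real.cos (t * y)) t := by
    intro t _
    have hmul : HasDerivAt (fun t : ℝ => t * y) y t := by simpa using (hasDerivAt_id t).mul_const y
    have hsub : HasDerivAt (fun t : ℝ => 1 - t) (-1) t := by
      simpa using (hasDerivAt_id t).const_sub 1
    convert! ((hsub.mul hmul.sin).div_const y).sub (hmul.cos.div_const (y ^ 2)) using 1
    field_simp
    ring
  rw [intervalIntegral.integral_eq_sub_of_hasDerivAt hderiv
    (Continuous.intervalIntegrable (by fun_prop) _ _)]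
  simp only [sub_self, zero_mul, one_mul, zero_div, mul_zero, Real.cos_zero, Real.sin_zero]
  ring

lemma integral_one_sub_mul_cos_nonneg (y : ℝ) :
    0 ≤ ∫ t in (0 : ℝ)..1, (1 - t) * Real.cos (t * y) := by
  rcases eq_or_ne y 0 with rfl | hy
  · refine intervalIntegral.integral_nonneg zero_le_one fun t ht => ?_
    simp [ht.2]
  · rw [integral_one_sub_mul_cos hy]
    exact div_nonneg (sub_nonneg.2 (Real.cos_le_one y)) (sq_nonneg y)

lemma one_fifth_le_integral_one_sub_mul_cos {y : ℝ} (hy : |y| ≤ 1) :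
    1 / 5 ≤ ∫ t in (0 : ℝ)..1, (1 - t) * Real.cos (t * y) := by
  rcases eq_or_ne y 0 with rfl | hy0
  · simp only [mul_zero, Real.cos_zero, mul_one]
    rw [intervalIntegral.integral_sub (by simp) (by simp)]
    simp only [intervalIntegral.integral_const, integral_id]
    norm_num
  · rw [integral_one_sub_mul_cos hy0, le_div_iff₀ (by positivity)]
    have hcos := Real.cos_le_one_sub_mul_cos_sq (x := y) (by linarith [Real.pi_gt_three])
    have hpi : (1 : ℝ) / 5 ≤ 2 / Real.pi ^ 2 := by
      rw [div_le_div_iff₀ (by norm_num) (by positivity)]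
      nlinarith [Real.pi_gt_three, Real.pi_lt_d2]
    nlinarith [sq_nonneg y]

variable {Ω : Type*} [MeasurableSpace Ω] {P : Measure Ω}

lemma integrable_one_sub_mul_cos_prod [IsFiniteMeasure P] {Y : Ω → ℝ} (hY : Measurable Y) :
    Integrable (fun z : Ω × ℝ => (1 - z.2) * Real.cos (z.2 * Y z.1))
      (P.prod (volume.restrict (Set.uIoc (0 : ℝ) 1))) := by
  have : IsFiniteMeasure (volume.restrict (Set.uIoc (0 : ℝ) 1)) := by
    rw [Set.uIoc_of_le zero_le_one]; infer_instance
  refine Integrable.mono' (integrable_const (1 : ℝ))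
    (Measurable.aestronglyMeasurable (by fun_prop)) ?_
  have hmem : ∀ᵐ z ∂(P.prod (volume.restrict (Set.uIoc (0 : ℝ) 1))), z.2 ∈ Set.uIoc (0 : ℝ) 1 :=
    Measure.quasiMeasurePreserving_snd.ae (ae_restrict_mem measurableSet_uIoc)
  filter_upwards [hmem] with z hz
  rw [Set.uIoc_of_le zero_le_one] at hz
  rw [Real.norm_eq_abs, abs_mul]
  refine mul_le_one₀ (abs_le.2 ⟨?_, ?_⟩) (abs_nonneg _) (Real.abs_cos_le_one _) <;>
    linarith [hz.1, hz.2]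

lemma integral_cos_add_le_norm_integral_exp [IsFiniteMeasure P] {Y : Ω → ℝ}
    (hY : AEStronglyMeasurable Y P) (c : ℝ) :
    ∫ ω, Real.cos (Y ω + c) ∂P ≤ ‖∫ ω, Complex.exp ((Y ω : ℝ) * Complex.I) ∂P‖ := by
  have hint : Integrable (fun ω => Complex.exp ((Y ω : ℝ) * Complex.I)) P := by
    refine (integrable_const (1 : ℝ)).mono (by fun_prop) (.of_forall fun ω => ?_)
    rw [Complex.norm_exp_ofReal_mul_I, norm_one]
  have hrotate : ∫ ω, Real.cos (Y ω + c) ∂P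
      = (Complex.exp ((c : ℝ) * Complex.I) * ∫ ω, Complex.exp ((Y ω : ℝ) * Complex.I) ∂P).re := by
    rw [← integral_const_mul, ← RCLike.re_to_complex, ← integral_re (hint.const_mul _)]
    congr 1 with ω
    rw [← Complex.exp_add, ← add_mul, ← Complex.ofReal_add, RCLike.re_to_complex,
      Complex.exp_ofReal_mul_I_re, add_comm]
  rw [hrotate]
  refine (Complex.re_le_norm _).trans_eq ?_
  rw [norm_mul, Complex.norm_exp_ofReal_mul_I, one_mul]

variable [IsProbabilityMeasure P] {S : Ω → ℝ}

lemma measureReal_abs_sub_le_le_integral (hS : Measurable S) {r : ℝ} (hr : 0 < r) (w : ℝ) :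
    1 / 5 * P.real {ω | |S ω - w| ≤ r}
      ≤ ∫ t in (0 : ℝ)..1, ∫ ω, (1 - t) * Real.cos (t * ((S ω - w) / r)) ∂P := by
  have hkernel := integrable_one_sub_mul_cos_prod (P := P) (Y := fun ω => (S ω - w) / r)
    (by fun_prop)
  have hswap := intervalIntegral_integral_swap (μ := P)
    (f := fun t ω => (1 - t) * Real.cos (t * ((S ω - w) / r)))
    (by simpa only [Function.uncurry_def, Function.comp_def, Prod.fst_swap, Prod.snd_swap]
      using hkernel.swap)
  have hint : Integrable (fun ω => ∫ t in (0 : ℝ)..1, (1 - t) * Real.cos (t * ((S ω - w) / r)))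
      P := by
    simp_rw [intervalIntegral.integral_of_le (zero_le_one (α := ℝ))]
    rw [Set.uIoc_of_le zero_le_one] at hkernel
    exact hkernel.integral_prod_left
  rw [hswap, mul_comm, ← smul_eq_mul, ← setIntegral_const]
  calc ∫ _ in {ω | |S ω - w| ≤ r}, (1 / 5 : ℝ) ∂P
      ≤ ∫ ω in {ω | |S ω - w| ≤ r},
          (∫ t in (0 : ℝ)..1, (1 - t) * Real.cos (t * ((S ω - w) / r))) ∂P := by
        refine setIntegral_mono_on (integrable_const _).integrableOn hint.integrableOn
          (measurableSet_le (by fun_prop) measurable_const) fun ω hω =>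
          one_fifth_le_integral_one_sub_mul_cos ?_
        rw [abs_div, abs_of_pos hr, div_le_one hr]
        exact hω
    _ ≤ _ := setIntegral_le_integral hint (.of_forall fun ω => integral_one_sub_mul_cos_nonneg _)

theorem measureReal_abs_sub_le_of_charFun_le (hS : Measurable S) {r κ : ℝ} (hr : 0 < r)
    (hκ : 0 < κ) (hφ : ∀ t ∈ Set.Icc (0 : ℝ) 1,
      ‖∫ ω, Complex.exp ((t / r * S ω : ℝ) * Complex.I) ∂P‖ ≤ Real.exp (-κ * t ^ 2)) (w : ℝ) :
    P.real {ω | |S ω - w| ≤ r} ≤ 5 * √(Real.pi / κ) := by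
  have hbound : ∀ t ∈ Set.Icc (0 : ℝ) 1,
      ∫ ω, (1 - t) * Real.cos (t * ((S ω - w) / r)) ∂P ≤ Real.exp (-κ * t ^ 2) := by
    intro t ht
    rw [integral_const_mul]
    have hcos : ∫ ω, Real.cos (t * ((S ω - w) / r)) ∂P ≤ Real.exp (-κ * t ^ 2) := by
      have harg : ∀ ω, t * ((S ω - w) / r) = t / r * S ω + -(t / r * w) := fun ω => by ring
      simp_rw [harg]
      exact (integral_cos_add_le_norm_integral_exp (by fun_prop) _).trans (hφ t ht)
    nlinarith [ht.1, ht.2, Real.exp_nonneg (-κ * t ^ 2)]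
  have hgauss : Integrable (fun t : ℝ => Real.exp (-κ * t ^ 2)) := integrable_exp_neg_mul_sq hκ
  have hkernel := integrable_one_sub_mul_cos_prod (P := P) (Y := fun ω => (S ω - w) / r)
    (by fun_prop)
  have hintegral : ∫ t in (0 : ℝ)..1, ∫ ω, (1 - t) * Real.cos (t * ((S ω - w) / r)) ∂P
      ≤ √(Real.pi / κ) := by
    calc _ ≤ ∫ t in (0 : ℝ)..1, Real.exp (-κ * t ^ 2) :=
          intervalIntegral.integral_mono_on zero_le_one
            (intervalIntegrable_iff.2 hkernel.integral_prod_right) hgauss.intervalIntegrable hbound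
      _ ≤ ∫ t : ℝ, Real.exp (-κ * t ^ 2) := by
          rw [intervalIntegral.integral_of_le zero_le_one]
          exact setIntegral_le_integral hgauss (.of_forall fun t => Real.exp_nonneg _)
      _ = _ := integral_gaussian κ
  linarith [measureReal_abs_sub_le_le_integral (P := P) hS hr w]

end Esseen

section SmallBall

lemma exists_charFun_rescaled_le {ρ : ℝ} (hρ0 : 0 ≤ ρ) (hρ : ρ < 1) (M : ℝ) {Λ : ℝ} (hΛ : 0 < Λ) :
    ∃ c q : ℝ, 0 < c ∧ 0 < q ∧ ∀ (Ω : Type*) [MeasurableSpace Ω] (P : Measure Ω)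
      [IsProbabilityMeasure P] (ι : Type*) [Fintype ι] (U V : ι → Ω → ℝ), IndepPairs P U V ρ M →
      ∀ (a b : ι → ℝ) (S : Finset ι) (s : ℝ), 0 < s →
      (∀ i ∈ S, s ^ 2 ≤ a i ^ 2 + b i ^ 2 ∧ a i ^ 2 + b i ^ 2 ≤ Λ * s ^ 2) →
      ∀ R : ℝ, q * s ≤ R → ∀ t ∈ Set.Icc (0 : ℝ) 1,
      ‖∫ ω, Complex.exp ((t / R * ∑ i, (a i * U i ω + b i * V i ω) : ℝ) * Complex.I) ∂P‖
        ≤ Real.exp (-(c * S.card * s ^ 2 / R ^ 2) * t ^ 2) := by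
  obtain ⟨c, t₀, hc, ht₀, H⟩ := exists_norm_charFun_sum_le hρ0 hρ M
  refine ⟨c, √(Λ / t₀), hc, by positivity, fun Ω _ P _ ι _ U V hUV a b S s hs hab R hR t ht => ?_⟩
  have hR0 : 0 < R := lt_of_lt_of_le (by positivity) hR
  have hscaled_small : ∀ i ∈ S, (t / R * a i) ^ 2 + (t / R * b i) ^ 2 ≤ t₀ := fun i hi => by
    have hratio : (t / R) ^ 2 * (√(Λ / t₀) * s) ^ 2 ≤ 1 := by
      have ht0 := ht.1
      rw [← mul_pow]
      refine pow_le_one₀ (by positivity) ?_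
      rw [div_mul_eq_mul_div, div_le_one hR0]
      exact (mul_le_of_le_one_left (by positivity) ht.2).trans hR
    rw [mul_pow _ s, Real.sq_sqrt (by positivity)] at hratio
    calc (t / R * a i) ^ 2 + (t / R * b i) ^ 2 = (t / R) ^ 2 * (a i ^ 2 + b i ^ 2) := by ring
      _ ≤ (t / R) ^ 2 * (Λ * s ^ 2) := by gcongr; exact (hab i hi).2
      _ = (t / R) ^ 2 * (Λ / t₀ * s ^ 2) * t₀ := by field_simp
      _ ≤ t₀ := mul_le_of_le_one_left ht₀.le hratio
  have hsum_lower : S.card * ((t / R) ^ 2 * s ^ 2)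
      ≤ ∑ i ∈ S, ((t / R * a i) ^ 2 + (t / R * b i) ^ 2) := by
    rw [← nsmul_eq_mul]
    refine Finset.card_nsmul_le_sum _ _ _ fun i hi => ?_
    rw [mul_pow, mul_pow, ← mul_add]
    gcongr
    exact (hab i hi).1
  have hcharFun := H Ω P ι U V hUV (fun i => t / R * a i) (fun i => t / R * b i) S hscaled_small
  simp only [mul_assoc (t / R), ← mul_add, ← Finset.mul_sum] at hcharFun hsum_lower
  refine hcharFun.trans (Real.exp_le_exp.2 ?_)
  calc _ ≤ -c * (S.card * ((t / R) ^ 2 * s ^ 2)) := by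
        simp only [neg_mul, neg_le_neg_iff]
        gcongr
    _ = _ := by field_simp

theorem exists_smallBall_real {ρ : ℝ} (hρ0 : 0 ≤ ρ) (hρ : ρ < 1) (M : ℝ) {Λ : ℝ} (hΛ : 0 < Λ) :
    ∃ C : ℝ, 0 < C ∧ ∀ (Ω : Type*) [MeasurableSpace Ω] (P : Measure Ω)
      [IsProbabilityMeasure P] (ι : Type*) [Fintype ι] (U V : ι → Ω → ℝ), IndepPairs P U V ρ M →
      ∀ (a b : ι → ℝ) (S : Finset ι) (s : ℝ), S.Nonempty → 0 < s →
      (∀ i ∈ S, s ^ 2 ≤ a i ^ 2 + b i ^ 2 ∧ a i ^ 2 + b i ^ 2 ≤ Λ * s ^ 2) →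
      ∀ (r : ℝ), 0 ≤ r → ∀ w : ℝ,
      P.real {ω | |∑ i, (a i * U i ω + b i * V i ω) - w| ≤ r} ≤ C * (r / s + 1) / √(S.card) := by
  obtain ⟨c, q, hc, hq, H⟩ := exists_charFun_rescaled_le hρ0 hρ M hΛ
  refine ⟨5 * √(Real.pi / c) * (1 + q), by positivity, ?_⟩
  intro Ω _ P _ ι _ U V hUV a b S s hS hs hab r hr w
  -- Esseen's inequality is applied at the scale `R`, which exceeds the size of the coefficients.
  set R := r + q * s with hR
  have hR0 : 0 < R := by positivity
  have : (0 : ℝ) < S.card := by exact_mod_cast hS.card_pos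
  have hmeas : Measurable fun ω => ∑ i, (a i * U i ω + b i * V i ω) :=
    Finset.measurable_sum _ fun i _ => ((hUV.moments i).measurable_left.const_mul _).add
      ((hUV.moments i).measurable_right.const_mul _)
  calc _ ≤ P.real {ω | |∑ i, (a i * U i ω + b i * V i ω) - w| ≤ R} :=
        measureReal_mono fun ω hω =>
          le_trans (show _ ≤ r from hω) (le_add_of_nonneg_right (by positivity))
    _ ≤ 5 * √(Real.pi / (c * S.card * s ^ 2 / R ^ 2)) :=
        measureReal_abs_sub_le_of_charFun_le hmeas hR0 (by positivity)
          (H Ω P ι U V hUV a b S s hs hab R (le_add_of_nonneg_left hr)) w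
    _ = 5 * √(Real.pi / c) * (R / s) / √(S.card) := by
        have : Real.pi / (c * S.card * s ^ 2 / R ^ 2) = Real.pi / c * (R / s) ^ 2 / S.card := by
          field_simp
        rw [this, Real.sqrt_div (by positivity), Real.sqrt_mul (by positivity),
          Real.sqrt_sq (by positivity)]
        ring
    _ ≤ _ := by
        have : R / s ≤ (1 + q) * (r / s + 1) := by
          rw [hR, add_div, mul_div_assoc, div_self hs.ne']
          have : 0 ≤ q * (r / s) := by positivity
          nlinarith
        rw [mul_assoc (5 * √(Real.pi / c))]
        gcongr

lemma exists_smallBall_of_realLinear {ρ : ℝ} (hρ0 : 0 ≤ ρ) (hρ : ρ < 1) (M : ℝ) {Λ : ℝ}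
    (hΛ : 0 < Λ) :
    ∃ C : ℝ, 0 < C ∧ ∀ (Ω : Type*) [MeasurableSpace Ω] (P : Measure Ω)
      [IsProbabilityMeasure P] (ι : Type*) [Fintype ι] (U V : ι → Ω → ℝ), IndepPairs P U V ρ M →
      ∀ f : ℂ →ₗ[ℝ] ℝ, (∀ z, |f z| ≤ ‖z‖) →
      ∀ (α β : ι → ℂ) (T : Finset ι) (s : ℝ), T.Nonempty → 0 < s →
      (∀ i ∈ T, s ^ 2 ≤ f (α i) ^ 2 + f (β i) ^ 2 ∧ ‖α i‖ ^ 2 + ‖β i‖ ^ 2 ≤ Λ * s ^ 2) →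
      ∀ (r : ℝ), 0 ≤ r → ∀ w : ℂ,
      P.real {ω | ‖∑ i, (α i * U i ω + β i * V i ω) - w‖ ≤ r} ≤ C * (r / s + 1) / √(T.card) := by
  obtain ⟨C, hC, H⟩ := exists_smallBall_real hρ0 hρ M hΛ
  refine ⟨C, hC, fun Ω _ P _ ι _ U V hUV f hf α β T s hT hs hαβ r hr w => ?_⟩
  have hf_sum : ∀ ω, f (∑ i, (α i * U i ω + β i * V i ω) - w)
      = ∑ i, (f (α i) * U i ω + f (β i) * V i ω) - f w := fun ω => by
    have hf_mul : ∀ (z : ℂ) (x : ℝ), f (z * x) = f z * x := fun z x => by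
      rw [mul_comm, ← Complex.real_smul, map_smul, smul_eq_mul, mul_comm]
    simp only [map_sub, map_sum, map_add, hf_mul]
  have hf_sq : ∀ z, f z ^ 2 ≤ ‖z‖ ^ 2 := fun z => by
    rw [← sq_abs]
    gcongr
    exact hf z
  calc _ ≤ P.real {ω | |∑ i, (f (α i) * U i ω + f (β i) * V i ω) - f w| ≤ r} :=
        measureReal_mono fun ω hω => by
          simpa only [Set.mem_ofPred_eq, hf_sum] using (hf _).trans (show _ ≤ r from hω)
    _ ≤ _ := H Ω P ι U V hUV _ _ T s hT hs
        (fun i hi => ⟨(hαβ i hi).1, (add_le_add (hf_sq _) (hf_sq _)).trans (hαβ i hi).2⟩) r hr _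

lemma exists_realLinear_large_on_half {ι : Type*} (α β : ι → ℂ) (S : Finset ι) {s : ℝ}
    (hs : ∀ i ∈ S, s ^ 2 ≤ ‖α i‖ ^ 2 + ‖β i‖ ^ 2) :
    ∃ f : ℂ →ₗ[ℝ] ℝ, (∀ z, |f z| ≤ ‖z‖) ∧ ∃ T ⊆ S, (S.card : ℝ) / 2 ≤ T.card ∧
      ∀ i ∈ T, s ^ 2 / 2 ≤ f (α i) ^ 2 + f (β i) ^ 2 := by
  classical
  let T : Finset ι := {i ∈ S | s ^ 2 / 2 ≤ (α i).re ^ 2 + (β i).re ^ 2}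
  let T' : Finset ι := {i ∈ S | ¬ s ^ 2 / 2 ≤ (α i).re ^ 2 + (β i).re ^ 2}
  have hcard : (T.card : ℝ) + T'.card = S.card := by
    exact_mod_cast Finset.card_filter_add_card_filter_not _
  rcases le_total (T'.card : ℝ) T.card with h | h
  · exact ⟨Complex.reLm, Complex.abs_re_le_norm, T, Finset.filter_subset _ _, by linarith,
      fun i hi => (Finset.mem_filter.1 hi).2⟩
  · refine ⟨Complex.imLm, Complex.abs_im_le_norm, T', Finset.filter_subset _ _, by linarith,
      fun i hi => ?_⟩
    obtain ⟨hiS, hre⟩ := Finset.mem_filter.1 hi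
    have hlow := hs i hiS
    simp only [Complex.sq_norm, Complex.normSq_apply] at hlow
    simp only [Complex.imLm_coe]
    linarith

theorem exists_smallBall {ρ : ℝ} (hρ0 : 0 ≤ ρ) (hρ : ρ < 1) (M : ℝ) {Λ : ℝ} (hΛ : 0 < Λ) :
    ∃ C : ℝ, 0 < C ∧ ∀ (Ω : Type*) [MeasurableSpace Ω] (P : Measure Ω)
      [IsProbabilityMeasure P] (ι : Type*) [Fintype ι] (U V : ι → Ω → ℝ), IndepPairs P U V ρ M →
      ∀ (α β : ι → ℂ) (S : Finset ι) (s : ℝ), S.Nonempty → 0 < s →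
      (∀ i ∈ S, s ^ 2 ≤ ‖α i‖ ^ 2 + ‖β i‖ ^ 2 ∧ ‖α i‖ ^ 2 + ‖β i‖ ^ 2 ≤ Λ * s ^ 2) →
      ∀ (r : ℝ), 0 ≤ r → ∀ w : ℂ,
      P.real {ω | ‖∑ i, (α i * U i ω + β i * V i ω) - w‖ ≤ r} ≤ C * (r / s + 1) / √(S.card) := by
  obtain ⟨C, hC, H⟩ := exists_smallBall_of_realLinear hρ0 hρ M (Λ := 2 * Λ) (by positivity)
  refine ⟨2 * C, by positivity, fun Ω _ P _ ι _ U V hUV α β S s hS hs hαβ r hr w => ?_⟩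
  obtain ⟨f, hf, T, hTS, hT, hlow⟩ :=
    exists_realLinear_large_on_half α β S fun i hi => (hαβ i hi).1
  have : (0 : ℝ) < S.card := by exact_mod_cast hS.card_pos
  have hT_pos : 0 < T.card := by exact_mod_cast (half_pos this).trans_le hT
  have hs_sq : (s / √2) ^ 2 = s ^ 2 / 2 := by rw [div_pow, Real.sq_sqrt zero_le_two]
  have hcard_half : √(S.card : ℝ) / √2 ≤ √(T.card) := by
    rw [← Real.sqrt_div (by positivity)]
    exact Real.sqrt_le_sqrt hT
  have hscale : r / (s / √2) + 1 ≤ √2 * (r / s + 1) := by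
    have : (1 : ℝ) ≤ √2 := Real.one_le_sqrt.2 one_le_two
    rw [mul_add, mul_one, ← mul_div_assoc, div_div_eq_mul_div, mul_comm r]
    gcongr
  calc _ ≤ C * (r / (s / √2) + 1) / √(T.card) := by
        refine H Ω P ι U V hUV f hf α β T (s / √2) (Finset.card_pos.1 hT_pos) (by positivity)
          (fun i hi => ?_) r hr w
        have hupper := (hαβ i (hTS hi)).2
        rw [hs_sq]
        exact ⟨hlow i hi, by linarith⟩
    _ ≤ C * (√2 * (r / s + 1)) / (√(S.card) / √2) := by gcongr
    _ = √2 * √2 * C * (r / s + 1) / √(S.card) := by field_simp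
    _ = _ := by rw [Real.mul_self_sqrt zero_le_two]

end SmallBall

section EllipticEntries

/-- The off-diagonal entries of an elliptic random matrix: the pairs of entries at transposed
positions are independent, and have uniformly controlled moments. The pairs need not be identically
distributed, and nothing is required of the diagonal. -/
structure EllipticEntries {Ω : Type*} [MeasurableSpace Ω] (P : Measure Ω) {ι : Type*}
    [LinearOrder ι] (X : Ω → ι → ι → ℝ) (ρ M : ℝ) : Prop where
  indep : iIndepFun (fun (p : {p : ι × ι // p.1 < p.2}) ω =>
    (X ω p.1.1 p.1.2, X ω p.1.2 p.1.1)) P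
  moments : ∀ i j, i ≠ j → PairMoments P (fun ω => X ω i j) (fun ω => X ω j i) ρ M

lemma iIndepFun_curry {Ω : Type*} [MeasurableSpace Ω] {P : Measure Ω} {I J E : Type*}
    [MeasurableSpace E] {Z : I × J → Ω → E} (hZ : ∀ p, Measurable (Z p)) (h : iIndepFun Z P) :
    iIndepFun (fun i ω j => Z (i, j) ω) P := by
  have := h.isProbabilityMeasure
  have : ∀ i j, IsProbabilityMeasure (P.map (Z (i, j))) :=
    fun i j => Measure.isProbabilityMeasure_map (hZ _).aemeasurable
  have hrow : ∀ i, P.map (fun ω j => Z (i, j) ω) = Measure.infinitePi fun j => P.map (Z (i, j)) :=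
    fun i => (h.precomp (g := fun j : J => (i, j))
      (Prod.mk_right_injective i)).map_fun_eq_infinitePi_map fun j => hZ _
  rw [iIndepFun_iff_map_fun_eq_infinitePi_map fun i => measurable_pi_lambda _ fun j => hZ _]
  simp_rw [hrow]
  rw [← Measure.infinitePi_map_curry (fun i j => P.map (Z (i, j))),
    ← h.map_fun_eq_infinitePi_map hZ, Measure.map_map (by fun_prop) (measurable_pi_lambda _ hZ)]
  rfl

namespace EllipticEntries

variable {Ω : Type*} [MeasurableSpace Ω] {P : Measure Ω} {ι : Type*} [LinearOrder ι]
  {X : Ω → ι → ι → ℝ} {ρ M : ℝ}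

lemma measurable (h : EllipticEntries P X ρ M) {i j : ι} (hij : i ≠ j) :
    Measurable fun ω => X ω i j := (h.moments i j hij).measurable_left

lemma indepPairs (h : EllipticEntries P X ρ M) {σ : Type*} (f g : σ → ι) (hne : ∀ s, f s ≠ g s)
    (hinj : ∀ s t, (f s = f t ∧ g s = g t) ∨ (f s = g t ∧ g s = f t) → s = t) :
    IndepPairs P (fun s ω => X ω (f s) (g s)) (fun s ω => X ω (g s) (f s)) ρ M where
  moments s := h.moments _ _ (hne s)
  indep := by
    let sorted : σ → {p : ι × ι // p.1 < p.2} := fun s =>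
      ⟨(min (f s) (g s), max (f s) (g s)), min_lt_max.2 (hne s)⟩
    have sorted_injective : Function.Injective sorted := by
      intro s t hst
      have : min (f s) (g s) = min (f t) (g t) := congrArg (fun p => p.1.1) hst
      have : max (f s) (g s) = max (f t) (g t) := congrArg (fun p => p.1.2) hst
      grind
    let orient : σ → ℝ × ℝ → ℝ × ℝ := fun s => if f s < g s then id else Prod.swap
    have measurable_orient : ∀ s, Measurable (orient s) := fun s => by
      simp only [orient]
      split_ifs
      exacts [measurable_id, measurable_swap]
    convert! (h.indep.precomp sorted_injective).comp orient measurable_orient using 2 with s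
    funext ω
    simp only [sorted, orient, Function.comp]
    rcases lt_or_gt_of_ne (hne s) with hlt | hlt
    · rw [if_pos hlt, min_eq_left hlt.le, max_eq_right hlt.le, id]
    · rw [if_neg hlt.not_gt, min_eq_right hlt.le, max_eq_left hlt.le, Prod.swap_prod_mk]

lemma indepPairs_row (h : EllipticEntries P X ρ M) {i : ι} {T : Finset ι} (hi : i ∉ T) :
    IndepPairs P (fun (j : T) ω => X ω i j) (fun (j : T) ω => X ω j i) ρ M :=
  h.indepPairs (fun _ : T => i) (fun j => j) (fun j hij => hi (hij ▸ j.2)) fun s t hst => by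
    rcases hst with hst | hst
    · exact Subtype.ext hst.2
    · exact absurd t.2 (hst.1 ▸ hi)

lemma indep_rows (h : EllipticEntries P X ρ M) {S T : Finset ι} (hST : Disjoint S T) :
    iIndepFun (fun (i : S) ω (j : T) => X ω i j) P := by
  have hne : ∀ p : S × T, (p.1 : ι) ≠ p.2 := fun p => Finset.disjoint_iff_ne.1 hST _ p.1.2 _ p.2.2
  have hpairs := h.indepPairs (fun p : S × T => (p.1 : ι)) (fun p => p.2) hne fun s t hst => by
    have hmixed := hne (s.1, t.2)
    rcases hst with hst | hst
    · exact Prod.ext (Subtype.ext hst.1) (Subtype.ext hst.2)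
    · exact absurd hst.1 hmixed
  exact iIndepFun_curry (fun p => h.measurable (hne p))
    (hpairs.indep.comp (fun _ => Prod.fst) fun _ => measurable_fst)

lemma transpose (h : EllipticEntries P X ρ M) :
    EllipticEntries P (fun ω i j => X ω j i) ρ M where
  indep := by
    refine (h.indepPairs (σ := {p : ι × ι // p.1 < p.2}) (fun p => p.1.2) (fun p => p.1.1)
      (fun p => p.2.ne') ?_).indep
    rintro ⟨⟨a, b⟩, hab⟩ ⟨⟨c, d⟩, hcd⟩ hswap
    simp only [Subtype.mk.injEq, Prod.mk.injEq] at *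
    grind
  moments := fun i j hij => (h.moments i j hij).symm

lemma restrict (h : EllipticEntries P X ρ M) (p : ι → Prop) :
    EllipticEntries P (fun ω (i j : {i // p i}) => X ω i j) ρ M where
  indep := by
    refine (h.indepPairs (fun q : {q : {i // p i} × {i // p i} // q.1 < q.2} => (q.1.1 : ι))
      (fun q => q.1.2) (fun q => (Subtype.coe_lt_coe.2 q.2).ne) ?_).indep
    rintro ⟨⟨⟨a, _⟩, ⟨b, _⟩⟩, hab⟩ ⟨⟨⟨c, _⟩, ⟨d, _⟩⟩, hcd⟩ hswap
    simp only [Subtype.mk.injEq, Prod.mk.injEq] at *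
    grind
  moments := fun i j hij => h.moments i j (Subtype.coe_injective.ne hij)

end EllipticEntries

end EllipticEntries

section FixedVector

lemma exp_neg_le_two_add_cos (x : ℝ) : Real.exp (-(x ^ 2 / 2)) ≤ (2 + Real.cos x) / 3 := by
  have hexp : Real.exp (-(x ^ 2 / 2)) ≤ 1 / (1 + x ^ 2 / 2) := by
    rw [Real.exp_neg, ← one_div, add_comm]
    exact one_div_le_one_div_of_le (by positivity) (Real.add_one_le_exp _)
  refine hexp.trans ((div_le_iff₀ (by positivity)).2 ?_)
  rcases le_or_gt (x ^ 2) 4 with h | h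
  · nlinarith [Real.one_sub_sq_div_two_le_cos (x := x), sq_nonneg x]
  · nlinarith [Real.neg_one_le_cos x]

lemma exp_neg_le_prod_two_add_cos {κ : Type*} [Fintype κ] (τ : ℝ) {y : κ → ℝ} {s : ℝ}
    (hy : ∑ i, y i ^ 2 ≤ s) :
    Real.exp (-(τ ^ 2 * s / 2)) ≤ ∏ i, (2 + Real.cos (τ * y i)) / 3 :=
  calc Real.exp (-(τ ^ 2 * s / 2)) ≤ Real.exp (∑ i, -((τ * y i) ^ 2 / 2)) := by
        simp only [mul_pow, Finset.sum_neg_distrib, ← Finset.sum_div, ← Finset.mul_sum]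
        gcongr
    _ = ∏ i, Real.exp (-((τ * y i) ^ 2 / 2)) := Real.exp_sum _ _
    _ ≤ _ := Finset.prod_le_prod (fun i _ => Real.exp_nonneg _) fun i _ =>
        exp_neg_le_two_add_cos _

lemma measureReal_sum_sq_le_of_iIndepFun {Ω : Type*} [MeasurableSpace Ω] {P : Measure Ω}
    {κ : Type*} [Fintype κ] {Y : κ → Ω → ℝ} (hY : ∀ i, Measurable (Y i)) (hind : iIndepFun Y P)
    {τ q : ℝ} (hq : ∀ i, ∫ ω, Real.cos (τ * Y i ω) ∂P ≤ q) (s : ℝ) :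
    P.real {ω | ∑ i, Y i ω ^ 2 ≤ s}
      ≤ Real.exp (τ ^ 2 * s / 2) * ((2 + q) / 3) ^ Fintype.card κ := by
  have := hind.isProbabilityMeasure
  let f : ℝ → ℝ := fun y => (2 + Real.cos (τ * y)) / 3
  have hf : Measurable f := by simp only [f]; fun_prop
  have hf0 : ∀ y, 0 ≤ f y := fun y => by
    simp only [f]; linarith [Real.neg_one_le_cos (τ * y)]
  have hf1 : ∀ y, f y ≤ 1 := fun y => by
    simp only [f]; linarith [Real.cos_le_one (τ * y)]
  have hfi : ∀ i, ∫ ω, f (Y i ω) ∂P ≤ (2 + q) / 3 := fun i => by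
    have hcos : Integrable (fun ω => Real.cos (τ * Y i ω)) P :=
      integrable_cos ((hY i).const_mul τ).aestronglyMeasurable
    simp only [f]
    rw [integral_div, integral_add (integrable_const _) hcos, integral_const, probReal_univ,
      one_smul]
    linarith [hq i]
  have hmarkov : Real.exp (-(τ ^ 2 * s / 2)) *
      P.real {ω | Real.exp (-(τ ^ 2 * s / 2)) ≤ ∏ i, f (Y i ω)} ≤ ∫ ω, ∏ i, f (Y i ω) ∂P := by
    refine mul_meas_ge_le_integral_of_nonneg (.of_forall fun ω =>
      Finset.prod_nonneg fun i _ => hf0 _) ((integrable_const (1 : ℝ)).mono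
        (Finset.measurable_prod _ fun i _ => hf.comp (hY i)).aestronglyMeasurable
        (.of_forall fun ω => ?_)) _
    rw [Real.norm_of_nonneg (Finset.prod_nonneg fun i _ => hf0 _), norm_one]
    exact Finset.prod_le_one (fun i _ => hf0 _) fun i _ => hf1 _
  have hsubset : {ω | ∑ i, Y i ω ^ 2 ≤ s}
      ⊆ {ω | Real.exp (-(τ ^ 2 * s / 2)) ≤ ∏ i, f (Y i ω)} :=
    fun _ hω => exp_neg_le_prod_two_add_cos τ hω
  calc P.real {ω | ∑ i, Y i ω ^ 2 ≤ s}
      ≤ Real.exp (τ ^ 2 * s / 2) * ∫ ω, ∏ i, f (Y i ω) ∂P := by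
        rw [← inv_mul_le_iff₀ (Real.exp_pos _), ← Real.exp_neg]
        exact (mul_le_mul_of_nonneg_left (measureReal_mono hsubset) (Real.exp_nonneg _)).trans
          hmarkov
    _ ≤ _ := by
        rw [hind.integral_fun_prod_comp (f := fun _ => f) (fun i => (hY i).aemeasurable)
          (fun i => hf.aestronglyMeasurable), ← Finset.card_univ, ← Finset.prod_const]
        gcongr with i
        · exact fun i _ => integral_nonneg fun ω => hf0 _
        · exact hfi i

lemma exists_integral_cos_le {ρ : ℝ} (hρ0 : 0 ≤ ρ) (hρ : ρ < 1) (M : ℝ) :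
    ∃ τ q : ℝ, 0 < τ ∧ 0 < q ∧ q < 1 ∧ ∀ (Ω : Type*) [MeasurableSpace Ω] (P : Measure Ω)
      [IsProbabilityMeasure P] (ι : Type*) [Fintype ι] (U V : ι → Ω → ℝ), IndepPairs P U V ρ M →
      ∀ a : ι → ℝ, 1 / 8 ≤ ∑ j, a j ^ 2 → (∀ j, a j ^ 2 ≤ 4) → ∀ w : ℝ,
      ∫ ω, Real.cos (τ * (∑ j, U j ω * a j + w)) ∂P ≤ q := by
  obtain ⟨c, t, hc, ht, H⟩ := exists_norm_charFun_sum_le hρ0 hρ M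
  have hτ_sq : (√t / 2) ^ 2 = t / 4 := by rw [div_pow, Real.sq_sqrt ht.le]; norm_num
  refine ⟨√t / 2, Real.exp (-c * (t / 32)), by positivity, Real.exp_pos _,
    Real.exp_lt_one_iff.2 (by rw [neg_mul, neg_lt_zero]; positivity), ?_⟩
  intro Ω _ P _ ι _ U V hUV a ha_sum ha w
  have hcharFun := H Ω P ι U V hUV (fun j => √t / 2 * a j) (fun _ => 0) Finset.univ fun j _ => by
    rw [mul_pow, hτ_sq]
    nlinarith [ha j]
  simp only [zero_mul, add_zero, mul_pow, hτ_sq, zero_pow two_ne_zero, ← Finset.mul_sum]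
    at hcharFun
  have hmeas : Measurable fun ω => ∑ j, √t / 2 * a j * U j ω :=
    Finset.measurable_sum _ fun j _ => (hUV.moments j).measurable_left.const_mul _
  have hsplit : ∀ ω, √t / 2 * (∑ j, U j ω * a j + w)
      = ∑ j, √t / 2 * a j * U j ω + √t / 2 * w := fun ω => by
    simp only [mul_add, Finset.mul_sum, mul_comm (U _ ω), mul_assoc]
  simp_rw [hsplit]
  refine (integral_cos_add_le_norm_integral_exp hmeas.aestronglyMeasurable _).trans
    (hcharFun.trans (Real.exp_le_exp.2 ?_))
  have : t / 32 ≤ t / 4 * ∑ j, a j ^ 2 := by nlinarith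
  rw [neg_mul, neg_mul, neg_le_neg_iff]
  gcongr

-- The constant `-log q / (2 τ²)` makes the exponential cost half of the gain `q ^ (n / 2)`.
lemma exp_mul_pow_le_pow {q τ : ℝ} (hq0 : 0 < q) (hq1 : q ≤ 1) (hτ : 0 < τ) {n m : ℕ}
    (hm : (n : ℝ) / 2 ≤ m) :
    Real.exp (τ ^ 2 * (-Real.log q / (2 * τ ^ 2) * n) / 2) * q ^ m
      ≤ Real.exp (Real.log q / 4) ^ n := by
  have hlog : Real.log q ≤ 0 := Real.log_nonpos hq0.le hq1
  have hexponent : τ ^ 2 * (-Real.log q / (2 * τ ^ 2) * n) / 2 = -(Real.log q / 4 * n) := by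
    field_simp
    ring
  rw [← Real.exp_nat_mul, ← Real.rpow_natCast q, Real.rpow_def_of_pos hq0, ← Real.exp_add,
    Real.exp_le_exp, hexponent]
  nlinarith

theorem exists_sum_sq_image_real_le {ρ : ℝ} (hρ0 : 0 ≤ ρ) (hρ : ρ < 1) (M : ℝ) :
    ∃ c q : ℝ, 0 < c ∧ 0 < q ∧ q < 1 ∧ ∀ (Ω : Type*) [MeasurableSpace Ω] (P : Measure Ω)
      [IsProbabilityMeasure P] (ι : Type*) [Fintype ι] [LinearOrder ι] (X : Ω → ι → ι → ℝ),
      EllipticEntries P X ρ M → ∀ (e : ι → ℝ) (T : Finset ι), (∀ j ∉ T, e j = 0) →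
      2 * T.card ≤ Fintype.card ι → 1 / 8 ≤ ∑ j, e j ^ 2 → (∀ j, e j ^ 2 ≤ 4) → ∀ v : ι → ℝ,
      P.real {ω | ∑ i ∈ Tᶜ, (∑ j, X ω i j * e j + v i) ^ 2 ≤ c * Fintype.card ι}
        ≤ q ^ Fintype.card ι := by
  obtain ⟨τ, q₀, hτ, hq₀, hq₀1, H⟩ := exists_integral_cos_le hρ0 hρ M
  set q := (2 + q₀) / 3 with hq
  have hq0 : 0 < q := by positivity
  have hq1 : q < 1 := by rw [hq]; linarith
  have hlog : Real.log q < 0 := Real.log_neg hq0 hq1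
  refine ⟨-Real.log q / (2 * τ ^ 2), Real.exp (Real.log q / 4),
    div_pos (by linarith) (by positivity), Real.exp_pos _, Real.exp_lt_one_iff.2 (by linarith), ?_⟩
  intro Ω _ P _ ι _ _ X hX e T heT hT he_sum he v
  have restrict_sum : ∀ f : ι → ℝ, (∀ j ∉ T, f j = 0) → ∑ j, f j = ∑ j : T, f j := fun f hf => by
    rw [Finset.sum_coe_sort T f]
    exact (Finset.sum_subset (Finset.subset_univ _) fun j _ hj => hf j hj).symm
  let Y : ↥(Tᶜ) → Ω → ℝ := fun i ω => ∑ j : T, X ω i j * e j + v i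
  have hYsum : ∀ ω, ∑ i ∈ Tᶜ, (∑ j, X ω i j * e j + v i) ^ 2 = ∑ i, Y i ω ^ 2 := fun ω => by
    rw [← Finset.sum_coe_sort]
    refine Finset.sum_congr rfl fun i _ => ?_
    rw [restrict_sum _ fun j hj => by rw [heT j hj, mul_zero]]
  have hdisj : Disjoint Tᶜ T := disjoint_compl_left
  have hYind : iIndepFun Y P :=
    (hX.indep_rows hdisj).comp (fun i z => ∑ j, z j * e j + v i) fun i => by fun_prop
  have hYmeas : ∀ i, Measurable (Y i) := fun i => (Finset.measurable_sum _ fun j _ =>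
    (hX.measurable (Finset.disjoint_iff_ne.1 hdisj _ i.2 _ j.2)).mul_const _).add_const _
  have hYcos : ∀ i, ∫ ω, Real.cos (τ * Y i ω) ∂P ≤ q₀ := fun i =>
    H Ω P T _ _ (hX.indepPairs_row (Finset.mem_compl.1 i.2)) (fun j => e j)
      (he_sum.trans_eq (restrict_sum _ fun j hj => by rw [heT j hj, zero_pow two_ne_zero]))
      (fun j => he j) (v i)
  have hcard : (Fintype.card ι : ℝ) / 2 ≤ Fintype.card ↥(Tᶜ) := by
    rw [Fintype.card_coe, Finset.card_compl, Nat.cast_sub (Finset.card_le_univ T)]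
    have : (2 * T.card : ℝ) ≤ Fintype.card ι := by exact_mod_cast hT
    linarith
  simp_rw [hYsum]
  refine (measureReal_sum_sq_le_of_iIndepFun hYmeas hYind hYcos _).trans ?_
  exact exp_mul_pow_le_pow hq0 hq1.le hτ hcard

theorem exists_sum_sq_image_le {ρ : ℝ} (hρ0 : 0 ≤ ρ) (hρ : ρ < 1) (M : ℝ) :
    ∃ c q : ℝ, 0 < c ∧ 0 < q ∧ q < 1 ∧ ∀ (Ω : Type*) [MeasurableSpace Ω] (P : Measure Ω)
      [IsProbabilityMeasure P] (ι : Type*) [Fintype ι] [LinearOrder ι] (X : Ω → ι → ι → ℝ),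
      EllipticEntries P X ρ M → ∀ (y : ι → ℂ) (T : Finset ι), (∀ j ∉ T, y j = 0) →
      2 * T.card ≤ Fintype.card ι → 1 / 4 ≤ ∑ j, ‖y j‖ ^ 2 → ∑ j, ‖y j‖ ^ 2 ≤ 4 → ∀ v : ι → ℂ,
      P.real {ω | ∑ i ∈ Tᶜ, ‖∑ j, (X ω i j : ℂ) * y j + v i‖ ^ 2 ≤ c * Fintype.card ι}
        ≤ q ^ Fintype.card ι := by
  obtain ⟨c, q, hc, hq, hq1, H⟩ := exists_sum_sq_image_real_le hρ0 hρ M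
  refine ⟨c, q, hc, hq, hq1, fun Ω _ P _ ι _ _ X hX y T hyT hT hy_lower hy_upper v => ?_⟩
  have bound_of_realLinear : ∀ f : ℂ →ₗ[ℝ] ℝ, (∀ z, |f z| ≤ ‖z‖) → 1 / 8 ≤ ∑ j, f (y j) ^ 2 →
      P.real {ω | ∑ i ∈ Tᶜ, ‖∑ j, (X ω i j : ℂ) * y j + v i‖ ^ 2 ≤ c * Fintype.card ι}
        ≤ q ^ Fintype.card ι := by
    intro f hf hf_sum
    have hf_sq : ∀ z, f z ^ 2 ≤ ‖z‖ ^ 2 := fun z => by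
      rw [← sq_abs]
      gcongr
      exact hf z
    have hf_image : ∀ ω i, ∑ j, X ω i j * f (y j) + f (v i)
        = f (∑ j, (X ω i j : ℂ) * y j + v i) := fun ω i => by
      simp only [map_add, map_sum, ← Complex.real_smul, map_smul, smul_eq_mul]
    refine (measureReal_mono fun ω hω => ?_).trans
      (H Ω P ι X hX (fun j => f (y j)) T (fun j hj => by rw [hyT j hj, map_zero]) hT hf_sum
        (fun j => ?_) (fun i => f (v i)))
    · simp only [Set.mem_ofPred_eq, hf_image] at hω ⊢
      exact (Finset.sum_le_sum fun i _ => hf_sq _).trans hω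
    · exact (hf_sq _).trans ((Finset.single_le_sum (f := fun j => ‖y j‖ ^ 2)
        (fun i _ => by positivity) (Finset.mem_univ j)).trans hy_upper)
  have hsum : ∑ j, ‖y j‖ ^ 2 = ∑ j, (y j).re ^ 2 + ∑ j, (y j).im ^ 2 := by
    simp only [← Finset.sum_add_distrib, Complex.sq_norm, Complex.normSq_apply, ← sq]
  rcases le_total (1 / 8) (∑ j, (y j).re ^ 2) with h | h
  · exact bound_of_realLinear Complex.reLm Complex.abs_re_le_norm h
  · exact bound_of_realLinear Complex.imLm Complex.abs_im_le_norm
      (by simp only [Complex.imLm_coe]; linarith)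

end FixedVector

/-- The Euclidean norm of a complex vector. -/
noncomputable def l2 {ι : Type*} [Fintype ι] (x : ι → ℂ) : ℝ := √(∑ i, ‖x i‖ ^ 2)

section l2

variable {ι : Type*} [Fintype ι]

lemma l2_eq_norm (x : ι → ℂ) : l2 x = ‖WithLp.toLp 2 x‖ := (EuclideanSpace.norm_eq _).symm

lemma l2_nonneg (x : ι → ℂ) : 0 ≤ l2 x := Real.sqrt_nonneg _

lemma l2_sq (x : ι → ℂ) : l2 x ^ 2 = ∑ i, ‖x i‖ ^ 2 :=
  Real.sq_sqrt (Finset.sum_nonneg fun _ _ => by positivity)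

lemma l2_add_le (x y : ι → ℂ) : l2 (x + y) ≤ l2 x + l2 y := by
  simp only [l2_eq_norm, WithLp.toLp_add]; exact norm_add_le _ _

lemma l2_sub_le (x y : ι → ℂ) : l2 (x - y) ≤ l2 x + l2 y := by
  simp only [l2_eq_norm, WithLp.toLp_sub]; exact norm_sub_le _ _

lemma l2_smul (c : ℂ) (x : ι → ℂ) : l2 (c • x) = ‖c‖ * l2 x := by
  simp only [l2_eq_norm, WithLp.toLp_smul]; exact norm_smul _ _

lemma l2_eq_zero {x : ι → ℂ} : l2 x = 0 ↔ x = 0 := by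
  rw [l2_eq_norm, norm_eq_zero, WithLp.toLp_eq_zero]

lemma l2_zero : l2 (0 : ι → ℂ) = 0 := l2_eq_zero.2 rfl

lemma l2_le_of_sum_sq_le {x : ι → ℂ} {r : ℝ} (hr : 0 ≤ r) (h : ∑ i, ‖x i‖ ^ 2 ≤ r ^ 2) :
    l2 x ≤ r := Real.sqrt_le_iff.2 ⟨hr, h⟩

lemma norm_sum_mul_le_l2 (x y : ι → ℂ) : ‖∑ i, x i * y i‖ ≤ l2 x * l2 y :=
  calc ‖∑ i, x i * y i‖ ≤ ∑ i, ‖x i‖ * ‖y i‖ :=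
        (norm_sum_le _ _).trans_eq (by simp_rw [norm_mul])
    _ ≤ _ := Real.sum_mul_le_sqrt_mul_sqrt _ _ _

lemma sum_norm_le_sqrt_card_mul_l2 (B : Finset ι) (x : ι → ℂ) :
    ∑ i ∈ B, ‖x i‖ ≤ √B.card * l2 x := by
  have partial_sq : ∑ i ∈ B, ‖x i‖ ^ 2 ≤ l2 x ^ 2 := by
    rw [l2_sq]
    exact Finset.sum_le_sum_of_subset_of_nonneg (Finset.subset_univ _) fun _ _ _ => by positivity
  apply le_of_sq_le_sq _ (mul_nonneg (Real.sqrt_nonneg _) (l2_nonneg x))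
  calc (∑ i ∈ B, ‖x i‖) ^ 2 ≤ B.card * ∑ i ∈ B, ‖x i‖ ^ 2 := sq_sum_le_card_mul_sum_sq
    _ ≤ (√B.card * l2 x) ^ 2 := by
        rw [mul_pow, Real.sq_sqrt (Nat.cast_nonneg _)]
        gcongr

end l2

/-- `A` has operator norm at most `k` on Euclidean space. -/
def OpBound {ι : Type*} [Fintype ι] (A : Matrix ι ι ℂ) (k : ℝ) : Prop :=
  ∀ x : ι → ℂ, l2 (A.mulVec x) ≤ k * l2 x

open Classical in
/-- A positive proportion `b` of the coordinates of `x` are at least `a` times their typical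
size `l2 x / √(card ι)`; this plays the role of incompressibility. -/
def Spread {ι : Type*} [Fintype ι] (a b : ℝ) (x : ι → ℂ) : Prop :=
  b * Fintype.card ι
    ≤ ((Finset.univ.filter fun i => a * l2 x ≤ √(Fintype.card ι) * ‖x i‖).card : ℝ)

/-- The complex matrix with off-diagonal entries from `Y` and diagonal `d`. -/
def withDiag {ι : Type*} [DecidableEq ι] (Y : ι → ι → ℝ) (d : ι → ℂ) : Matrix ι ι ℂ :=
  Matrix.of fun i j => if i = j then d i else (Y i j : ℂ)

lemma OpBound.l2_mulVec_sub_smul_le {ι : Type*} [Fintype ι] {A : Matrix ι ι ℂ} {k : ℝ}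
    (hA : OpBound A k) (x y w : ι → ℂ) (s t : ℂ) :
    l2 (A.mulVec y - t • w) ≤ l2 (A.mulVec x - s • w) + k * l2 (x - y) + ‖s - t‖ * l2 w := by
  have split : A.mulVec y - t • w
      = (A.mulVec x - s • w) + ((s - t) • w - A.mulVec (x - y)) := by
    rw [Matrix.mulVec_sub, sub_smul]; abel
  rw [split]
  have outer := l2_add_le (A.mulVec x - s • w) ((s - t) • w - A.mulVec (x - y))
  have inner := l2_sub_le ((s - t) • w) (A.mulVec (x - y))
  have image := hA (x - y)
  rw [l2_smul] at inner
  linarith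

/-- Rows outside the support of `y` do not see the diagonal. -/
lemma sum_compl_sq_le_l2_withDiag_mulVec {ι : Type*} [Fintype ι] [DecidableEq ι]
    (Y : ι → ι → ℝ) (d y v : ι → ℂ) {T : Finset ι} (hT : ∀ j ∉ T, y j = 0) :
    ∑ i ∈ Tᶜ, ‖∑ j, (Y i j : ℂ) * y j + v i‖ ^ 2 ≤ l2 ((withDiag Y d).mulVec y + v) ^ 2 := by
  rw [l2_sq]
  refine le_trans (Finset.sum_le_sum fun i hi => le_of_eq ?_) (Finset.sum_le_sum_of_subset_of_nonneg
    (Finset.subset_univ Tᶜ) fun _ _ _ => by positivity)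
  rw [Pi.add_apply, Matrix.mulVec, dotProduct]
  congr 3
  refine Finset.sum_congr rfl fun j _ => ?_
  rcases eq_or_ne i j with rfl | hij
  · rw [hT i (Finset.mem_compl.1 hi), mul_zero, mul_zero]
  · rw [withDiag, Matrix.of_apply, if_neg hij]

section GaussianGrid

/-- The Gaussian integer `p.1 + p.2 i`, scaled to the mesh `h`. -/
noncomputable def gaussianPoint (h : ℝ) (p : ℤ × ℤ) : ℂ := h * (p.1 + p.2 * Complex.I)

/-- The point of the Gaussian grid of mesh `h` that is nearest to `x`. -/
noncomputable def gaussianRound (h : ℝ) (x : ℂ) : ℤ × ℤ := (round (x.re / h), round (x.im / h))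

/-- The Gaussian integers with both parts at most `N` in absolute value. -/
noncomputable def gaussianBox (N : ℕ) : Finset (ℤ × ℤ) :=
  Finset.Icc (-N : ℤ) N ×ˢ Finset.Icc (-N : ℤ) N

variable (ι : Type*) [Fintype ι]

open Classical in
/-- The vectors of Gaussian integers whose `ℓ¹` norm, the sum of the absolute values of all real
and imaginary parts, is at most `T`. The box only makes the set finite; see `mem_gaussianBall`. -/
noncomputable def gaussianBall (T : ℝ) : Finset (ι → ℤ × ℤ) :=
  (Fintype.piFinset fun _ : ι => gaussianBox ⌈T⌉₊).filter fun z =>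
    ((∑ i, ((z i).1.natAbs + (z i).2.natAbs) : ℕ) : ℝ) ≤ T

variable {ι}

lemma gaussianPoint_zero (h : ℝ) : gaussianPoint h 0 = 0 := by simp [gaussianPoint]

lemma norm_sub_gaussianPoint_gaussianRound_le {h : ℝ} (hh : 0 < h) (x : ℂ) :
    ‖x - gaussianPoint h (gaussianRound h x)‖ ≤ h := by
  have coordinate (t : ℝ) : (t - h * round (t / h)) ^ 2 ≤ h ^ 2 / 4 := by
    have factor : t - h * round (t / h) = h * (t / h - round (t / h)) := by field_simp
    have : |t / h - round (t / h)| ^ 2 ≤ (1 / 2) ^ 2 := by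
      have := abs_sub_round (t / h)
      gcongr
    rw [factor, mul_pow, ← sq_abs (t / h - round (t / h))]
    nlinarith [sq_nonneg h]
  have re_sq := coordinate x.re
  have im_sq := coordinate x.im
  apply le_of_sq_le_sq _ hh.le
  rw [← Complex.normSq_eq_norm_sq, Complex.normSq_apply]
  simp only [gaussianPoint, gaussianRound, Complex.sub_re, Complex.sub_im, Complex.mul_re,
    Complex.mul_im, Complex.ofReal_re, Complex.ofReal_im, Complex.add_re, Complex.add_im,
    Complex.intCast_re, Complex.intCast_im, Complex.I_re, Complex.I_im]
  ring_nf at re_sq im_sq ⊢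
  linarith [sq_nonneg h]

lemma abs_round_le_two_mul (y : ℝ) : |(round y : ℝ)| ≤ 2 * |y| := by
  rcases lt_or_ge |y| (1 / 2) with h | h
  · have round_eq : round y = 0 := round_eq_zero_iff.2 ⟨(abs_lt.1 h).1.le, (abs_lt.1 h).2⟩
    simp [round_eq]
  · have triangle := abs_sub y (y - round y)
    rw [sub_sub_cancel] at triangle
    linarith [abs_sub_round y]

lemma natAbs_gaussianRound_le {h : ℝ} (hh : 0 < h) (x : ℂ) :
    ((gaussianRound h x).1.natAbs + (gaussianRound h x).2.natAbs : ℝ) ≤ 4 / h * ‖x‖ := by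
  have coordinate {t : ℝ} (ht : |t| ≤ ‖x‖) : |(round (t / h) : ℝ)| ≤ 2 * (‖x‖ / h) := by
    refine (abs_round_le_two_mul _).trans ?_
    rw [abs_div, abs_of_pos hh]
    gcongr
  simp only [gaussianRound, Nat.cast_natAbs, Int.cast_abs]
  calc _ ≤ 2 * (‖x‖ / h) + 2 * (‖x‖ / h) :=
        add_le_add (coordinate (Complex.abs_re_le_norm x)) (coordinate (Complex.abs_im_le_norm x))
    _ = 4 / h * ‖x‖ := by ring

lemma mem_gaussianBox {N : ℕ} {p : ℤ × ℤ} :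
    p ∈ gaussianBox N ↔ p.1.natAbs ≤ N ∧ p.2.natAbs ≤ N := by
  simp only [gaussianBox, Finset.mem_product, Finset.mem_Icc]
  omega

lemma card_gaussianBox (N : ℕ) : (gaussianBox N).card = (2 * N + 1) ^ 2 := by
  rw [gaussianBox, Finset.card_product, Int.card_Icc, sq]
  congr 1 <;> omega

lemma gaussianRound_mem_gaussianBox {h : ℝ} (hh : 0 < h) {x : ℂ} {R : ℝ} (hx : ‖x‖ ≤ R * h) :
    gaussianRound h x ∈ gaussianBox ⌈4 * R⌉₊ := by
  have total : ((gaussianRound h x).1.natAbs + (gaussianRound h x).2.natAbs : ℝ) ≤ ⌈4 * R⌉₊ :=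
    calc _ ≤ 4 / h * ‖x‖ := natAbs_gaussianRound_le hh x
      _ ≤ 4 / h * (R * h) := by gcongr
      _ = 4 * R := by field_simp
      _ ≤ _ := Nat.le_ceil _
  norm_cast at total
  exact mem_gaussianBox.2 (by omega)

lemma mem_gaussianBall {T : ℝ} {z : ι → ℤ × ℤ} :
    z ∈ gaussianBall ι T ↔ ((∑ i, ((z i).1.natAbs + (z i).2.natAbs) : ℕ) : ℝ) ≤ T := by
  classical
  rw [gaussianBall, Finset.mem_filter, and_iff_right_iff_imp, Fintype.mem_piFinset]
  intro hz i
  have coordinate : (z i).1.natAbs + (z i).2.natAbs ≤ ∑ i, ((z i).1.natAbs + (z i).2.natAbs) :=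
    Finset.single_le_sum (f := fun i => (z i).1.natAbs + (z i).2.natAbs)
      (fun _ _ => Nat.zero_le _) (Finset.mem_univ i)
  have total : ∑ i, ((z i).1.natAbs + (z i).2.natAbs) ≤ ⌈T⌉₊ := by
    exact_mod_cast hz.trans (Nat.le_ceil T)
  exact mem_gaussianBox.2 (by omega)

lemma gaussianBall_mono {S T : ℝ} (h : S ≤ T) : gaussianBall ι S ⊆ gaussianBall ι T :=
  fun _ hz => mem_gaussianBall.2 ((mem_gaussianBall.1 hz).trans h)

lemma sum_Icc_pow_natAbs_le {r : ℝ} (hr0 : 0 < r) (hr1 : r ≤ 1 / 2) (N : ℕ) :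
    ∑ z ∈ Finset.Icc (-N : ℤ) N, r ^ z.natAbs ≤ 1 + 4 * r := by
  suffices sharper : ∑ z ∈ Finset.Icc (-N : ℤ) N, r ^ z.natAbs ≤ 1 + 4 * r - 4 * r ^ (N + 1) by
    have : 0 < r ^ (N + 1) := by positivity
    linarith
  induction N with
  | zero => simp
  | succ N ih =>
    have endpoints : Finset.Icc (-((N + 1 : ℕ) : ℤ)) ((N + 1 : ℕ) : ℤ)
        = insert (-((N + 1 : ℕ) : ℤ)) (insert ((N + 1 : ℕ) : ℤ) (Finset.Icc (-N : ℤ) N)) := by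
      ext z
      simp only [Finset.mem_Icc, Finset.mem_insert]
      omega
    rw [endpoints, Finset.sum_insert (by simp only [Finset.mem_insert, Finset.mem_Icc]; omega),
      Finset.sum_insert (by simp only [Finset.mem_Icc]; omega), Int.natAbs_neg,
      Int.natAbs_natCast]
    have : r ^ (N + 1 + 1) ≤ 1 / 2 * r ^ (N + 1) := by
      rw [pow_succ, mul_comm]; gcongr
    linarith

lemma sum_gaussianBox_pow_le {r : ℝ} (hr0 : 0 < r) (hr1 : r ≤ 1 / 2) (N : ℕ) :
    ∑ p ∈ gaussianBox N, r ^ (p.1.natAbs + p.2.natAbs) ≤ (1 + 4 * r) ^ 2 := by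
  simp_rw [pow_add]
  rw [gaussianBox, Finset.sum_product]
  dsimp only
  rw [← Finset.sum_mul_sum, ← sq]
  have : 0 ≤ ∑ z ∈ Finset.Icc (-N : ℤ) N, r ^ z.natAbs :=
    Finset.sum_nonneg fun _ _ => by positivity
  gcongr
  exact sum_Icc_pow_natAbs_le hr0 hr1 N

/-- Markov's inequality for the counting measure: each vector in the ball weighs at least `r ^ T`
in the product `(∑ r ^ ‖p‖₁) ^ card ι`. -/
lemma card_gaussianBall_le {r : ℝ} (hr0 : 0 < r) (hr1 : r ≤ 1 / 2) (T : ℝ) :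
    ((gaussianBall ι T).card : ℝ)
      ≤ Real.exp (-Real.log r * T) * ((1 + 4 * r) ^ 2) ^ Fintype.card ι := by
  classical
  let norm₁ (z : ι → ℤ × ℤ) : ℕ := ∑ i, ((z i).1.natAbs + (z i).2.natAbs)
  have log_neg : Real.log r < 0 := Real.log_neg hr0 (by linarith)
  have one_le_weight : ∀ z ∈ gaussianBall ι T,
      1 ≤ Real.exp (-Real.log r * T) * r ^ norm₁ z := by
    intro z hz
    have : (norm₁ z : ℝ) ≤ T := mem_gaussianBall.1 hz
    rw [← Real.rpow_natCast, Real.rpow_def_of_pos hr0, ← Real.exp_add, Real.one_le_exp_iff]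
    nlinarith
  calc ((gaussianBall ι T).card : ℝ) = ∑ _z ∈ gaussianBall ι T, (1 : ℝ) := by simp
    _ ≤ ∑ z ∈ gaussianBall ι T, Real.exp (-Real.log r * T) * r ^ norm₁ z :=
        Finset.sum_le_sum one_le_weight
    _ ≤ ∑ z ∈ Fintype.piFinset fun _ : ι => gaussianBox ⌈T⌉₊,
          Real.exp (-Real.log r * T) * r ^ norm₁ z :=
        Finset.sum_le_sum_of_subset_of_nonneg (Finset.filter_subset _ _)
          fun _ _ _ => by positivity
    _ = Real.exp (-Real.log r * T) * ∏ _i : ι, ∑ p ∈ gaussianBox ⌈T⌉₊,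
          r ^ (p.1.natAbs + p.2.natAbs) := by
        rw [← Finset.mul_sum, Finset.prod_univ_sum]
        congr 1
        exact Finset.sum_congr rfl fun z _ => (Finset.prod_pow_eq_pow_sum _ _ _).symm
    _ ≤ _ := by
        rw [Finset.prod_const, Finset.card_univ]
        gcongr
        exact sum_gaussianBox_pow_le hr0 hr1 _

lemma exists_card_gaussianBall_le {L : ℝ} (hL : 0 < L) :
    ∃ t : ℝ, 0 < t ∧ ∀ (ι : Type*) [Fintype ι],
      ((gaussianBall ι (t * Fintype.card ι)).card : ℝ) ≤ Real.exp (L * Fintype.card ι) := by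
  let r : ℝ := min (1 / 2) (L / 16)
  have r_pos : 0 < r := by positivity
  have r_le_half : r ≤ 1 / 2 := min_le_left _ _
  have neg_log_pos : 0 < -Real.log r := by
    have := Real.log_neg r_pos (by linarith)
    linarith
  have base_le : (1 + 4 * r) ^ 2 ≤ Real.exp (L / 2) :=
    calc (1 + 4 * r) ^ 2 ≤ Real.exp (4 * r) ^ 2 := by
          gcongr; linarith [Real.add_one_le_exp (4 * r)]
      _ = Real.exp (8 * r) := by rw [← Real.exp_nat_mul]; congr 1; push_cast; ring
      _ ≤ Real.exp (L / 2) := Real.exp_le_exp.2 (by linarith [min_le_right (1 / 2 : ℝ) (L / 16)])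
  refine ⟨L / (2 * -Real.log r), by positivity, fun ι _ => ?_⟩
  have exponent_eq : -Real.log r * (L / (2 * -Real.log r) * Fintype.card ι)
      = L / 2 * Fintype.card ι := by
    have := neg_log_pos.ne'
    generalize -Real.log r = l at *
    field_simp
  calc _ ≤ Real.exp (-Real.log r * (L / (2 * -Real.log r) * Fintype.card ι))
          * ((1 + 4 * r) ^ 2) ^ Fintype.card ι := card_gaussianBall_le r_pos r_le_half _
    _ ≤ Real.exp (L / 2 * Fintype.card ι) * Real.exp (L / 2) ^ Fintype.card ι := by
        rw [exponent_eq]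
        gcongr
    _ = _ := by rw [← Real.exp_nat_mul, ← Real.exp_add]; congr 1; ring

end GaussianGrid

section NotSpread

variable {ι : Type*} [Fintype ι]

lemma sum_natAbs_gaussianRound_le {h : ℝ} (hh : 0 < h) [DecidableEq ι] (B : Finset ι) (x : ι → ℂ) :
    ((∑ i, ((if i ∈ B then gaussianRound h (x i) else 0).1.natAbs
        + (if i ∈ B then gaussianRound h (x i) else 0).2.natAbs) : ℕ) : ℝ)
      ≤ 4 / h * (√B.card * l2 x) := by
  have coordinate (i) : (((if i ∈ B then gaussianRound h (x i) else 0).1.natAbs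
      + (if i ∈ B then gaussianRound h (x i) else 0).2.natAbs : ℕ) : ℝ)
        ≤ if i ∈ B then 4 / h * ‖x i‖ else 0 := by
    by_cases hi : i ∈ B
    · simpa only [if_pos hi, Nat.cast_add] using natAbs_gaussianRound_le hh (x i)
    · simp [if_neg hi]
  rw [Nat.cast_sum]
  calc _ ≤ ∑ i, if i ∈ B then 4 / h * ‖x i‖ else 0 := Finset.sum_le_sum fun i _ => coordinate i
    _ = 4 / h * ∑ i ∈ B, ‖x i‖ := by rw [Finset.sum_ite_mem, Finset.univ_inter, Finset.mul_sum]
    _ ≤ _ := by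
        gcongr
        exact sum_norm_le_sqrt_card_mul_l2 B x

/-- Round the few large coordinates to the grid and replace the others by `0`. -/
lemma exists_gaussianPoint_approx_of_not_spread [Nonempty ι] {a b : ℝ} (ha : 0 < a) (hb : 0 ≤ b)
    {x : ι → ℂ} (hx : l2 x = 1) (hs : ¬ Spread a b x) :
    ∃ z ∈ gaussianBall ι (4 * √b / a * Fintype.card ι),
      l2 (x - fun i => gaussianPoint (a / √(Fintype.card ι)) (z i)) ≤ a ∧
      ((Finset.univ.filter fun i => z i ≠ 0).card : ℝ) ≤ b * Fintype.card ι := by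
  classical
  set n := Fintype.card ι with hn
  have n_pos : (0 : ℝ) < n := by exact_mod_cast Fintype.card_pos
  set h := a / √n with hh
  have h_pos : 0 < h := by positivity
  have mesh_sq : n * h ^ 2 = a ^ 2 := by
    rw [hh, div_pow, Real.sq_sqrt n_pos.le]; field_simp
  let B : Finset ι := Finset.univ.filter fun i => a * l2 x ≤ √n * ‖x i‖
  have card_B_le : (B.card : ℝ) ≤ b * n := by
    rw [Spread, not_le] at hs
    convert hs.le
  have norm_le_of_notMem (i) (hi : i ∉ B) : ‖x i‖ ≤ h := by
    simp only [B, Finset.mem_filter, Finset.mem_univ, true_and, not_le, hx, mul_one] at hi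
    rw [hh, le_div_iff₀ (by positivity)]
    linarith
  let z : ι → ℤ × ℤ := fun i => if i ∈ B then gaussianRound h (x i) else 0
  refine ⟨z, mem_gaussianBall.2 ?_, l2_le_of_sum_sq_le ha.le ?_, le_trans ?_ card_B_le⟩
  · calc _ ≤ 4 / h * (√B.card * l2 x) := sum_natAbs_gaussianRound_le h_pos B x
      _ ≤ 4 / h * (√(b * n) * 1) := by
          rw [hx]
          gcongr
      _ = 4 * √b / a * n := by
          rw [hh, Real.sqrt_mul hb]
          field_simp
          rw [Real.sq_sqrt n_pos.le, mul_comm]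
  · rw [← mesh_sq, hn, ← Finset.card_univ, ← nsmul_eq_mul]
    refine Finset.sum_le_card_nsmul _ _ _ fun i _ => ?_
    gcongr
    by_cases hi : i ∈ B
    · simpa only [Pi.sub_apply, z, if_pos hi] using norm_sub_gaussianPoint_gaussianRound_le h_pos _
    · simpa only [Pi.sub_apply, z, if_neg hi, gaussianPoint_zero, sub_zero]
        using norm_le_of_notMem i hi
  · norm_cast
    refine Finset.card_le_card fun i hi => ?_
    by_contra hiB
    exact (Finset.mem_filter.1 hi).2 (if_neg hiB)

lemma exists_gaussianPoint_image_le_of_not_spread [Nonempty ι] [DecidableEq ι]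
    {Y : ι → ι → ℝ} {d w x : ι → ℂ} {s : ℂ} {a b K : ℝ} (ha : 0 < a) (ha' : a ≤ 1 / 4)
    (hb : 0 ≤ b) (hb' : b ≤ 1 / 2) (hK : 0 ≤ K)
    (hop : OpBound (withDiag Y d) (K * √(Fintype.card ι))) (hw : l2 w ≤ 1) (hx : l2 x = 1)
    (hsp : ¬ Spread a b x) (hs : ‖s‖ ≤ K * √(Fintype.card ι))
    (hAx : l2 ((withDiag Y d).mulVec x - s • w) ≤ a * √(Fintype.card ι)) :
    ∃ z ∈ gaussianBall ι (4 * √b / a * Fintype.card ι), ∃ σ ∈ gaussianBox ⌈4 * (K / a)⌉₊,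
      let T : Finset ι := Finset.univ.filter fun i => z i ≠ 0
      let y : ι → ℂ := fun i => gaussianPoint (a / √(Fintype.card ι)) (z i)
      2 * T.card ≤ Fintype.card ι ∧ 1 / 4 ≤ ∑ j, ‖y j‖ ^ 2 ∧ ∑ j, ‖y j‖ ^ 2 ≤ 4 ∧
      ∑ i ∈ Tᶜ, ‖∑ j, (Y i j : ℂ) * y j
          + (-(gaussianPoint (a * √(Fintype.card ι)) σ • w)) i‖ ^ 2
        ≤ ((2 + K) * a) ^ 2 * Fintype.card ι := by
  obtain ⟨z, z_mem, approx, card_le⟩ := exists_gaussianPoint_approx_of_not_spread ha hb hx hsp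
  set n := Fintype.card ι
  have n_pos : (0 : ℝ) < n := by exact_mod_cast Fintype.card_pos
  have mesh_pos : 0 < a * √n := by positivity
  let σ := gaussianRound (a * √n) s
  have σ_mem : σ ∈ gaussianBox ⌈4 * (K / a)⌉₊ :=
    gaussianRound_mem_gaussianBox mesh_pos (hs.trans_eq (by field_simp))
  refine ⟨z, z_mem, σ, σ_mem, ?_⟩
  intro T y
  have y_eq_zero (j) (hj : j ∉ T) : y j = 0 := by
    have : z j = 0 := by simpa [T] using hj
    simp only [y, this, gaussianPoint_zero]
  have l2_y_le : l2 y ≤ 5 / 4 := by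
    have := l2_sub_le x (x - y)
    rw [sub_sub_cancel] at this
    linarith
  have le_l2_y : 3 / 4 ≤ l2 y := by
    have := l2_add_le (x - y) y
    rw [sub_add_cancel] at this
    linarith
  have image_le : l2 ((withDiag Y d).mulVec y - gaussianPoint (a * √n) σ • w)
      ≤ (2 + K) * a * √n :=
    calc _ ≤ l2 ((withDiag Y d).mulVec x - s • w) + K * √n * l2 (x - y)
          + ‖s - gaussianPoint (a * √n) σ‖ * l2 w := hop.l2_mulVec_sub_smul_le x y w s _
      _ ≤ a * √n + K * √n * a + a * √n * 1 := by
          gcongr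
          · exact l2_nonneg w
          · exact norm_sub_gaussianPoint_gaussianRound_le mesh_pos s
      _ = (2 + K) * a * √n := by ring
  refine ⟨?_, by rw [← l2_sq]; nlinarith, by rw [← l2_sq]; nlinarith, ?_⟩
  · have : (2 * T.card : ℝ) ≤ n := by nlinarith
    exact_mod_cast this
  · refine (sum_compl_sq_le_l2_withDiag_mulVec Y d y _ y_eq_zero).trans ?_
    rw [← sub_eq_add_neg]
    calc _ ≤ ((2 + K) * a * √n) ^ 2 := by gcongr; exact l2_nonneg _
      _ = _ := by rw [mul_pow, Real.sq_sqrt n_pos.le]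

lemma exp_neg_le_two_div_sq {t : ℝ} (ht : 0 < t) : Real.exp (-t) ≤ 2 / t ^ 2 := by
  rw [Real.exp_neg, inv_le_comm₀ (Real.exp_pos t) (by positivity), inv_div]
  linarith [Real.quadratic_le_exp_of_nonneg ht.le]

/-- A union bound over the grid points that approximate the vectors `x` and the scalars `s`. -/
lemma measureReal_not_spread_le {Ω : Type*} [MeasurableSpace Ω] {P : Measure Ω} [IsFiniteMeasure P]
    [DecidableEq ι] [Nonempty ι] {Y : Ω → ι → ι → ℝ} {a b c K p : ℝ} (ha : 0 < a)
    (ha' : a ≤ 1 / 4) (hb : 0 ≤ b) (hb' : b ≤ 1 / 2) (hK : 0 ≤ K) (hc : ((2 + K) * a) ^ 2 ≤ c)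
    (hp : 0 ≤ p)
    (fixed_vector : ∀ (y : ι → ℂ) (T : Finset ι), (∀ j ∉ T, y j = 0) →
      2 * T.card ≤ Fintype.card ι → 1 / 4 ≤ ∑ j, ‖y j‖ ^ 2 → ∑ j, ‖y j‖ ^ 2 ≤ 4 → ∀ v : ι → ℂ,
      P.real {ω | ∑ i ∈ Tᶜ, ‖∑ j, (Y ω i j : ℂ) * y j + v i‖ ^ 2 ≤ c * Fintype.card ι} ≤ p)
    (d : ι → ℂ) {w : ι → ℂ} (hw : l2 w ≤ 1) :
    P.real {ω | OpBound (withDiag (Y ω) d) (K * √(Fintype.card ι)) ∧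
        ∃ (x : ι → ℂ) (s : ℂ), l2 x = 1 ∧ ¬ Spread a b x ∧ ‖s‖ ≤ K * √(Fintype.card ι) ∧
          l2 ((withDiag (Y ω) d).mulVec x - s • w) ≤ a * √(Fintype.card ι)}
      ≤ (gaussianBall ι (4 * √b / a * Fintype.card ι)).card * (2 * ⌈4 * (K / a)⌉₊ + 1) ^ 2 * p := by
  set n := Fintype.card ι
  let y (z : ι → ℤ × ℤ) (i : ι) : ℂ := gaussianPoint (a / √n) (z i)
  let T (z : ι → ℤ × ℤ) : Finset ι := Finset.univ.filter fun i => z i ≠ 0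
  let G := (gaussianBall ι (4 * √b / a * n)).filter fun z => 2 * (T z).card ≤ n ∧
    1 / 4 ≤ ∑ j, ‖y z j‖ ^ 2 ∧ ∑ j, ‖y z j‖ ^ 2 ≤ 4
  let S := gaussianBox ⌈4 * (K / a)⌉₊
  let E (g : (ι → ℤ × ℤ) × (ℤ × ℤ)) : Set Ω :=
    {ω | ∑ i ∈ (T g.1)ᶜ, ‖∑ j, (Y ω i j : ℂ) * y g.1 j
      + (-(gaussianPoint (a * √n) g.2 • w)) i‖ ^ 2 ≤ c * n}
  have cover : {ω | OpBound (withDiag (Y ω) d) (K * √n) ∧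
        ∃ (x : ι → ℂ) (s : ℂ), l2 x = 1 ∧ ¬ Spread a b x ∧ ‖s‖ ≤ K * √n ∧
          l2 ((withDiag (Y ω) d).mulVec x - s • w) ≤ a * √n} ⊆ ⋃ g ∈ G ×ˢ S, E g := by
    rintro ω ⟨hop, x, s, hx, hsp, hs, hAx⟩
    obtain ⟨z, z_mem, σ, σ_mem, support, lower, upper, image⟩ :=
      exists_gaussianPoint_image_le_of_not_spread ha ha' hb hb' hK hop hw hx hsp hs hAx
    exact Set.mem_biUnion (x := (z, σ)) (Finset.mem_product.2
      ⟨Finset.mem_filter.2 ⟨z_mem, support, lower, upper⟩, σ_mem⟩) (image.trans (by gcongr))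
  have event_le (g) (hg : g ∈ G ×ˢ S) : P.real (E g) ≤ p := by
    obtain ⟨support, lower, upper⟩ := (Finset.mem_filter.1 (Finset.mem_product.1 hg).1).2
    refine fixed_vector (y g.1) (T g.1) (fun j hj => ?_) support lower upper _
    have : g.1 j = 0 := by simpa [T] using hj
    simp only [y, this, gaussianPoint_zero]
  calc _ ≤ P.real (⋃ g ∈ G ×ˢ S, E g) := measureReal_mono cover (measure_ne_top _ _)
    _ ≤ ∑ g ∈ G ×ˢ S, P.real (E g) := measureReal_biUnion_finset_le _ _
    _ ≤ ∑ _g ∈ G ×ˢ S, p := Finset.sum_le_sum event_le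
    _ = G.card * (2 * ⌈4 * (K / a)⌉₊ + 1) ^ 2 * p := by
        rw [Finset.sum_const, nsmul_eq_mul, Finset.card_product, card_gaussianBox]; push_cast; ring
    _ ≤ _ := by
        gcongr
        exact Finset.filter_subset _ _

lemma exp_half_mul_exp_neg_le {L n : ℝ} (hL : 0 < L) (hn : 0 < n) :
    Real.exp (L / 2 * n) * Real.exp (-(L * n)) ≤ 8 / L ^ 2 / n ^ 2 :=
  calc _ = Real.exp (-(L / 2 * n)) := by rw [← Real.exp_add]; congr 1; ring
    _ ≤ 2 / (L / 2 * n) ^ 2 := exp_neg_le_two_div_sq (by positivity)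
    _ = _ := by field_simp; ring

/-- The grid has `exp (L n / 2)` elements, while each of them is badly mapped with probability at
most `q ^ n = exp (-L n)`. -/
theorem exists_not_spread_le {ρ : ℝ} (hρ0 : 0 ≤ ρ) (hρ : ρ < 1) (M : ℝ) {K : ℝ} (hK : 0 < K) :
    ∃ a b C : ℝ, 0 < a ∧ 0 < b ∧ b ≤ 1 ∧ 0 < C ∧ ∀ (Ω : Type*) [MeasurableSpace Ω] (P : Measure Ω)
      [IsProbabilityMeasure P] (ι : Type*) [Fintype ι] [LinearOrder ι] [Nonempty ι]
      (X : Ω → ι → ι → ℝ), EllipticEntries P X ρ M → ∀ (d w : ι → ℂ), l2 w ≤ 1 →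
      P.real {ω | OpBound (withDiag (X ω) d) (K * √(Fintype.card ι)) ∧
        ∃ (x : ι → ℂ) (s : ℂ), l2 x = 1 ∧ ¬ Spread a b x ∧ ‖s‖ ≤ K * √(Fintype.card ι) ∧
          l2 ((withDiag (X ω) d).mulVec x - s • w) ≤ a * √(Fintype.card ι)}
        ≤ C / (Fintype.card ι : ℝ) ^ 2 := by
  obtain ⟨c, q, hc, hq, hq1, fixed_vector⟩ := exists_sum_sq_image_le hρ0 hρ M
  let L : ℝ := -Real.log q
  have L_pos : 0 < L := neg_pos.2 (Real.log_neg hq hq1)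
  obtain ⟨t, ht, card_ball_le⟩ := exists_card_gaussianBall_le (half_pos L_pos)
  let a : ℝ := min (1 / 4) (√c / (2 + K))
  have a_pos : 0 < a := by positivity
  have image_const : ((2 + K) * a) ^ 2 ≤ c := by
    rw [← Real.sq_sqrt hc.le]
    gcongr
    rw [mul_comm, ← le_div_iff₀ (by positivity)]
    exact min_le_right _ _
  let b : ℝ := min (1 / 2) ((a * t / 4) ^ 2)
  have radius_le : 4 * √b / a ≤ t := by
    have : √b ≤ a * t / 4 := Real.sqrt_le_iff.2 ⟨by positivity, min_le_right _ _⟩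
    rw [div_le_iff₀ a_pos]
    linarith
  let N : ℕ := ⌈4 * (K / a)⌉₊
  refine ⟨a, b, (2 * N + 1) ^ 2 * (8 / L ^ 2), a_pos, by positivity,
    (min_le_left _ _).trans (by norm_num), by positivity, ?_⟩
  intro Ω _ P _ ι _ _ _ X hX d w hw
  have union_bound := measureReal_not_spread_le (Y := X) a_pos (min_le_left _ _)
    (by positivity : 0 ≤ b) (min_le_left _ _) hK.le image_const (by positivity)
    (fixed_vector Ω P ι X hX) d hw
  set n := Fintype.card ι
  have n_pos : (0 : ℝ) < n := by exact_mod_cast Fintype.card_pos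
  have q_pow_eq : q ^ n = Real.exp (-(L * n)) := by
    rw [← Real.rpow_natCast, Real.rpow_def_of_pos hq]
    congr 1
    ring
  calc _ ≤ (gaussianBall ι (4 * √b / a * n)).card * (2 * N + 1 : ℝ) ^ 2 * q ^ n := union_bound
    _ ≤ Real.exp (L / 2 * n) * (2 * N + 1) ^ 2 * Real.exp (-(L * n)) := by
        rw [q_pow_eq]
        gcongr
        exact (Nat.cast_le.2 (Finset.card_le_card
          (gaussianBall_mono (by gcongr)))).trans (card_ball_le ι)
    _ = (2 * N + 1) ^ 2 * (Real.exp (L / 2 * n) * Real.exp (-(L * n))) := by ring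
    _ ≤ (2 * N + 1) ^ 2 * (8 / L ^ 2 / n ^ 2) := by
        gcongr
        exact exp_half_mul_exp_neg_le L_pos n_pos
    _ = _ := by ring

end NotSpread

/-- The squared Hilbert–Schmidt norm. -/
noncomputable def hsSq {ι : Type*} [Fintype ι] (G : Matrix ι ι ℂ) : ℝ := ∑ i, l2 (G i) ^ 2

/-- The vector with coordinate `c` at `k` and the coordinates of `y` elsewhere. -/
def insertCoord {ι : Type*} [DecidableEq ι] (k : ι) (c : ℂ) (y : {i // i ≠ k} → ℂ) : ι → ℂ :=
  fun i => if hi : i ≠ k then y ⟨i, hi⟩ else c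

lemma insertCoord_self {ι : Type*} [DecidableEq ι] (k : ι) (c : ℂ) (y : {i // i ≠ k} → ℂ) :
    insertCoord k c y k = c := by
  simp [insertCoord]

lemma insertCoord_coe {ι : Type*} [DecidableEq ι] {k : ι} (c : ℂ) (y : {i // i ≠ k} → ℂ)
    (i : {i // i ≠ k}) : insertCoord k c y i = y i := by
  simp [insertCoord, i.2]

section Matrices

variable {ι : Type*} [Fintype ι]

lemma hsSq_transpose (G : Matrix ι ι ℂ) : hsSq G.transpose = hsSq G := by
  simp only [hsSq, l2_sq, Matrix.transpose_apply]
  exact Finset.sum_comm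

lemma l2_star (y : ι → ℂ) : l2 (star y) = l2 y := by simp [l2]

lemma l2_sq_eq_dotProduct_star (y : ι → ℂ) : ((l2 y ^ 2 : ℝ) : ℂ) = dotProduct y (star y) := by
  rw [l2_sq]
  push_cast
  refine Finset.sum_congr rfl fun j _ => ?_
  rw [Pi.star_apply, RCLike.star_def, Complex.mul_conj, Complex.normSq_eq_norm_sq]
  push_cast; rfl

lemma OpBound.transpose {A : Matrix ι ι ℂ} {k : ℝ} (h : OpBound A k) : OpBound A.transpose k := by
  intro x
  set y := A.transpose.mulVec x with hy
  rcases (l2_nonneg y).eq_or_lt with y_eq | y_pos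
  · rw [← y_eq]
    exact (l2_nonneg _).trans (h x)
  · have sq_eq : ((l2 y ^ 2 : ℝ) : ℂ) = ∑ i, x i * (A.mulVec (star y)) i := by
      rw [l2_sq_eq_dotProduct_star, hy, Matrix.mulVec_transpose]
      exact (Matrix.dotProduct_mulVec x A _).symm
    have sq_le := norm_sum_mul_le_l2 x (A.mulVec (star y))
    rw [← sq_eq, Complex.norm_real, Real.norm_of_nonneg (by positivity)] at sq_le
    refine le_of_mul_le_mul_right ?_ y_pos
    calc l2 y * l2 y = l2 y ^ 2 := (sq _).symm
      _ ≤ l2 x * l2 (A.mulVec (star y)) := sq_le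
      _ ≤ l2 x * (k * l2 y) := by
          gcongr
          · exact l2_nonneg _
          · exact (h (star y)).trans_eq (by rw [l2_star])
      _ = _ := by ring

variable [DecidableEq ι]

lemma l2_single (j : ι) : l2 (Pi.single j (1 : ℂ)) = 1 := by
  rw [l2_eq_norm]
  exact (PiLp.norm_single 2 (fun _ : ι => ℂ) j 1).trans norm_one

lemma one_le_of_opBound_inv {B : Matrix ι ι ℂ} {K : ℝ} [Nonempty ι]
    (hB : OpBound B (K * √(Fintype.card ι))) (hdet : B.det ≠ 0) : 1 ≤ K ^ 2 * hsSq B⁻¹ := by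
  have card_pos : (0 : ℝ) < Fintype.card ι := by exact_mod_cast Fintype.card_pos
  have column_bound : ∀ j, 1 ≤ K ^ 2 * Fintype.card ι * l2 (B⁻¹.transpose j) ^ 2 := by
    intro j
    have image := hB (B⁻¹.mulVec (Pi.single j 1))
    rw [Matrix.mulVec_mulVec, Matrix.mul_nonsing_inv _ (isUnit_iff_ne_zero.2 hdet),
      Matrix.one_mulVec, l2_single, Matrix.mulVec_single_one] at image
    calc (1 : ℝ) = 1 ^ 2 := (one_pow 2).symm
      _ ≤ (K * √(Fintype.card ι) * l2 (B⁻¹.col j)) ^ 2 := by gcongr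
      _ = K ^ 2 * Fintype.card ι * l2 (B⁻¹.transpose j) ^ 2 := by
          rw [mul_pow, mul_pow, Real.sq_sqrt card_pos.le]; rfl
  have sum_bound := Finset.card_nsmul_le_sum Finset.univ _ 1 fun j _ => column_bound j
  rw [← Finset.mul_sum, nsmul_eq_mul, mul_one, Finset.card_univ] at sum_bound
  rw [← hsSq_transpose, hsSq]
  exact le_of_mul_le_mul_left (by linarith) card_pos

lemma l2_insertCoord_sq (k : ι) (c : ℂ) (y : {i // i ≠ k} → ℂ) :
    l2 (insertCoord k c y) ^ 2 = ‖c‖ ^ 2 + l2 y ^ 2 := by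
  rw [l2_sq, l2_sq, Fintype.sum_eq_add_sum_subtype_ne _ k]
  simp_rw [insertCoord_self, insertCoord_coe]

/-- The principal submatrix with row and column `k` removed. -/
def minor (A : Matrix ι ι ℂ) (k : ι) : Matrix {i // i ≠ k} {i // i ≠ k} ℂ :=
  A.submatrix (↑) (↑)

lemma mulVec_insertCoord_zero (A : Matrix ι ι ℂ) {k : ι} (y : {i // i ≠ k} → ℂ)
    (i : {i // i ≠ k}) : (A.mulVec (insertCoord k 0 y)) i = ((minor A k).mulVec y) i := by
  rw [Matrix.mulVec, dotProduct, Fintype.sum_eq_add_sum_subtype_ne _ k, insertCoord_self, mul_zero,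
    zero_add]
  simp_rw [insertCoord_coe]
  rfl

lemma OpBound.minor {A : Matrix ι ι ℂ} {c : ℝ} (h : OpBound A c) (k : ι) :
    OpBound (minor A k) c := by
  intro y
  have l2_eq : l2 (insertCoord k 0 y) = l2 y := by
    rw [← sq_eq_sq₀ (l2_nonneg _) (l2_nonneg _), l2_insertCoord_sq]
    simp
  rw [← l2_eq]
  refine le_trans ?_ (h _)
  apply Real.sqrt_le_sqrt
  rw [Fintype.sum_eq_add_sum_subtype_ne (fun i => ‖(A.mulVec (insertCoord k 0 y)) i‖ ^ 2) k]
  simp_rw [mulVec_insertCoord_zero]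
  exact le_add_of_nonneg_left (by positivity)

/-- The row vector `(1, -v B⁻¹)`, for `v` the rest of the row `k` and `B` the minor, annihilates all
columns but the one of index `k`, where it yields the Schur complement. -/
lemma vecMul_insertCoord_schur {A : Matrix ι ι ℂ} {k : ι} (hdet : (minor A k).det ≠ 0) :
    Matrix.vecMul
        (insertCoord k 1 (-(minor A k)⁻¹.transpose.mulVec fun i : {i // i ≠ k} => A k i)) A
      = Pi.single k (A k k - dotProduct (fun i : {i // i ≠ k} => A k i)
        ((minor A k)⁻¹.mulVec fun i => A i k)) := by
  set v : {i // i ≠ k} → ℂ := fun i => A k i with hv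
  set p := (minor A k)⁻¹.transpose.mulVec v with hp
  have vecMul_minor : Matrix.vecMul p (minor A k) = v := by
    rw [hp, Matrix.mulVec_transpose, Matrix.vecMul_vecMul,
      Matrix.nonsing_inv_mul _ (isUnit_iff_ne_zero.2 hdet), Matrix.vecMul_one]
  funext j
  rw [Matrix.vecMul, dotProduct, Fintype.sum_eq_add_sum_subtype_ne _ k, insertCoord_self]
  simp_rw [insertCoord_coe]
  simp only [Pi.neg_apply, neg_mul, Finset.sum_neg_distrib, one_mul]
  by_cases hj : j = k
  · subst hj
    rw [Pi.single_eq_same, Matrix.dotProduct_mulVec, ← Matrix.mulVec_transpose, ← hp, dotProduct,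
      sub_eq_add_neg]
  · have column := congrFun vecMul_minor ⟨j, hj⟩
    simp only [Matrix.vecMul, dotProduct, minor, Matrix.submatrix_apply, hv] at column
    rw [Pi.single_eq_of_ne hj, column, add_neg_cancel]

lemma norm_mul_schur_le {A : Matrix ι ι ℂ} {k : ι} (hdet : (minor A k).det ≠ 0) (x : ι → ℂ) :
    ‖x k‖ * ‖A k k - dotProduct (fun i : {i // i ≠ k} => A k i)
        ((minor A k)⁻¹.mulVec fun i => A i k)‖
      ≤ l2 (A.mulVec x)
        * √(1 + l2 ((minor A k)⁻¹.transpose.mulVec fun i => A k i) ^ 2) := by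
  set p := (minor A k)⁻¹.transpose.mulVec fun i : {i // i ≠ k} => A k i
  have l2_eq : l2 (insertCoord k 1 (-p)) = √(1 + l2 p ^ 2) := by
    rw [← Real.sqrt_sq (l2_nonneg (insertCoord k 1 (-p))), l2_insertCoord_sq, norm_one, one_pow,
      l2_sq, l2_sq]
    simp
  have pairing := Matrix.dotProduct_mulVec (insertCoord k 1 (-p)) A x
  rw [vecMul_insertCoord_schur hdet, single_dotProduct] at pairing
  rw [← norm_mul, mul_comm (x k), ← pairing, ← l2_eq, mul_comm (l2 _)]
  exact norm_sum_mul_le_l2 _ _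

end Matrices

section SpreadCombinatorics

variable {ι : Type*} [Fintype ι]

lemma card_large_mul_sq_le {x : ι → ℂ} {R c : ℝ} (hR : 0 < R) (hc : 0 ≤ c) (hx : l2 x ≤ R) :
    ((Finset.univ.filter fun i => c * R < √(Fintype.card ι) * ‖x i‖).card : ℝ) * c ^ 2
      ≤ Fintype.card ι := by
  set T := Finset.univ.filter fun i => c * R < √(Fintype.card ι) * ‖x i‖
  have lower : T.card • (c * R) ^ 2 ≤ ∑ i ∈ T, (√(Fintype.card ι) * ‖x i‖) ^ 2 := by
    refine Finset.card_nsmul_le_sum _ _ _ fun i hi => ?_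
    have := (Finset.mem_filter.1 hi).2
    gcongr
  have upper : ∑ i ∈ T, (√(Fintype.card ι) * ‖x i‖) ^ 2 ≤ Fintype.card ι * R ^ 2 := by
    simp_rw [mul_pow, Real.sq_sqrt (Nat.cast_nonneg (Fintype.card ι))]
    rw [← Finset.mul_sum]
    gcongr
    calc ∑ i ∈ T, ‖x i‖ ^ 2 ≤ ∑ i, ‖x i‖ ^ 2 := Finset.sum_le_sum_of_subset_of_nonneg
          (Finset.subset_univ _) fun _ _ _ => by positivity
      _ = l2 x ^ 2 := (l2_sq x).symm
      _ ≤ R ^ 2 := by gcongr; exact l2_nonneg _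
  rw [nsmul_eq_mul, mul_pow] at lower
  have : (T.card * c ^ 2) * R ^ 2 ≤ Fintype.card ι * R ^ 2 := by linarith
  exact le_of_mul_le_mul_right this (by positivity)

/-- Among the large coordinates of `α`, discard `J` and the few coordinates at which `α` or `β` is
far above its typical size. -/
lemma exists_large_bounded_of_spread {a b : ℝ} (hb : 0 < b) {α β : ι → ℂ} (hα : Spread a b α)
    (h0 : 0 < l2 α) (hβ : l2 β ≤ l2 α) {J : Finset ι}
    (hJ : (J.card : ℝ) ≤ b / 4 * Fintype.card ι) :
    ∃ S : Finset ι, Disjoint S J ∧ b / 2 * Fintype.card ι ≤ S.card ∧ ∀ i ∈ S,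
      a * l2 α ≤ √(Fintype.card ι) * ‖α i‖ ∧ √(Fintype.card ι) * ‖α i‖ ≤ √(8 / b) * l2 α ∧
        √(Fintype.card ι) * ‖β i‖ ≤ √(8 / b) * l2 α := by
  classical
  set n := Fintype.card ι
  let large := Finset.univ.filter fun i => a * l2 α ≤ √n * ‖α i‖
  let huge (x : ι → ℂ) := Finset.univ.filter fun i => √(8 / b) * l2 α < √n * ‖x i‖
  have card_large : b * n ≤ (large.card : ℝ) := by
    rw [Spread] at hα
    convert hα
  have card_huge {x : ι → ℂ} (hx : l2 x ≤ l2 α) : ((huge x).card : ℝ) ≤ b / 8 * n := by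
    have markov := card_large_mul_sq_le h0 (Real.sqrt_nonneg (8 / b)) hx
    rw [Real.sq_sqrt (by positivity), ← le_div_iff₀ (by positivity)] at markov
    exact markov.trans_eq (by field_simp; rfl)
  have notMem_huge {x : ι → ℂ} {i : ι} (hi : i ∉ huge x) : √n * ‖x i‖ ≤ √(8 / b) * l2 α := by
    simpa [huge] using hi
  refine ⟨large \ (J ∪ (huge α ∪ huge β)), ?_, ?_, fun i hi => ?_⟩
  · exact Finset.disjoint_left.2 fun i hi hiJ =>
      (Finset.mem_sdiff.1 hi).2 (Finset.mem_union_left _ hiJ)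
  · have card_le : (large.card : ℝ)
        ≤ (large \ (J ∪ (huge α ∪ huge β))).card + (J.card + ((huge α).card + (huge β).card)) := by
      have := Finset.le_card_sdiff (J ∪ (huge α ∪ huge β)) large
      have := Finset.card_union_le J (huge α ∪ huge β)
      have := Finset.card_union_le (huge α) (huge β)
      norm_cast
      omega
    linarith [card_huge le_rfl, card_huge hβ]
  · simp only [Finset.mem_sdiff, Finset.mem_union, not_or] at hi
    exact ⟨(Finset.mem_filter.1 hi.1).2, notMem_huge hi.2.2.1, notMem_huge hi.2.2.2⟩

lemma exists_comparable_of_spread {a b : ℝ} (ha : 0 < a) (hb : 0 < b) {α β : ι → ℂ} [Nonempty ι]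
    (hα : Spread a b α) (h0 : 0 < l2 α) (hβ : l2 β ≤ l2 α) {J : Finset ι}
    (hJ : (J.card : ℝ) ≤ b / 4 * Fintype.card ι) :
    ∃ S : Finset ι, Disjoint S J ∧ b / 2 * Fintype.card ι ≤ S.card ∧
      ∀ i ∈ S, (a * l2 α / √(Fintype.card ι)) ^ 2 ≤ ‖α i‖ ^ 2 + ‖β i‖ ^ 2 ∧
        ‖α i‖ ^ 2 + ‖β i‖ ^ 2 ≤ 16 / (b * a ^ 2) * (a * l2 α / √(Fintype.card ι)) ^ 2 := by
  obtain ⟨S, disjoint, card_S, bounds⟩ := exists_large_bounded_of_spread hb hα h0 hβ hJ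
  refine ⟨S, disjoint, card_S, fun i hi => ?_⟩
  obtain ⟨lower, upper, upper'⟩ := bounds i hi
  set n := Fintype.card ι
  have sqrt_pos : 0 < √(n : ℝ) := Real.sqrt_pos.2 (by exact_mod_cast Fintype.card_pos)
  have sq_le {z : ℂ} (hz : √n * ‖z‖ ≤ √(8 / b) * l2 α) :
      ‖z‖ ^ 2 ≤ 8 / (b * a ^ 2) * (a * l2 α / √n) ^ 2 :=
    calc ‖z‖ ^ 2 ≤ (√(8 / b) * l2 α / √n) ^ 2 := by
          gcongr
          rwa [le_div_iff₀ sqrt_pos, mul_comm]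
      _ = _ := by rw [div_pow, mul_pow, Real.sq_sqrt (by positivity)]; field_simp
  constructor
  · have : a * l2 α / √n ≤ ‖α i‖ := by rwa [div_le_iff₀ sqrt_pos, mul_comm _ √_]
    have : (a * l2 α / √n) ^ 2 ≤ ‖α i‖ ^ 2 := by gcongr
    linarith [sq_nonneg ‖β i‖]
  · calc ‖α i‖ ^ 2 + ‖β i‖ ^ 2 ≤ 8 / (b * a ^ 2) * (a * l2 α / √n) ^ 2
          + 8 / (b * a ^ 2) * (a * l2 α / √n) ^ 2 := add_le_add (sq_le upper) (sq_le upper')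
      _ = _ := by ring

lemma card_filter_div_eq_le {e : ι → ℕ} (he : e.Injective) {s : ℕ} (hs : 0 < s) (l : ℕ) :
    (Finset.univ.filter fun i => e i / s = l).card ≤ s :=
  calc _ ≤ (Finset.Ico (l * s) (l * s + s)).card := by
        refine Finset.card_le_card_of_injOn e (fun i hi => ?_) he.injOn
        have quotient := (Finset.mem_filter.1 hi).2
        rw [Finset.coe_Ico, Set.mem_Ico]
        have division := Nat.div_add_mod (e i) s
        have := Nat.mod_lt (e i) hs
        rw [quotient, mul_comm] at division
        omega
    _ = s := by rw [Nat.card_Ico]; omega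

lemma exists_cover_small {η : ℝ} (hη : 0 < η) :
    ∃ L : ℕ, 0 < L ∧ ∀ (ι : Type*) [Fintype ι], 1 ≤ η * Fintype.card ι →
      ∃ J : Fin L → Finset ι, (∀ i, ∃ l, i ∈ J l) ∧ ∀ l, ((J l).card : ℝ) ≤ η * Fintype.card ι := by
  refine ⟨⌈2 / η⌉₊ + 1, by omega, fun ι _ hι => ?_⟩
  set n := Fintype.card ι
  let s := ⌊η * n⌋₊
  have one_le_s : 1 ≤ s := Nat.le_floor (by simpa using hι)
  have s_le : (s : ℝ) ≤ η * n := Nat.floor_le (by linarith)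
  have le_two_mul_s : η * n ≤ 2 * s := by
    have := Nat.lt_floor_add_one (η * n)
    have : (1 : ℝ) ≤ s := by exact_mod_cast one_le_s
    linarith
  have n_le : n ≤ s * ⌈2 / η⌉₊ := by
    rify
    calc (n : ℝ) = η * n * (1 / η) := by field_simp
      _ ≤ 2 * s * (1 / η) := by gcongr
      _ = s * (2 / η) := by ring
      _ ≤ s * ⌈2 / η⌉₊ := by gcongr; exact Nat.le_ceil _
  let e := Fintype.equivFin ι
  refine ⟨fun l => Finset.univ.filter fun i => (e i : ℕ) / s = l, fun i => ?_, fun l => ?_⟩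
  · have block_lt : (e i : ℕ) / s < ⌈2 / η⌉₊ + 1 :=
      Nat.lt_succ_of_le (Nat.div_le_of_le_mul ((e i).2.le.trans n_le))
    exact ⟨⟨_, block_lt⟩, Finset.mem_filter.2 ⟨Finset.mem_univ _, rfl⟩⟩
  · have := card_filter_div_eq_le (Fin.val_injective.comp e.injective) one_le_s l
    exact (Nat.cast_le.2 this).trans s_le

end SpreadCombinatorics

section Measurability

variable {Ω : Type*} [MeasurableSpace Ω] {ι : Type*}

lemma measurable_l2 [Fintype ι] : Measurable (l2 : (ι → ℂ) → ℝ) := by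
  unfold l2
  fun_prop

lemma measurableSet_spread [Fintype ι] {f : Ω → ι → ℂ} (hf : Measurable f) (a b : ℝ) :
    MeasurableSet {ω | Spread a b (f ω)} := by
  classical
  have coordinate : ∀ i, Measurable fun ω => f ω i := fun i => (measurable_pi_apply i).comp hf
  have l2_f : Measurable fun ω => l2 (f ω) := measurable_l2.comp hf
  have card_eq : ∀ ω, ((Finset.univ.filter fun i =>
      a * l2 (f ω) ≤ √(Fintype.card ι) * ‖f ω i‖).card : ℝ)
      = ∑ i, if a * l2 (f ω) ≤ √(Fintype.card ι) * ‖f ω i‖ then (1 : ℝ) else 0 := fun ω => by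
    rw [Finset.card_filter]; push_cast; rfl
  have set_eq : {ω | Spread a b (f ω)} = {ω | b * Fintype.card ι ≤
      ∑ i, if a * l2 (f ω) ≤ √(Fintype.card ι) * ‖f ω i‖ then (1 : ℝ) else 0} := by
    ext ω
    simp only [Set.mem_ofPred_eq, ← card_eq]
    unfold Spread
    constructor <;> intro h <;> convert h
  rw [set_eq]
  refine measurableSet_le measurable_const (Finset.measurable_sum _ fun i _ => ?_)
  exact Measurable.ite (measurableSet_le (by fun_prop) (by have := coordinate i; fun_prop))
    measurable_const measurable_const

lemma measurable_mulVec [Fintype ι] {A : Ω → Matrix ι ι ℂ} {x : Ω → ι → ℂ}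
    (hA : ∀ i j, Measurable fun ω => A ω i j) (hx : ∀ i, Measurable fun ω => x ω i) :
    Measurable fun ω => (A ω).mulVec (x ω) :=
  measurable_pi_lambda _ fun i => Finset.measurable_sum _ fun j _ => (hA i j).mul (hx j)

lemma measurableSet_opBound [Fintype ι] {A : Ω → Matrix ι ι ℂ}
    (hA : ∀ i j, Measurable fun ω => A ω i j) (c : ℝ) : MeasurableSet {ω | OpBound (A ω) c} := by
  have closed : IsClosed {B : ι → ι → ℂ | OpBound (Matrix.of B) c} := by
    simp only [OpBound, Set.ofPred_forall]
    refine isClosed_iInter fun x => isClosed_le ?_ continuous_const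
    simp only [l2, Matrix.mulVec, dotProduct, Matrix.of_apply]
    fun_prop
  have measurable_entries : Measurable fun ω => (fun i j => A ω i j : ι → ι → ℂ) :=
    measurable_pi_lambda _ fun i => measurable_pi_lambda _ fun j => hA i j
  exact measurable_entries closed.measurableSet

variable [DecidableEq ι]

lemma measurable_det [Fintype ι] {A : Ω → Matrix ι ι ℂ}
    (hA : ∀ i j, Measurable fun ω => A ω i j) : Measurable fun ω => (A ω).det := by
  simp_rw [Matrix.det_apply]
  refine Finset.measurable_sum _ fun σ _ => Measurable.const_smul ?_ _
  exact Finset.measurable_prod _ fun i _ => hA _ _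

lemma measurable_inv_apply [Fintype ι] {A : Ω → Matrix ι ι ℂ}
    (hA : ∀ i j, Measurable fun ω => A ω i j) (i j : ι) :
    Measurable fun ω => (A ω)⁻¹ i j := by
  simp_rw [Matrix.inv_def, Matrix.smul_apply, Matrix.adjugate_apply, Ring.inverse_eq_inv',
    smul_eq_mul]
  refine (measurable_det hA).inv.mul (measurable_det fun k l => ?_)
  simp only [Matrix.updateRow_apply]
  split_ifs
  exacts [measurable_const, hA k l]

lemma measurable_withDiag {Y : Ω → ι → ι → ℝ} {D : Ω → ι → ℂ}
    (hY : ∀ i j, i ≠ j → Measurable fun ω => Y ω i j) (hD : ∀ i, Measurable fun ω => D ω i)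
    (i j : ι) : Measurable fun ω => withDiag (Y ω) (D ω) i j := by
  simp only [withDiag, Matrix.of_apply]
  split_ifs with h
  exacts [hD i, Complex.measurable_ofReal.comp (hY i j h)]

end Measurability

section ProductMeasures

section Sections

variable {E F : Type*} [MeasurableSpace E] [MeasurableSpace F] (μ : Measure E) (ν : Measure F)

lemma measureReal_prod_eq_integral [IsFiniteMeasure ν] {W : Set (E × F)} (hW : MeasurableSet W) :
    (μ.prod ν).real W = ∫ x, ν.real {y | (x, y) ∈ W} ∂μ := by
  rw [measureReal_def, Measure.prod_apply hW, ← integral_toReal]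
  · rfl
  · exact (measurable_measure_prodMk_left hW).aemeasurable
  · exact Filter.Eventually.of_forall fun y => measure_lt_top _ _

lemma measureReal_prod_eq_integral_swap [IsFiniteMeasure μ] [SFinite ν] {W : Set (E × F)}
    (hW : MeasurableSet W) : (μ.prod ν).real W = ∫ y, μ.real {x | (x, y) ∈ W} ∂ν := by
  rw [measureReal_def, Measure.prod_apply_symm hW, ← integral_toReal]
  · rfl
  · exact (measurable_measure_prodMk_right hW).aemeasurable
  · exact Filter.Eventually.of_forall fun y => measure_lt_top _ _

variable [IsProbabilityMeasure μ] [IsProbabilityMeasure ν]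

lemma measureReal_prod_le_of_section_le {W : Set (E × F)} (hW : MeasurableSet W) {D : Set F}
    (hD : MeasurableSet D) {c : ℝ} (h : ∀ y ∉ D, μ.real {x | (x, y) ∈ W} ≤ c) (hc : 0 ≤ c) :
    (μ.prod ν).real W ≤ ν.real D + c := by
  rw [measureReal_prod_eq_integral_swap μ ν hW]
  calc ∫ y, μ.real {x | (x, y) ∈ W} ∂ν ≤ ∫ y, (D.indicator (fun _ => (1 : ℝ)) y + c) ∂ν := by
        refine integral_mono_of_nonneg (Filter.Eventually.of_forall fun y => measureReal_nonneg)
          (((integrable_const _).indicator hD).add (integrable_const _))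
          (Filter.Eventually.of_forall fun y => ?_)
        by_cases hy : y ∈ D
        · simp only [Set.indicator_of_mem hy]
          linarith [measureReal_le_one (μ := μ) (s := {x | (x, y) ∈ W})]
        · simp only [Set.indicator_of_notMem hy]
          linarith [h y hy]
    _ = ν.real D + c := by
        rw [integral_add ((integrable_const _).indicator hD) (integrable_const _),
          integral_indicator_const _ hD]
        simp

/-- Jensen's inequality for the square of the measures of the sections. -/
lemma sq_measureReal_prod_le {W : Set (E × F)} (hW : MeasurableSet W) :
    (μ.prod ν).real W ^ 2
      ≤ (μ.prod (ν.prod ν)).real {p | (p.1, p.2.1) ∈ W ∧ (p.1, p.2.2) ∈ W} := by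
  let f (x : E) : ℝ := ν.real {y | (x, y) ∈ W}
  have f_measurable : Measurable f := (measurable_measure_prodMk_left hW).ennreal_toReal
  have f_memLp : MemLp f 2 μ :=
    MemLp.of_bound f_measurable.aestronglyMeasurable 1 (Filter.Eventually.of_forall fun x => by
      rw [Real.norm_of_nonneg measureReal_nonneg]; exact measureReal_le_one)
  have pairs_measurable : MeasurableSet {p : E × F × F | (p.1, p.2.1) ∈ W ∧ (p.1, p.2.2) ∈ W} :=
    ((by fun_prop : Measurable fun p : E × F × F => (p.1, p.2.1)) hW).inter
      ((by fun_prop : Measurable fun p : E × F × F => (p.1, p.2.2)) hW)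
  have pairs_section (x : E) : (ν.prod ν).real {q | (x, q.1) ∈ W ∧ (x, q.2) ∈ W} = f x ^ 2 := by
    rw [sq]
    exact measureReal_prod_prod {y | (x, y) ∈ W} {y | (x, y) ∈ W}
  have variance_eq := variance_eq_sub f_memLp
  have := variance_nonneg f μ
  rw [measureReal_prod_eq_integral μ ν hW, measureReal_prod_eq_integral μ _ pairs_measurable]
  simp only [Set.mem_ofPred_eq, pairs_section]
  simp only [Pi.pow_apply] at variance_eq
  linarith

end Sections

variable {ι : Type*} [DecidableEq ι] {E : Type*} [MeasurableSpace E]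

lemma measurable_piecewise (J : Finset ι) :
    Measurable fun p : (ι → E) × (ι → E) => J.piecewise p.2 p.1 := by
  refine measurable_pi_lambda _ fun i => ?_
  by_cases hi : i ∈ J
  · simp only [Finset.piecewise, hi, if_true]; fun_prop
  · simp only [Finset.piecewise, hi, if_false]; fun_prop

variable [Fintype ι] (ν : ι → Measure E) [∀ i, IsProbabilityMeasure (ν i)]

lemma map_piecewise_pi (J : Finset ι) :
    ((Measure.pi ν).prod (Measure.pi ν)).map (fun p => J.piecewise p.2 p.1) = Measure.pi ν := by
  refine (Measure.pi_eq fun s hs => ?_).symm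
  rw [Measure.map_apply (measurable_piecewise J) (MeasurableSet.univ_pi hs)]
  have preimage_eq : (fun p : (ι → E) × (ι → E) => J.piecewise p.2 p.1) ⁻¹' Set.pi Set.univ s
      = (Set.pi Set.univ fun i => if i ∈ J then Set.univ else s i) ×ˢ
        (Set.pi Set.univ fun i => if i ∈ J then s i else Set.univ) := by
    ext p
    simp only [Set.mem_preimage, Set.mem_pi, Set.mem_univ, true_implies, Set.mem_prod]
    rw [← forall_and]
    refine forall_congr' fun i => ?_
    by_cases hi : i ∈ J <;> simp [Finset.piecewise, hi]
  rw [preimage_eq, Measure.prod_prod, Measure.pi_pi, Measure.pi_pi, ← Finset.prod_mul_distrib]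
  refine Finset.prod_congr rfl fun i _ => ?_
  by_cases hi : i ∈ J <;> simp [hi]

/-- The decoupling step: the coordinates in `J` are resampled twice. -/
lemma sq_measureReal_pi_le (J : Finset ι) {W : Set (ι → E)} (hW : MeasurableSet W) :
    (Measure.pi ν).real W ^ 2
      ≤ ((Measure.pi ν).prod ((Measure.pi ν).prod (Measure.pi ν))).real
        {p | J.piecewise p.2.1 p.1 ∈ W ∧ J.piecewise p.2.2 p.1 ∈ W} := by
  rw [← map_piecewise_pi ν J, map_measureReal_apply (measurable_piecewise J) hW,
    map_piecewise_pi ν J]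
  exact sq_measureReal_prod_le _ _ (measurable_piecewise J hW)

end ProductMeasures

lemma mul_measureReal_le_sum {Ω : Type*} [MeasurableSpace Ω] {P : Measure Ω} [IsFiniteMeasure P]
    {κ : Type*} (s : Finset κ) {w : κ → ℝ} (hw : ∀ k ∈ s, 0 ≤ w k) (E : κ → Set Ω) {F : Set Ω}
    {c : ℝ} (h : ∀ ω ∈ F, c ≤ ∑ k ∈ s, (E k).indicator (fun _ => w k) ω) (hc : 0 ≤ c) :
    c * P.real F ≤ ∑ k ∈ s, w k * P.real (E k) := by
  let hull (k : κ) : Set Ω := toMeasurable P (E k)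
  have hull_measurable (k) : MeasurableSet (hull k) := measurableSet_toMeasurable _ _
  have integrable_indicator (k) : Integrable ((hull k).indicator fun _ => w k) P :=
    (integrable_const _).indicator (hull_measurable k)
  have integral_indicator (k) :
      ∫ ω, (hull k).indicator (fun _ => w k) ω ∂P = w k * P.real (E k) := by
    rw [integral_indicator_const _ (hull_measurable k), smul_eq_mul, mul_comm, measureReal_def,
      measure_toMeasurable, ← measureReal_def]
  have markov := mul_meas_ge_le_integral_of_nonneg (μ := P)
    (f := fun ω => ∑ k ∈ s, (hull k).indicator (fun _ => w k) ω)
    (Filter.Eventually.of_forall fun ω => Finset.sum_nonneg fun k hk =>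
      Set.indicator_nonneg (fun _ _ => hw k hk) ω)
    (integrable_finsetSum _ fun k _ => integrable_indicator k) c
  rw [integral_finsetSum _ fun k _ => integrable_indicator k] at markov
  simp_rw [integral_indicator] at markov
  refine le_trans ?_ markov
  gcongr
  · exact measure_ne_top _ _
  · intro ω hω
    refine (h ω hω).trans (Finset.sum_le_sum fun k hk => ?_)
    exact Set.indicator_le_indicator_of_subset (subset_toMeasurable _ _) (fun _ => hw k hk) ω

section SecondMoment

variable {Ω : Type*} [MeasurableSpace Ω] {P : Measure Ω} [IsProbabilityMeasure P]
  {ι : Type*} [Fintype ι] {V : ι → Ω → ℝ}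

lemma integral_sq_sum_mul_of_pairwise_indepFun (memLp : ∀ i, MemLp (V i) 2 P)
    (mean : ∀ i, ∫ ω, V i ω ∂P = 0) (var : ∀ i, ∫ ω, V i ω ^ 2 ∂P = 1)
    (indep : Pairwise fun i j => IndepFun (V i) (V j) P) (c : ι → ℝ) :
    ∫ ω, (∑ j, c j * V j ω) ^ 2 ∂P = ∑ j, c j ^ 2 := by
  have memLp_term (j) : MemLp (fun ω => c j * V j ω) 2 P := (memLp j).const_mul _
  have mean_sum : ∫ ω, ∑ j, c j * V j ω ∂P = 0 := by
    rw [integral_finsetSum _ fun j _ => (memLp_term j).integrable one_le_two]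
    simp_rw [integral_const_mul, mean, mul_zero, Finset.sum_const_zero]
  have variance_term (j) : variance (fun ω => c j * V j ω) P = c j ^ 2 := by
    rw [variance_const_mul, variance_of_integral_eq_zero (memLp j).aemeasurable (mean j), var,
      mul_one]
  have variance_sum := IndepFun.variance_sum (s := Finset.univ) (fun j _ => memLp_term j)
    fun i _ j _ hij => (indep hij).comp (measurable_const_mul (c i)) (measurable_const_mul (c j))
  simp_rw [variance_term] at variance_sum
  rw [← variance_sum, Finset.sum_fn, variance_of_integral_eq_zero
    (memLp_finsetSum _ fun j _ => memLp_term j).aemeasurable mean_sum]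

lemma l2_mulVec_ofReal_sq (G : Matrix ι ι ℂ) (x : ι → ℝ) :
    l2 (G.mulVec fun j => (x j : ℂ)) ^ 2
      = ∑ i, ((∑ j, (G i j).re * x j) ^ 2 + (∑ j, (G i j).im * x j) ^ 2) := by
  rw [l2_sq]
  refine Finset.sum_congr rfl fun i _ => ?_
  rw [← Complex.normSq_eq_norm_sq, Complex.normSq_apply, Matrix.mulVec, dotProduct,
    Complex.re_sum, Complex.im_sum, sq, sq]
  simp

lemma measureReal_hsSq_div_le_l2_mulVec_sq_le (memLp : ∀ i, MemLp (V i) 2 P)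
    (mean : ∀ i, ∫ ω, V i ω ∂P = 0) (var : ∀ i, ∫ ω, V i ω ^ 2 ∂P = 1)
    (indep : Pairwise fun i j => IndepFun (V i) (V j) P) (G : Matrix ι ι ℂ) (hG : 0 < hsSq G)
    {δ : ℝ} (hδ : 0 < δ) :
    P.real {ω | hsSq G / δ ≤ l2 (G.mulVec fun j => (V j ω : ℂ)) ^ 2} ≤ δ := by
  have integrable_sq (c : ι → ℝ) : Integrable (fun ω => (∑ j, c j * V j ω) ^ 2) P :=
    (memLp_finsetSum _ fun j _ => (memLp j).const_mul (c j)).integrable_sq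
  have integrable_row (i) : Integrable (fun ω => (∑ j, (G i j).re * V j ω) ^ 2
      + (∑ j, (G i j).im * V j ω) ^ 2) P := (integrable_sq _).add (integrable_sq _)
  have integral_eq : ∫ ω, l2 (G.mulVec fun j => (V j ω : ℂ)) ^ 2 ∂P = hsSq G := by
    simp_rw [l2_mulVec_ofReal_sq]
    rw [integral_finsetSum _ fun i _ => integrable_row i, hsSq]
    refine Finset.sum_congr rfl fun i _ => ?_
    rw [integral_add (integrable_sq _) (integrable_sq _),
      integral_sq_sum_mul_of_pairwise_indepFun memLp mean var indep,
      integral_sq_sum_mul_of_pairwise_indepFun memLp mean var indep, l2_sq,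
      ← Finset.sum_add_distrib]
    refine Finset.sum_congr rfl fun j _ => ?_
    rw [← Complex.normSq_eq_norm_sq, Complex.normSq_apply, sq, sq]
  have integrable_l2 : Integrable (fun ω => l2 (G.mulVec fun j => (V j ω : ℂ)) ^ 2) P := by
    simp_rw [l2_mulVec_ofReal_sq]
    exact integrable_finsetSum _ fun i _ => integrable_row i
  have markov := mul_meas_ge_le_integral_of_nonneg
    (Filter.Eventually.of_forall fun ω => by positivity) integrable_l2 (hsSq G / δ)
  rw [integral_eq, div_mul_eq_mul_div, div_le_iff₀ hδ] at markov
  exact le_of_mul_le_mul_left markov hG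

end SecondMoment

section SmallBallOfSpread

theorem exists_smallBall_of_comparable {ρ : ℝ} (hρ0 : 0 ≤ ρ) (hρ : ρ < 1) (M : ℝ) {Λ a c : ℝ}
    (hΛ : 0 < Λ) (ha : 0 < a) (hc : 0 < c) :
    ∃ C : ℝ, 0 < C ∧ ∀ (Ω : Type*) [MeasurableSpace Ω] (P : Measure Ω)
      [IsProbabilityMeasure P] (ι : Type*) [Fintype ι] [Nonempty ι] (U V : ι → Ω → ℝ),
      IndepPairs P U V ρ M → ∀ (α β : ι → ℂ) (S : Finset ι) (t : ℝ), 0 < t →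
      c * Fintype.card ι ≤ S.card →
      (∀ i ∈ S, (a * t / √(Fintype.card ι)) ^ 2 ≤ ‖α i‖ ^ 2 + ‖β i‖ ^ 2 ∧
        ‖α i‖ ^ 2 + ‖β i‖ ^ 2 ≤ Λ * (a * t / √(Fintype.card ι)) ^ 2) →
      ∀ r : ℝ, 0 ≤ r → ∀ w : ℂ,
      P.real {ω | ‖∑ i, (α i * U i ω + β i * V i ω) - w‖ ≤ r}
        ≤ C * (r / t + 1 / √(Fintype.card ι)) := by
  obtain ⟨C, hC, smallBall⟩ := exists_smallBall hρ0 hρ M hΛ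
  refine ⟨C * (1 / a + 1) / √c, by positivity, ?_⟩
  intro Ω _ P _ ι _ _ U V hUV α β S t ht hS hαβ r hr w
  set n := Fintype.card ι
  have hn : (0 : ℝ) < n := by exact_mod_cast Fintype.card_pos
  have hS_pos : (0 : ℝ) < S.card := lt_of_lt_of_le (by positivity) hS
  calc _ ≤ C * (r / (a * t / √n) + 1) / √(S.card) :=
        smallBall Ω P ι U V hUV α β S _ (Finset.card_pos.1 (by exact_mod_cast hS_pos))
          (by positivity) hαβ r hr w
    _ ≤ C * (r / (a * t / √n) + 1) / √(c * n) := by gcongr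
    _ = C * (1 / a * (r / t) + 1 / √n) / √c := by
        rw [Real.sqrt_mul hc.le]
        field_simp
    _ ≤ C * ((1 / a + 1) * (r / t + 1 / √n)) / √c := by
        have : 0 ≤ 1 / a * (1 / √n) := by positivity
        have : 0 ≤ r / t := by positivity
        gcongr
        linarith
    _ = _ := by ring

theorem exists_smallBall_of_spread {ρ : ℝ} (hρ0 : 0 ≤ ρ) (hρ : ρ < 1) (M : ℝ) {a b : ℝ}
    (ha : 0 < a) (hb : 0 < b) :
    ∃ C : ℝ, 0 < C ∧ ∀ (Ω : Type*) [MeasurableSpace Ω] (P : Measure Ω)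
      [IsProbabilityMeasure P] (ι : Type*) [Fintype ι] [DecidableEq ι] [Nonempty ι]
      (U V : ι → Ω → ℝ), IndepPairs P U V ρ M →
      ∀ (α β : ι → ℂ) (J : Finset ι), Spread a b α → 0 < l2 α → l2 β ≤ l2 α →
      (J.card : ℝ) ≤ b / 4 * Fintype.card ι → ∀ r : ℝ, 0 ≤ r → ∀ w : ℂ,
      P.real {ω | ‖∑ i, ((if i ∈ J then 0 else α i) * U i ω
          + (if i ∈ J then 0 else β i) * V i ω) - w‖ ≤ r}
        ≤ C * (r / l2 α + 1 / √(Fintype.card ι)) := by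
  obtain ⟨C, hC, smallBall⟩ := exists_smallBall_of_comparable hρ0 hρ M
    (Λ := 16 / (b * a ^ 2)) (by positivity) ha (half_pos hb)
  refine ⟨C, hC, fun Ω _ P _ ι _ _ _ U V hUV α β J hα hα_pos hβ hJ r hr w => ?_⟩
  obtain ⟨S, disjoint, card_S, comparable⟩ :=
    exists_comparable_of_spread ha hb hα hα_pos hβ hJ
  refine smallBall Ω P ι U V hUV _ _ S _ hα_pos card_S (fun i hi => ?_) r hr w
  rw [if_neg (Finset.disjoint_left.1 disjoint hi), if_neg (Finset.disjoint_left.1 disjoint hi)]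
  exact comparable i hi

end SmallBallOfSpread

section MatrixVectorProducts

variable {ι : Type*} {L : ℕ}

lemma exists_card_le_mul_card_inter [DecidableEq ι] [NeZero L] {J : Fin L → Finset ι}
    (hJ : ∀ i, ∃ l, i ∈ J l) (S : Finset ι) : ∃ l, S.card ≤ L * (S ∩ J l).card := by
  have card_le : S.card ≤ ∑ l, (S ∩ J l).card :=
    calc S.card ≤ (Finset.univ.biUnion fun l => S ∩ J l).card := Finset.card_le_card fun i hi => by
          obtain ⟨l, hl⟩ := hJ i
          exact Finset.mem_biUnion.2 ⟨l, Finset.mem_univ _, Finset.mem_inter.2 ⟨hi, hl⟩⟩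
      _ ≤ _ := Finset.card_biUnion_le
  obtain ⟨l, -, hl⟩ := Finset.exists_max_image Finset.univ (fun l => (S ∩ J l).card)
    Finset.univ_nonempty
  refine ⟨l, card_le.trans ?_⟩
  simpa using Finset.sum_le_card_nsmul Finset.univ _ _ fun k hk => hl k hk

/-- Pigeonhole twice: first for the block that is heaviest in `S k`, then for the rows `k` whose
heaviest block is the same. -/
lemma exists_heavy_block [DecidableEq ι] [NeZero L] {J : Fin L → Finset ι}
    (hJ : ∀ i, ∃ l, i ∈ J l) {κ : Type*} [Fintype κ] (S : κ → Finset ι) (w : κ → ℝ) :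
    ∃ l, ∃ T : Finset κ, (∀ k ∈ T, (S k).card ≤ L * (S k ∩ J l).card) ∧
      (∑ k, w k) / L ≤ ∑ k ∈ T, w k := by
  choose block hblock using fun k => exists_card_le_mul_card_inter hJ (S k)
  obtain ⟨l, hl⟩ := Fintype.exists_le_sum_fiber_of_nsmul_le_sum (w := w) (b := (∑ k, w k) / L)
    block (by
      rw [Fintype.card_fin, nsmul_eq_mul, mul_div_cancel₀ _ (NeZero.ne (L : ℝ))])
  exact ⟨l, Finset.univ.filter fun k => block k = l,
    fun k hk => (Finset.mem_filter.1 hk).2 ▸ hblock k, hl⟩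

variable [Fintype ι]

lemma measureReal_l2_sq_le_of_coord_smallBall {Ω : Type*} [MeasurableSpace Ω] {P : Measure Ω}
    [IsFiniteMeasure P] (Y : Ω → ι → ℂ) (T : Finset ι) {g : ι → ℝ} (hg : ∀ k ∈ T, 0 ≤ g k)
    (hT : 0 < ∑ k ∈ T, g k ^ 2) {θ p : ℝ} (hθ : 0 < θ)
    (hp : ∀ k ∈ T, P.real {ω | ‖Y ω k‖ ≤ θ * g k} ≤ p) :
    P.real {ω | l2 (Y ω) ^ 2 ≤ θ ^ 2 / 2 * ∑ k ∈ T, g k ^ 2} ≤ 2 * p := by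
  set W := ∑ k ∈ T, g k ^ 2
  let small (k : ι) : Set Ω := {ω | ‖Y ω k‖ ≤ θ * g k}
  have l2_lower (ω : Ω) :
      θ ^ 2 * (W - ∑ k ∈ T, (small k).indicator (fun _ => g k ^ 2) ω) ≤ l2 (Y ω) ^ 2 := by
    rw [← Finset.sum_sub_distrib, Finset.mul_sum, l2_sq]
    calc _ ≤ ∑ k ∈ T, ‖Y ω k‖ ^ 2 := by
          refine Finset.sum_le_sum fun k hk => ?_
          by_cases hω : ω ∈ small k
          · rw [Set.indicator_of_mem hω, sub_self, mul_zero]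
            positivity
          · rw [Set.indicator_of_notMem hω, sub_zero, ← mul_pow]
            have := hg k hk
            have : θ * g k < ‖Y ω k‖ := not_le.1 hω
            gcongr
      _ ≤ _ := Finset.sum_le_sum_of_subset_of_nonneg (Finset.subset_univ _)
          fun _ _ _ => by positivity
  have half_small : ∀ ω ∈ {ω | l2 (Y ω) ^ 2 ≤ θ ^ 2 / 2 * W},
      W / 2 ≤ ∑ k ∈ T, (small k).indicator (fun _ => g k ^ 2) ω := fun ω hω => by
    have : θ ^ 2 * (W - ∑ k ∈ T, (small k).indicator (fun _ => g k ^ 2) ω) ≤ θ ^ 2 * (W / 2) :=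
      (l2_lower ω).trans ((show _ ≤ θ ^ 2 / 2 * W from hω).trans_eq (by ring))
    linarith [le_of_mul_le_mul_left this (by positivity)]
  have markov := mul_measureReal_le_sum (P := P) T (fun k _ => sq_nonneg (g k)) small
    half_small (by positivity)
  have sum_le : ∑ k ∈ T, g k ^ 2 * P.real (small k) ≤ W * p := by
    rw [Finset.sum_mul]
    exact Finset.sum_le_sum fun k hk => by gcongr; exact hp k hk
  refine le_of_mul_le_mul_left ?_ hT
  linarith

variable [DecidableEq ι]

lemma mulVec_ite_apply_eq_sub (G : Matrix ι ι ℂ) (J : Finset ι) (x u : ι → ℝ) (k : ι) :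
    G.mulVec (fun i => if i ∈ J then ((x i - u i : ℝ) : ℂ) else 0) k
      = ∑ i, ((if i ∈ J then G k i else 0) * (x i : ℂ))
        - ∑ i, if i ∈ J then G k i * u i else 0 := by
  rw [← Finset.sum_sub_distrib, Matrix.mulVec, dotProduct]
  refine Finset.sum_congr rfl fun i _ => ?_
  split_ifs
  · push_cast; ring
  · ring

theorem exists_l2_mulVec_smallBall {ρ : ℝ} (hρ0 : 0 ≤ ρ) (hρ : ρ < 1) (M : ℝ) {a b : ℝ}
    (ha : 0 < a) (hb : 0 < b) (L : ℕ) [NeZero L] :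
    ∃ C : ℝ, 0 < C ∧ ∀ (Ω : Type*) [MeasurableSpace Ω] (P : Measure Ω)
      [IsProbabilityMeasure P] (ι : Type*) [Fintype ι] [DecidableEq ι] [Nonempty ι]
      (U V : ι → Ω → ℝ), IndepPairs P U V ρ M →
      ∀ J : Fin L → Finset ι, (∀ i, ∃ l, i ∈ J l) → ∀ G : Matrix ι ι ℂ,
      (∀ k, Spread a b (G k)) → (∀ k, 0 < l2 (G k)) → ∃ l, ∀ θ : ℝ, 0 < θ → ∀ u : ι → ℝ,
      P.real {ω | l2 (G.mulVec fun i => if i ∈ J l then ((U i ω - u i : ℝ) : ℂ) else 0) ^ 2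
          ≤ θ ^ 2 / (2 * L) * hsSq G}
        ≤ C * (θ + 1 / √(Fintype.card ι)) := by
  have L_pos : (0 : ℝ) < L := Nat.cast_pos.2 (NeZero.pos L)
  obtain ⟨C, hC, smallBall⟩ := exists_smallBall_of_comparable hρ0 hρ M
    (Λ := 16 / (b * a ^ 2)) (by positivity) ha (c := b / 2 / L) (by positivity)
  refine ⟨2 * C, by positivity, fun Ω _ P _ ι _ _ _ U V hUV J hJ G spread row_pos => ?_⟩
  choose S _ card_S comparable using fun k => exists_comparable_of_spread (β := 0) (J := ∅)
    ha hb (spread k) (row_pos k) (by rw [l2_zero]; exact l2_nonneg _) (by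
      rw [Finset.card_empty, Nat.cast_zero]; positivity)
  obtain ⟨l, T, heavy, weight_T⟩ := exists_heavy_block hJ S fun k => l2 (G k) ^ 2
  refine ⟨l, fun θ hθ u => ?_⟩
  have hsSq_pos : 0 < hsSq G :=
    Finset.sum_pos (fun k _ => pow_pos (row_pos k) 2) Finset.univ_nonempty
  have row_smallBall (k : ι) (hk : k ∈ T) :
      P.real {ω | ‖G.mulVec (fun i => if i ∈ J l then ((U i ω - u i : ℝ) : ℂ) else 0) k‖
        ≤ θ * l2 (G k)} ≤ C * (θ + 1 / √(Fintype.card ι)) := by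
    have card_le : b / 2 / L * Fintype.card ι ≤ ((S k ∩ J l).card : ℝ) := by
      rw [div_mul_eq_mul_div, div_le_iff₀' L_pos]
      exact (card_S k).trans (by exact_mod_cast heavy k hk)
    have smallBall_row := smallBall Ω P ι U V hUV (fun i => if i ∈ J l then G k i else 0) 0
      (S k ∩ J l) _ (row_pos k) card_le (fun i hi => by
        rw [if_pos (Finset.mem_inter.1 hi).2]
        exact comparable k i (Finset.mem_inter.1 hi).1)
      (θ * l2 (G k)) (mul_nonneg hθ.le (l2_nonneg _)) (∑ i, if i ∈ J l then G k i * u i else 0)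
    simp_rw [mulVec_ite_apply_eq_sub G (J l) (fun i => U i _) u k]
    rw [mul_div_cancel_right₀ _ (row_pos k).ne'] at smallBall_row
    simpa only [Pi.zero_apply, zero_mul, add_zero] using smallBall_row
  rw [mul_assoc]
  refine (measureReal_mono fun ω hω => ?_).trans (measureReal_l2_sq_le_of_coord_smallBall
    (fun ω => G.mulVec fun i => if i ∈ J l then ((U i ω - u i : ℝ) : ℂ) else 0) T
    (fun k _ => l2_nonneg (G k)) ((div_pos hsSq_pos L_pos).trans_le weight_T) hθ row_smallBall)
  calc _ ≤ θ ^ 2 / (2 * L) * hsSq G := hω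
    _ = θ ^ 2 / 2 * (hsSq G / L) := by field_simp
    _ ≤ _ := by gcongr; exact weight_T

end MatrixVectorProducts

section Resampling

/-- The difference of two samples of a coordinate functional of the pairs, restricted to `J`. -/
def resampleDiff {ι : Type*} [DecidableEq ι] (J : Finset ι) (f : ℝ × ℝ → ℝ)
    (p : (ι → ℝ × ℝ) × (ι → ℝ × ℝ)) : ι → ℂ :=
  fun i => if i ∈ J then ((f (p.1 i) - f (p.2 i) : ℝ) : ℂ) else 0

/-- The bilinear form of `G` evaluated at the second and the first components of `y`. -/
noncomputable def pairForm {ι : Type*} [Fintype ι] (G : Matrix ι ι ℂ) (y : ι → ℝ × ℝ) : ℂ :=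
  dotProduct (fun i => ((y i).2 : ℂ)) (G.mulVec fun i => ((y i).1 : ℂ))

/-- The pairs of vectors (column, row) which border a matrix with inverse `G` in such a way that the
Schur complement of the corner `z` has modulus at most `ε` times the Euclidean norm of the row
vector `(1, -vᵀ G)`, where `v` is the bordering row. -/
noncomputable def smallSchur {ι : Type*} [Fintype ι] (G : Matrix ι ι ℂ) (z : ℂ) (ε : ℝ) :
    Set (ι → ℝ × ℝ) :=
  {y | ‖z - pairForm G y‖ ≤ ε * √(1 + l2 (G.transpose.mulVec fun i => ((y i).2 : ℂ)) ^ 2)}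

/-- The pairs of samples for which resampling the coordinates in `J` changes `pairForm G` by a
linear form with a coefficient vector that is not spread. -/
def notSpreadResample {ι : Type*} [Fintype ι] [DecidableEq ι] (a b : ℝ) (G : Matrix ι ι ℂ)
    (J : Finset ι) : Set ((ι → ℝ × ℝ) × (ι → ℝ × ℝ)) :=
  {p | ¬ Spread a b (G.mulVec (resampleDiff J Prod.fst p)) ∨
    ¬ Spread a b (G.transpose.mulVec (resampleDiff J Prod.snd p))}

variable {ι : Type*}

lemma pairForm_piecewise_sub [Fintype ι] [DecidableEq ι] (G : Matrix ι ι ℂ) (J : Finset ι)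
    (p : (ι → ℝ × ℝ) × (ι → ℝ × ℝ)) (x : ι → ℝ × ℝ) :
    pairForm G (J.piecewise p.1 x) - pairForm G (J.piecewise p.2 x)
      = ∑ i, ((if i ∈ J then 0 else G.mulVec (resampleDiff J Prod.fst p) i) * (x i).2
          + (if i ∈ J then 0 else G.transpose.mulVec (resampleDiff J Prod.snd p) i) * (x i).1)
        - (pairForm G (J.piecewise p.2 0) - pairForm G (J.piecewise p.1 0)) := by
  let inside (y : ι → ℝ × ℝ) (f : ℝ × ℝ → ℝ) (i : ι) : ℂ := if i ∈ J then (f (y i) : ℂ) else 0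
  let outside (f : ℝ × ℝ → ℝ) (i : ι) : ℂ := if i ∈ J then 0 else (f (x i) : ℂ)
  have piecewise_eq (y : ι → ℝ × ℝ) (f : ℝ × ℝ → ℝ) :
      (fun i => ((f (J.piecewise y x i) : ℝ) : ℂ)) = outside f + inside y f := by
    funext i
    by_cases hi : i ∈ J <;> simp [outside, inside, hi]
  have piecewise_zero_eq (y : ι → ℝ × ℝ) (f : ℝ × ℝ → ℝ) (hf : f 0 = 0) :
      (fun i => ((f (J.piecewise y 0 i) : ℝ) : ℂ)) = inside y f := by
    funext i
    by_cases hi : i ∈ J <;> simp [inside, hi, hf]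
  have resampleDiff_eq (f : ℝ × ℝ → ℝ) : resampleDiff J f p = inside p.1 f - inside p.2 f := by
    funext i
    by_cases hi : i ∈ J <;> simp [resampleDiff, inside, hi]
  have sum_outside (u : ι → ℂ) (f : ℝ × ℝ → ℝ) :
      ∑ i, (if i ∈ J then 0 else u i) * (f (x i) : ℂ) = dotProduct u (outside f) :=
    Finset.sum_congr rfl fun i _ => by by_cases hi : i ∈ J <;> simp [outside, hi]
  rw [Finset.sum_add_distrib, sum_outside _ Prod.snd, sum_outside _ Prod.fst,
    Matrix.mulVec_transpose, ← Matrix.dotProduct_mulVec, dotProduct_comm _ (outside Prod.snd),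
    resampleDiff_eq, resampleDiff_eq]
  simp only [pairForm, piecewise_eq _ Prod.fst, piecewise_eq _ Prod.snd,
    piecewise_zero_eq _ Prod.fst rfl, piecewise_zero_eq _ Prod.snd rfl, Matrix.mulVec_add,
    Matrix.mulVec_sub, add_dotProduct, dotProduct_add, sub_dotProduct, dotProduct_sub]
  ring

section Measurability

variable {Ω : Type*} [MeasurableSpace Ω] {G : Ω → Matrix ι ι ℂ}

lemma measurable_resampleDiff [DecidableEq ι] (J : Finset ι) {f : ℝ × ℝ → ℝ} (hf : Measurable f)
    (i : ι) : Measurable fun p => resampleDiff J f p i := by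
  simp only [resampleDiff]
  split_ifs
  · fun_prop
  · exact measurable_const

lemma measurable_pairForm [Fintype ι] (hG : ∀ i j, Measurable fun ω => G ω i j)
    {y : Ω → ι → ℝ × ℝ} (hy : Measurable y) : Measurable fun ω => pairForm (G ω) (y ω) :=
  Finset.measurable_sum _ fun i _ => Measurable.mul (by fun_prop) <|
    Finset.measurable_sum _ fun j _ => (hG i j).mul (by fun_prop)

lemma measurableSet_notSpreadResample [Fintype ι] [DecidableEq ι] (a b : ℝ)
    (hG : ∀ i j, Measurable fun ω => G ω i j) (J : Finset ι)
    {q : Ω → (ι → ℝ × ℝ) × (ι → ℝ × ℝ)} (hq : Measurable q) :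
    MeasurableSet {ω | q ω ∈ notSpreadResample a b (G ω) J} :=
  (measurableSet_spread (measurable_mulVec hG fun i =>
      (measurable_resampleDiff J measurable_fst i).comp hq) a b).compl.union
    (measurableSet_spread (measurable_mulVec (fun i j => hG j i) fun i =>
      (measurable_resampleDiff J measurable_snd i).comp hq) a b).compl

lemma measurableSet_smallSchur [Fintype ι] (hG : ∀ i j, Measurable fun ω => G ω i j)
    {y : Ω → ι → ℝ × ℝ} (hy : Measurable y) (z : ℂ) (ε : ℝ) :
    MeasurableSet {ω | y ω ∈ smallSchur (G ω) z ε} :=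
  have row_measurable := measurable_l2.comp <|
    measurable_mulVec (A := fun ω => (G ω).transpose) (x := fun ω i => ((y ω i).2 : ℂ))
      (fun i j => hG j i) fun i => by fun_prop
  measurableSet_le (measurable_const.sub (measurable_pairForm hG hy)).norm <|
    measurable_const.mul (measurable_const.add (row_measurable.pow_const 2)).sqrt

end Measurability

end Resampling

section PairFormSmallBall

namespace IndepPairs

lemma symm {Ω : Type*} [MeasurableSpace Ω] {P : Measure Ω} {ι : Type*} {U V : ι → Ω → ℝ}
    {ρ M : ℝ} (h : IndepPairs P U V ρ M) : IndepPairs P V U ρ M where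
  indep := h.indep.comp (fun _ => Prod.swap) fun _ => measurable_swap
  moments i := (h.moments i).symm

lemma pi {ι : Type*} [Fintype ι] {ν : ι → Measure (ℝ × ℝ)} [∀ i, IsProbabilityMeasure (ν i)]
    {ρ M : ℝ} (hν : ∀ i, PairMoments (ν i) Prod.fst Prod.snd ρ M) :
    IndepPairs (Measure.pi ν) (fun i y => (y i).1) (fun i y => (y i).2) ρ M where
  indep := iIndepFun_pi (X := fun _ => id) fun _ => aemeasurable_id
  moments i := (hν i).comp_measurePreserving (measurePreserving_eval ν i)

end IndepPairs

lemma exists_smallBall_of_spread_of_spread {ρ : ℝ} (hρ0 : 0 ≤ ρ) (hρ : ρ < 1) (M : ℝ) {a b : ℝ}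
    (ha : 0 < a) (hb : 0 < b) :
    ∃ C : ℝ, 0 < C ∧ ∀ (Ω : Type*) [MeasurableSpace Ω] (P : Measure Ω)
      [IsProbabilityMeasure P] (ι : Type*) [Fintype ι] [DecidableEq ι] [Nonempty ι]
      (U V : ι → Ω → ℝ), IndepPairs P U V ρ M →
      ∀ (α β : ι → ℂ) (J : Finset ι), Spread a b α → Spread a b β →
      (J.card : ℝ) ≤ b / 4 * Fintype.card ι → ∀ N : ℝ, 0 < N → N ≤ l2 α →
      ∀ r : ℝ, 0 ≤ r → ∀ w : ℂ,
      P.real {ω | ‖∑ i, ((if i ∈ J then 0 else α i) * U i ω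
          + (if i ∈ J then 0 else β i) * V i ω) - w‖ ≤ r}
        ≤ C * (r / N + 1 / √(Fintype.card ι)) := by
  obtain ⟨C, hC, smallBall⟩ := exists_smallBall_of_spread hρ0 hρ M ha hb
  refine ⟨C, hC, fun Ω _ P _ ι _ _ _ U V hUV α β J hα hβ hJ N hN hNα r hr w => ?_⟩
  rcases le_total (l2 β) (l2 α) with h | h
  · refine (smallBall Ω P ι U V hUV α β J hα (hN.trans_le hNα) h hJ r hr w).trans ?_
    gcongr
  · simp_rw [add_comm (_ * (U _ _ : ℂ))]
    refine (smallBall Ω P ι V U hUV.symm β α J hβ (hN.trans_le (hNα.trans h)) h hJ r hr w).trans ?_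
    have := hNα.trans h
    gcongr

lemma exists_pairForm_piecewise_smallBall {ρ : ℝ} (hρ0 : 0 ≤ ρ) (hρ : ρ < 1) (M : ℝ) {a b : ℝ}
    (ha : 0 < a) (hb : 0 < b) :
    ∃ C : ℝ, 0 < C ∧ ∀ (ι : Type*) [Fintype ι] [DecidableEq ι] [Nonempty ι]
      (ν : ι → Measure (ℝ × ℝ)) [∀ i, IsProbabilityMeasure (ν i)],
      (∀ i, PairMoments (ν i) Prod.fst Prod.snd ρ M) → ∀ (G : Matrix ι ι ℂ) (J : Finset ι),
      (J.card : ℝ) ≤ b / 4 * Fintype.card ι → ∀ p ∉ notSpreadResample a b G J,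
      ∀ N : ℝ, 0 < N → N ≤ l2 (G.mulVec (resampleDiff J Prod.fst p)) →
      ∀ (z : ℂ) (r : ℝ), 0 ≤ r →
      (Measure.pi ν).real {x | ‖z - pairForm G (J.piecewise p.1 x)‖ ≤ r ∧
          ‖z - pairForm G (J.piecewise p.2 x)‖ ≤ r}
        ≤ C * (r / N + 1 / √(Fintype.card ι)) := by
  obtain ⟨C, hC, smallBall⟩ := exists_smallBall_of_spread_of_spread hρ0 hρ M ha hb
  refine ⟨2 * C, by positivity, fun ι _ _ _ ν _ hν G J hJ p hp N hN hNp z r hr => ?_⟩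
  simp only [notSpreadResample, Set.mem_ofPred_eq, not_or, not_not] at hp
  refine (measureReal_mono ?_).trans ((smallBall _ (Measure.pi ν) ι _ _ (IndepPairs.pi hν).symm
    _ _ J hp.1 hp.2 hJ N hN hNp (2 * r) (by positivity)
    (pairForm G (J.piecewise p.2 0) - pairForm G (J.piecewise p.1 0))).trans ?_)
  · rintro x ⟨close₁, close₂⟩
    rw [Set.mem_ofPred_eq, ← pairForm_piecewise_sub]
    calc _ = ‖(z - pairForm G (J.piecewise p.2 x)) - (z - pairForm G (J.piecewise p.1 x))‖ := by
          rw [sub_sub_sub_cancel_left]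
      _ ≤ r + r := (norm_sub_le _ _).trans (add_le_add close₂ close₁)
      _ = 2 * r := by ring
  · have : 0 ≤ 1 / √(Fintype.card ι : ℝ) := by positivity
    rw [mul_div_assoc, mul_comm 2 C, mul_assoc]
    gcongr
    linarith

lemma sq_measureReal_pi_le_of_section_le {ι E : Type*} [Fintype ι] [DecidableEq ι]
    [MeasurableSpace E] (ν : ι → Measure E) [∀ i, IsProbabilityMeasure (ν i)] (J : Finset ι)
    {W : Set (ι → E)} (hW : MeasurableSet W) {D : Set ((ι → E) × (ι → E))} (hD : MeasurableSet D)
    {c : ℝ} (h : ∀ p ∉ D,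
      (Measure.pi ν).real {x | J.piecewise p.1 x ∈ W ∧ J.piecewise p.2 x ∈ W} ≤ c) (hc : 0 ≤ c) :
    (Measure.pi ν).real W ^ 2 ≤ ((Measure.pi ν).prod (Measure.pi ν)).real D + c := by
  have preimage_measurable {f : (ι → E) × (ι → E) × (ι → E) → ι → E} (hf : Measurable f) :
      MeasurableSet {p | J.piecewise (f p) p.1 ∈ W} :=
    (measurable_piecewise J).comp (measurable_fst.prodMk hf) hW
  refine (sq_measureReal_pi_le ν J hW).trans (measureReal_prod_le_of_section_le _ _ ?_ hD h hc)
  exact (preimage_measurable (measurable_fst.comp measurable_snd)).inter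
    (preimage_measurable (measurable_snd.comp measurable_snd))

lemma exists_l2_mulVec_resampleDiff_smallBall {ρ : ℝ} (hρ0 : 0 ≤ ρ) (hρ : ρ < 1) (M : ℝ) {a b : ℝ}
    (ha : 0 < a) (hb : 0 < b) (L : ℕ) [NeZero L] :
    ∃ C : ℝ, 0 < C ∧ ∀ (ι : Type*) [Fintype ι] [DecidableEq ι] [Nonempty ι]
      (ν : ι → Measure (ℝ × ℝ)) [∀ i, IsProbabilityMeasure (ν i)],
      (∀ i, PairMoments (ν i) Prod.fst Prod.snd ρ M) →
      ∀ J : Fin L → Finset ι, (∀ i, ∃ l, i ∈ J l) → ∀ G : Matrix ι ι ℂ,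
      (∀ k, Spread a b (G k)) → (∀ k, 0 < l2 (G k)) → ∃ l, ∀ θ : ℝ, 0 < θ →
      ((Measure.pi ν).prod (Measure.pi ν)).real
          {p | l2 (G.mulVec (resampleDiff (J l) Prod.fst p)) ≤ θ * √(hsSq G) / √(2 * L)}
        ≤ C * (θ + 1 / √(Fintype.card ι)) := by
  obtain ⟨C, hC, smallBall⟩ := exists_l2_mulVec_smallBall hρ0 hρ M ha hb L
  refine ⟨C, hC, fun ι _ _ _ ν _ hν J J_cover G spread row_pos => ?_⟩
  obtain ⟨l, short_le⟩ :=
    smallBall _ (Measure.pi ν) ι _ _ (IndepPairs.pi hν) J J_cover G spread row_pos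
  refine ⟨l, fun θ hθ => ?_⟩
  have short_measurable : MeasurableSet
      {p | l2 (G.mulVec (resampleDiff (J l) Prod.fst p)) ≤ θ * √(hsSq G) / √(2 * L)} :=
    measurableSet_le (measurable_l2.comp (measurable_mulVec (fun _ _ => measurable_const)
      (measurable_resampleDiff (J l) measurable_fst))) measurable_const
  have section_le : ∀ y ∉ (∅ : Set (ι → ℝ × ℝ)), (Measure.pi ν).real
      {x | l2 (G.mulVec (resampleDiff (J l) Prod.fst (x, y))) ≤ θ * √(hsSq G) / √(2 * L)}
      ≤ C * (θ + 1 / √(Fintype.card ι)) := fun y _ => by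
    refine (measureReal_mono fun x hx => ?_).trans (short_le θ hθ fun i => (y i).1)
    have hsSq_nonneg : 0 ≤ hsSq G := Finset.sum_nonneg fun k _ => sq_nonneg _
    calc _ ≤ (θ * √(hsSq G) / √(2 * L)) ^ 2 := pow_le_pow_left₀ (l2_nonneg _) hx 2
      _ = _ := by
        rw [div_pow, mul_pow, Real.sq_sqrt hsSq_nonneg, Real.sq_sqrt (by positivity),
          mul_div_right_comm]
  simpa only [measureReal_empty, zero_add] using
    measureReal_prod_le_of_section_le _ _ short_measurable MeasurableSet.empty section_le
      (by positivity)

lemma exists_sq_pairForm_smallBall_le_resample {ρ : ℝ} (hρ0 : 0 ≤ ρ) (hρ : ρ < 1) (M : ℝ)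
    {a b : ℝ} (ha : 0 < a) (hb : 0 < b) :
    ∃ C : ℝ, 0 < C ∧ ∀ (ι : Type*) [Fintype ι] [DecidableEq ι] [Nonempty ι]
      (ν : ι → Measure (ℝ × ℝ)) [∀ i, IsProbabilityMeasure (ν i)],
      (∀ i, PairMoments (ν i) Prod.fst Prod.snd ρ M) → ∀ (G : Matrix ι ι ℂ) (J : Finset ι),
      (J.card : ℝ) ≤ b / 4 * Fintype.card ι → ∀ N : ℝ, 0 < N → ∀ (z : ℂ) (r : ℝ), 0 ≤ r →
      (Measure.pi ν).real {y | ‖z - pairForm G y‖ ≤ r} ^ 2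
        ≤ ((Measure.pi ν).prod (Measure.pi ν)).real (notSpreadResample a b G J)
          + ((Measure.pi ν).prod (Measure.pi ν)).real
              {p | l2 (G.mulVec (resampleDiff J Prod.fst p)) ≤ N}
          + C * (r / N + 1 / √(Fintype.card ι)) := by
  obtain ⟨C, hC, smallBall⟩ := exists_pairForm_piecewise_smallBall hρ0 hρ M ha hb
  refine ⟨C, hC, fun ι _ _ _ ν _ hν G J card_J N hN z r hr => ?_⟩
  let short : Set ((ι → ℝ × ℝ) × (ι → ℝ × ℝ)) :=
    {p | l2 (G.mulVec (resampleDiff J Prod.fst p)) ≤ N}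
  have short_measurable : MeasurableSet short :=
    measurableSet_le (measurable_l2.comp (measurable_mulVec (fun _ _ => measurable_const)
      (measurable_resampleDiff J measurable_fst))) measurable_const
  have close_measurable : MeasurableSet {y | ‖z - pairForm G y‖ ≤ r} :=
    measurableSet_le ((measurable_pairForm (G := fun _ => G) (fun _ _ => measurable_const)
      measurable_id).const_sub z).norm measurable_const
  have bad_measurable : MeasurableSet (notSpreadResample a b G J ∪ short) :=
    (measurableSet_notSpreadResample a b (G := fun _ => G) (fun _ _ => measurable_const) J
      measurable_id).union short_measurable
  refine (sq_measureReal_pi_le_of_section_le ν J close_measurable bad_measurable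
    (fun p hp => smallBall ι ν hν G J card_J p (fun h => hp (.inl h)) N hN
      (not_le.1 fun h => hp (.inr h)).le z r hr) (by positivity)).trans ?_
  gcongr
  exact measureReal_union_le _ _

lemma exists_sq_pairForm_smallBall {ρ : ℝ} (hρ0 : 0 ≤ ρ) (hρ : ρ < 1) (M : ℝ) {a b : ℝ}
    (ha : 0 < a) (hb : 0 < b) :
    ∃ (C : ℝ) (L : ℕ), 0 < C ∧ ∀ (ι : Type*) [Fintype ι] [DecidableEq ι] [Nonempty ι],
      1 ≤ b / 4 * Fintype.card ι → ∃ J : Fin L → Finset ι,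
      ∀ (ν : ι → Measure (ℝ × ℝ)) [∀ i, IsProbabilityMeasure (ν i)],
      (∀ i, PairMoments (ν i) Prod.fst Prod.snd ρ M) → ∀ G : Matrix ι ι ℂ,
      (∀ k, Spread a b (G k)) → (∀ k, 0 < l2 (G k)) →
      ∀ (z : ℂ) (r θ : ℝ), 0 ≤ r → 0 < θ →
      (Measure.pi ν).real {y | ‖z - pairForm G y‖ ≤ r} ^ 2
        ≤ C * (r / (θ * √(hsSq G)) + θ + 1 / √(Fintype.card ι))
          + ∑ l, ((Measure.pi ν).prod (Measure.pi ν)).real (notSpreadResample a b G (J l)) := by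
  obtain ⟨L, hL, cover⟩ := exists_cover_small (η := b / 4) (by positivity)
  have : NeZero L := ⟨hL.ne'⟩
  obtain ⟨C₁, hC₁, smallBall⟩ := exists_sq_pairForm_smallBall_le_resample hρ0 hρ M ha hb
  obtain ⟨C₂, hC₂, length⟩ := exists_l2_mulVec_resampleDiff_smallBall hρ0 hρ M ha hb L
  refine ⟨C₁ * √(2 * L) + C₁ + C₂, L, by positivity, fun ι _ _ _ hcard => ?_⟩
  obtain ⟨J, J_cover, card_J⟩ := cover ι hcard
  refine ⟨J, fun ν _ hν G spread row_pos z r θ hr hθ => ?_⟩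
  have hsSq_pos : 0 < hsSq G :=
    Finset.sum_pos (fun k _ => pow_pos (row_pos k) 2) Finset.univ_nonempty
  obtain ⟨l, short_le⟩ := length ι ν hν J J_cover G spread row_pos
  have ratio : r / (θ * √(hsSq G) / √(2 * L)) = √(2 * L) * (r / (θ * √(hsSq G))) := by
    field_simp
  have single_le := Finset.single_le_sum (f := fun l =>
    ((Measure.pi ν).prod (Measure.pi ν)).real (notSpreadResample a b G (J l)))
    (fun _ _ => measureReal_nonneg) (Finset.mem_univ l)
  have : 0 ≤ r / (θ * √(hsSq G)) := by positivity
  have : 0 ≤ 1 / √(Fintype.card ι : ℝ) := by positivity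
  calc _ ≤ _ := smallBall ι ν hν G (J l) (card_J l) (θ * √(hsSq G) / √(2 * L))
          (by positivity) z r hr
    _ ≤ ∑ l, ((Measure.pi ν).prod (Measure.pi ν)).real (notSpreadResample a b G (J l))
          + C₂ * (θ + 1 / √(Fintype.card ι))
        + C₁ * (√(2 * L) * (r / (θ * √(hsSq G))) + 1 / √(Fintype.card ι)) := by
      rw [ratio]
      gcongr
      exact short_le θ hθ
    _ ≤ _ := by
      have : 0 ≤ (C₁ + C₂) * (r / (θ * √(hsSq G))) := by positivity
      have : 0 ≤ (C₁ * √(2 * L) + C₁) * θ := by positivity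
      have : 0 ≤ C₁ * √(2 * L) * (1 / √(Fintype.card ι)) := by positivity
      linarith

lemma div_le_sq_or_le_of_le_mul_sqrt {K h δ ε s t : ℝ} (hδ : 0 < δ) (hδ1 : δ ≤ 1) (hε : 0 ≤ ε)
    (hK : 1 ≤ K ^ 2 * h) (ht : t ≤ ε * √(1 + s ^ 2)) :
    h / δ ≤ s ^ 2 ∨ t ≤ ε * √(K ^ 2 + 1) * √h / √δ := by
  refine or_iff_not_imp_left.2 fun hs => ht.trans ?_
  rw [mul_assoc, mul_div_assoc, ← Real.sqrt_mul (by positivity), ← Real.sqrt_div' _ hδ.le]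
  gcongr
  have : K ^ 2 * h ≤ K ^ 2 * h / δ := le_div_self (by linarith) hδ hδ1
  rw [not_le] at hs
  rw [add_mul, one_mul, add_div]
  linarith

theorem exists_pairForm_smallBall {ρ : ℝ} (hρ0 : 0 ≤ ρ) (hρ : ρ < 1) (M : ℝ) {a b : ℝ} (K : ℝ)
    (ha : 0 < a) (hb : 0 < b) :
    ∃ (C : ℝ) (L : ℕ), 0 < C ∧ ∀ (ι : Type*) [Fintype ι] [DecidableEq ι] [Nonempty ι],
      1 ≤ b / 4 * Fintype.card ι → ∃ J : Fin L → Finset ι,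
      ∀ (ν : ι → Measure (ℝ × ℝ)) [∀ i, IsProbabilityMeasure (ν i)],
      (∀ i, PairMoments (ν i) Prod.fst Prod.snd ρ M) → ∀ G : Matrix ι ι ℂ,
      (∀ k, Spread a b (G k)) → (∀ k, 0 < l2 (G k)) → 1 ≤ K ^ 2 * hsSq G →
      ∀ (z : ℂ) (ε : ℝ), 0 < ε → ε ≤ 1 →
      (Measure.pi ν).real (smallSchur G z ε)
        ≤ ε ^ (1 / 8 : ℝ) + √(C * (ε ^ (1 / 4 : ℝ) + 1 / √(Fintype.card ι))
          + ∑ l, ((Measure.pi ν).prod (Measure.pi ν)).real (notSpreadResample a b G (J l))) := by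
  obtain ⟨C, L, hC, smallBall⟩ := exists_sq_pairForm_smallBall hρ0 hρ M ha hb
  refine ⟨C * (√(K ^ 2 + 1) + 1), L, by positivity, fun ι _ _ _ hcard => ?_⟩
  obtain ⟨J, smallBall⟩ := smallBall ι hcard
  refine ⟨J, fun ν _ hν G spread row_pos hK z ε hε hε1 => ?_⟩
  let δ := ε ^ (1 / 8 : ℝ)
  let θ := ε ^ (1 / 4 : ℝ)
  let r := ε * √(K ^ 2 + 1) * √(hsSq G) / √δ
  have δ_pos : 0 < δ := by positivity
  have pairs := IndepPairs.pi hν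
  have long_le := measureReal_hsSq_div_le_l2_mulVec_sq_le
    (fun i => (pairs.moments i).symm.memLp_two_left) (fun i => (pairs.moments i).mean_right)
    (fun i => (pairs.moments i).var_right)
    (fun i j hij => (pairs.indep.indepFun hij).comp measurable_snd measurable_snd)
    (G := G.transpose) (by rw [hsSq_transpose]; nlinarith [sq_nonneg K]) δ_pos
  rw [hsSq_transpose] at long_le
  have hsSq_pos : 0 < hsSq G :=
    Finset.sum_pos (fun k _ => pow_pos (row_pos k) 2) Finset.univ_nonempty
  have ratio : r / (θ * √(hsSq G)) ≤ √(K ^ 2 + 1) * θ := by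
    have exponents : ε / √δ ≤ θ ^ 2 := by
      rw [div_le_iff₀ (by positivity), Real.sqrt_eq_rpow, ← Real.rpow_mul hε.le,
        ← Real.rpow_mul_natCast hε.le, ← Real.rpow_add hε]
      simpa using Real.rpow_le_rpow_of_exponent_ge hε hε1 (y := 1) (by norm_num)
    calc _ = √(K ^ 2 + 1) * (ε / √δ) / θ := by simp only [r]; field_simp
      _ ≤ √(K ^ 2 + 1) * θ ^ 2 / θ := by gcongr
      _ = _ := by field_simp
  have close_le : (Measure.pi ν).real {y | ‖z - pairForm G y‖ ≤ r} ≤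
      √(C * (√(K ^ 2 + 1) + 1) * (θ + 1 / √(Fintype.card ι))
        + ∑ l, ((Measure.pi ν).prod (Measure.pi ν)).real (notSpreadResample a b G (J l))) := by
    refine Real.le_sqrt_of_sq_le ((smallBall ν hν G spread row_pos z r θ (by positivity)
      (by positivity)).trans ?_)
    have : 0 ≤ √(K ^ 2 + 1) * (1 / √(Fintype.card ι)) := by positivity
    rw [mul_assoc]
    gcongr
    linarith
  refine (measureReal_mono fun y hy => ?_).trans
    ((measureReal_union_le _ _).trans (add_le_add long_le close_le))
  exact div_le_sq_or_le_of_le_mul_sqrt δ_pos (Real.rpow_le_one hε.le hε1 (by norm_num)) hε.le hK hy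

end PairFormSmallBall

section InverseSpread

lemma withDiag_transpose {ι : Type*} [DecidableEq ι] (Y : ι → ι → ℝ) (d : ι → ℂ) :
    (withDiag Y d).transpose = withDiag (fun i j => Y j i) d := by
  ext i j
  rcases eq_or_ne i j with rfl | hij
  · rfl
  · simp [withDiag, hij, hij.symm]

variable {ι : Type*} [Fintype ι]

lemma spread_zero {a b : ℝ} (hb : b ≤ 1) : Spread a b (0 : ι → ℂ) := by
  unfold Spread
  rw [Finset.filter_true_of_mem fun i _ => by simp [l2_zero], Finset.card_univ]
  exact mul_le_of_le_one_left (Nat.cast_nonneg _) hb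

lemma Spread.smul {a b : ℝ} {x : ι → ℂ} (h : Spread a b x) (c : ℂ) : Spread a b (c • x) := by
  refine h.trans (Nat.cast_le.2 (Finset.card_le_card fun i hi => ?_))
  simp only [Finset.mem_filter, Finset.mem_univ, true_and] at hi ⊢
  rw [l2_smul, Pi.smul_apply, smul_eq_mul, norm_mul]
  calc a * (‖c‖ * l2 x) = ‖c‖ * (a * l2 x) := by ring
    _ ≤ ‖c‖ * (√(Fintype.card ι) * ‖x i‖) := by gcongr
    _ = _ := by ring

variable [DecidableEq ι]

/-- The invertible matrices of operator norm at most `κ`. -/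
def boundedInvertible (κ : ℝ) : Set (Matrix ι ι ℂ) := {A | OpBound A κ ∧ A.det ≠ 0}

lemma measurableSet_boundedInvertible {Ω : Type*} [MeasurableSpace Ω] {A : Ω → Matrix ι ι ℂ}
    (hA : ∀ i j, Measurable fun ω => A ω i j) (κ : ℝ) :
    MeasurableSet {ω | A ω ∈ boundedInvertible κ} :=
  (measurableSet_opBound hA κ).inter (measurable_det hA (measurableSet_singleton 0)).compl

variable {κ : ℝ} {A : Matrix ι ι ℂ}

lemma transpose_mem_boundedInvertible (hA : A ∈ boundedInvertible κ) :
    A.transpose ∈ boundedInvertible κ :=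
  ⟨hA.1.transpose, by rw [Matrix.det_transpose]; exact hA.2⟩

lemma l2_inv_row_pos (hA : A ∈ boundedInvertible κ) (k : ι) : 0 < l2 (A⁻¹ k) := by
  refine (l2_nonneg _).lt_of_ne' fun row_zero => ?_
  have entry_eq := congrFun (congrFun (Matrix.nonsing_inv_mul A (isUnit_iff_ne_zero.2 hA.2)) k) k
  rw [Matrix.mul_apply, Matrix.one_apply_eq, l2_eq_zero.1 row_zero] at entry_eq
  simp at entry_eq

lemma exists_unit_not_spread_of_inv {a b : ℝ} (hb : b ≤ 1) (hA : A ∈ boundedInvertible κ)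
    {w : ι → ℂ} (hw : ¬ Spread a b (A⁻¹.mulVec w)) :
    ∃ (x : ι → ℂ) (s : ℂ), l2 x = 1 ∧ ¬ Spread a b x ∧ ‖s‖ ≤ κ ∧
      A.mulVec x = s • (((l2 w)⁻¹ : ℝ) : ℂ) • w := by
  have image : A.mulVec (A⁻¹.mulVec w) = w := by
    rw [Matrix.mulVec_mulVec, Matrix.mul_nonsing_inv _ (isUnit_iff_ne_zero.2 hA.2),
      Matrix.one_mulVec]
  set y := A⁻¹.mulVec w
  have y_ne : l2 y ≠ 0 := fun h => hw (l2_eq_zero.1 h ▸ spread_zero hb)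
  have w_ne : l2 w ≠ 0 := fun h => y_ne <| by
    simp only [y, l2_eq_zero.1 h, Matrix.mulVec_zero, l2_zero]
  let t : ℂ := ((l2 y)⁻¹ : ℝ)
  have t_ne : t ≠ 0 := Complex.ofReal_ne_zero.2 (inv_ne_zero y_ne)
  have unit : l2 (t • y) = 1 := by
    rw [l2_smul, Complex.norm_real, Real.norm_of_nonneg (inv_nonneg.2 (l2_nonneg _)),
      inv_mul_cancel₀ y_ne]
  refine ⟨t • y, t * l2 w, unit, fun h => hw ?_, ?_, ?_⟩
  · simpa [smul_smul, inv_mul_cancel₀ t_ne] using h.smul t⁻¹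
  · have := hA.1 (t • y)
    rwa [unit, mul_one, Matrix.mulVec_smul, image, l2_smul, ← Real.norm_of_nonneg (l2_nonneg w),
      ← Complex.norm_real, ← norm_mul] at this
  · rw [Matrix.mulVec_smul, image, smul_smul, mul_assoc, ← Complex.ofReal_mul,
      mul_inv_cancel₀ w_ne, Complex.ofReal_one, mul_one]

/-- The matrix does not depend on `w`, so that its image of the unit vector in the direction of
`A⁻¹ w` lies on a fixed line. -/
theorem exists_inv_not_spread_le {ρ : ℝ} (hρ0 : 0 ≤ ρ) (hρ : ρ < 1) (M : ℝ) {K : ℝ} (hK : 0 < K) :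
    ∃ a b C : ℝ, 0 < a ∧ 0 < b ∧ 0 < C ∧ ∀ (Ω : Type*) [MeasurableSpace Ω] (P : Measure Ω)
      [IsProbabilityMeasure P] (ι : Type*) [Fintype ι] [LinearOrder ι] [Nonempty ι]
      (X : Ω → ι → ι → ℝ), EllipticEntries P X ρ M → ∀ d w : ι → ℂ,
      P.real {ω | withDiag (X ω) d ∈ boundedInvertible (K * √(Fintype.card ι)) ∧
          ¬ Spread a b ((withDiag (X ω) d)⁻¹.mulVec w)} ≤ C / (Fintype.card ι : ℝ) ^ 2 ∧
      P.real {ω | withDiag (X ω) d ∈ boundedInvertible (K * √(Fintype.card ι)) ∧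
          ¬ Spread a b ((withDiag (X ω) d)⁻¹.transpose.mulVec w)}
        ≤ C / (Fintype.card ι : ℝ) ^ 2 := by
  obtain ⟨a, b, C, ha, hb, hb1, hC, not_spread_le⟩ := exists_not_spread_le hρ0 hρ M hK
  refine ⟨a, b, C, ha, hb, hC, fun Ω _ P _ ι _ _ _ X hX d w => ?_⟩
  have inv_le (Y : Ω → ι → ι → ℝ) (hY : EllipticEntries P Y ρ M) :
      P.real {ω | withDiag (Y ω) d ∈ boundedInvertible (K * √(Fintype.card ι)) ∧
          ¬ Spread a b ((withDiag (Y ω) d)⁻¹.mulVec w)} ≤ C / (Fintype.card ι : ℝ) ^ 2 := by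
    have direction_le : l2 ((((l2 w)⁻¹ : ℝ) : ℂ) • w) ≤ 1 := by
      rw [l2_smul, Complex.norm_real, Real.norm_of_nonneg (inv_nonneg.2 (l2_nonneg _))]
      exact inv_mul_le_one
    refine (measureReal_mono ?_ (measure_ne_top _ _)).trans
      (not_spread_le Ω P ι Y hY d _ direction_le)
    rintro ω ⟨good, hω⟩
    obtain ⟨x, s, unit, hx, hs, image⟩ := exists_unit_not_spread_of_inv hb1 good hω
    refine ⟨good.1, x, s, unit, hx, hs, ?_⟩
    rw [image, sub_self, l2_zero]
    positivity
  refine ⟨inv_le X hX, (measureReal_mono ?_ (measure_ne_top _ _)).trans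
    (inv_le _ hX.transpose)⟩
  rintro ω ⟨good, hω⟩
  change withDiag (fun i j => X ω j i) d ∈ _ ∧ _
  rw [← withDiag_transpose, ← Matrix.transpose_nonsing_inv]
  exact ⟨transpose_mem_boundedInvertible good, hω⟩

theorem exists_unit_not_spread_le {ρ : ℝ} (hρ0 : 0 ≤ ρ) (hρ : ρ < 1) (M : ℝ) {K : ℝ} (hK : 0 < K) :
    ∃ a b C : ℝ, 0 < a ∧ 0 < b ∧ 0 < C ∧ ∀ (Ω : Type*) [MeasurableSpace Ω] (P : Measure Ω)
      [IsProbabilityMeasure P] (ι : Type*) [Fintype ι] [LinearOrder ι] [Nonempty ι]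
      (X : Ω → ι → ι → ℝ), EllipticEntries P X ρ M → ∀ d : ι → ℂ,
      P.real {ω | OpBound (withDiag (X ω) d) (K * √(Fintype.card ι)) ∧ ∃ x, l2 x = 1 ∧
          ¬ Spread a b x ∧ l2 ((withDiag (X ω) d).mulVec x) ≤ a * √(Fintype.card ι)}
        ≤ C / (Fintype.card ι : ℝ) ^ 2 := by
  obtain ⟨a, b, C, ha, hb, -, hC, not_spread_le⟩ := exists_not_spread_le hρ0 hρ M hK
  refine ⟨a, b, C, ha, hb, hC, fun Ω _ P _ ι _ _ _ X hX d => (measureReal_mono ?_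
    (measure_ne_top _ _)).trans (not_spread_le Ω P ι X hX d 0 (by simp [l2_zero]))⟩
  rintro ω ⟨hop, x, unit, hx, image⟩
  exact ⟨hop, x, 0, unit, hx, by simp only [norm_zero]; positivity, by simpa using image⟩

end InverseSpread

lemma measureReal_prod_le_of_section_le_sqrt {E F : Type*} [MeasurableSpace E] [MeasurableSpace F]
    (μ : Measure E) (ν : Measure F) [IsProbabilityMeasure μ] [IsProbabilityMeasure ν]
    {W : Set (E × F)} (hW : MeasurableSet W) {D : Set F} (hD : MeasurableSet D) {g : F → ℝ}
    (hg : Integrable g ν) (hg0 : ∀ y, 0 ≤ g y) {η : ℝ} (hη : 0 ≤ η)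
    (h : ∀ y ∉ D, μ.real {x | (x, y) ∈ W} ≤ η + √(g y)) :
    (μ.prod ν).real W ≤ ν.real D + η + √(∫ y, g y ∂ν) := by
  have sqrt_integrable : Integrable (fun y => √(g y)) ν := by
    refine (hg.add (integrable_const (1 : ℝ))).mono'
      hg.aestronglyMeasurable.aemeasurable.sqrt.aestronglyMeasurable
      (Filter.Eventually.of_forall fun y => ?_)
    rw [Real.norm_of_nonneg (Real.sqrt_nonneg _)]
    exact Real.sqrt_le_iff.2 ⟨add_nonneg (hg0 y) zero_le_one, by
      simp only [Pi.add_apply]; nlinarith [hg0 y]⟩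
  have jensen : ∫ y, √(g y) ∂ν ≤ √(∫ y, g y ∂ν) :=
    Real.strictConcaveOn_sqrt.concaveOn.le_map_integral Real.continuous_sqrt.continuousOn
      isClosed_Ici (Filter.Eventually.of_forall hg0) hg sqrt_integrable
  have indicator_integrable : Integrable (D.indicator fun _ => (1 : ℝ)) ν :=
    (integrable_const _).indicator hD
  have majorant_integrable : Integrable (fun y => D.indicator (fun _ => (1 : ℝ)) y + η) ν :=
    indicator_integrable.add (integrable_const _)
  calc (μ.prod ν).real W = ∫ y, μ.real {x | (x, y) ∈ W} ∂ν :=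
        measureReal_prod_eq_integral_swap μ ν hW
    _ ≤ ∫ y, ((D.indicator (fun _ => (1 : ℝ)) y + η) + √(g y)) ∂ν := by
        refine integral_mono_of_nonneg (Filter.Eventually.of_forall fun y => measureReal_nonneg)
          (majorant_integrable.add sqrt_integrable)
          (Filter.Eventually.of_forall fun y => ?_)
        by_cases hy : y ∈ D
        · simp only [Set.indicator_of_mem hy]
          linarith [measureReal_le_one (μ := μ) (s := {x | (x, y) ∈ W}), Real.sqrt_nonneg (g y)]
        · simp only [Set.indicator_of_notMem hy, zero_add]
          exact h y hy
    _ = ν.real D + η + ∫ y, √(g y) ∂ν := by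
        rw [integral_add majorant_integrable sqrt_integrable,
          integral_add indicator_integrable (integrable_const _), integral_indicator hD]
        simp
    _ ≤ _ := by gcongr

lemma measureReal_indepFun_eq {Ω E F : Type*} [MeasurableSpace Ω] [MeasurableSpace E]
    [MeasurableSpace F] {P : Measure Ω} [IsProbabilityMeasure P] {f : Ω → E} {g : Ω → F}
    (hf : Measurable f) (hg : Measurable g) (h : IndepFun f g P)
    {S : Set (E × F)} (hS : MeasurableSet S) :
    P.real {ω | (f ω, g ω) ∈ S} = ((P.map f).prod P).real {q | (q.1, g q.2) ∈ S} := by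
  have := Measure.isProbabilityMeasure_map (μ := P) hf.aemeasurable
  have law : P.map (fun ω => (f ω, g ω)) = ((P.map f).prod P).map (Prod.map id g) := by
    rw [(indepFun_iff_map_prod_eq_prod_map_map hf.aemeasurable hg.aemeasurable).1 h,
      ← Measure.map_prod_map _ _ measurable_id hg, Measure.map_id]
  calc _ = (P.map fun ω => (f ω, g ω)).real S :=
        (map_measureReal_apply (hf.prodMk hg) hS).symm
    _ = _ := by rw [law, map_measureReal_apply (measurable_id.prodMap hg) hS]; rfl

section SpreadInverse

variable {Ω : Type*} [MeasurableSpace Ω] {P : Measure Ω} {ι : Type*} [Fintype ι] [DecidableEq ι]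
  {B : Ω → Matrix ι ι ℂ} {a b κ p : ℝ}

lemma measurableSet_boundedInvertible_notSpread_row (hB : ∀ i j, Measurable fun ω => B ω i j)
    (a b κ : ℝ) :
    MeasurableSet {ω | B ω ∈ boundedInvertible κ ∧ ∃ k, ¬ Spread a b ((B ω)⁻¹ k)} := by
  rw [Set.ofPred_and, Set.ofPred_exists]
  exact (measurableSet_boundedInvertible hB κ).inter (MeasurableSet.iUnion fun k =>
    (measurableSet_spread (measurable_pi_lambda _ fun j => measurable_inv_apply hB k j) a b).compl)

lemma measureReal_notSpread_row_le [IsFiniteMeasure P]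
    (h : ∀ w, P.real {ω | B ω ∈ boundedInvertible κ ∧
      ¬ Spread a b ((B ω)⁻¹.transpose.mulVec w)} ≤ p) :
    P.real {ω | B ω ∈ boundedInvertible κ ∧ ∃ k, ¬ Spread a b ((B ω)⁻¹ k)}
      ≤ Fintype.card ι * p := by
  calc _ ≤ P.real (⋃ k, {ω | B ω ∈ boundedInvertible κ ∧
        ¬ Spread a b ((B ω)⁻¹.transpose.mulVec (Pi.single k 1))}) := by
        refine measureReal_mono ?_ (measure_ne_top _ _)
        rintro ω ⟨good, k, hk⟩
        refine Set.mem_iUnion.2 ⟨k, good, ?_⟩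
        rwa [Matrix.mulVec_single_one]
    _ ≤ ∑ _k : ι, p := (measureReal_iUnion_fintype_le _).trans
        (Finset.sum_le_sum fun k _ => h (Pi.single k 1))
    _ = Fintype.card ι * p := by rw [Finset.sum_const, Finset.card_univ, nsmul_eq_mul]

variable (Q : Measure ((ι → ℝ × ℝ) × (ι → ℝ × ℝ))) (J : Finset ι)

lemma measurableSet_boundedInvertible_notSpreadResample
    (hB : ∀ i j, Measurable fun ω => B ω i j) (a b κ : ℝ) :
    MeasurableSet {q : Ω × (ι → ℝ × ℝ) × (ι → ℝ × ℝ) |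
      B q.1 ∈ boundedInvertible κ ∧ q.2 ∈ notSpreadResample a b (B q.1)⁻¹ J} :=
  (measurableSet_boundedInvertible hB κ).preimage measurable_fst |>.inter <|
    measurableSet_notSpreadResample a b
      (fun i j => (measurable_inv_apply hB i j).comp measurable_fst) J measurable_snd

lemma measureReal_prod_notSpreadResample_le [IsProbabilityMeasure P] [IsProbabilityMeasure Q]
    (hB : ∀ i j, Measurable fun ω => B ω i j) (hp : 0 ≤ p)
    (hcol : ∀ w, P.real {ω | B ω ∈ boundedInvertible κ ∧
      ¬ Spread a b ((B ω)⁻¹.mulVec w)} ≤ p)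
    (hrow : ∀ w, P.real {ω | B ω ∈ boundedInvertible κ ∧
      ¬ Spread a b ((B ω)⁻¹.transpose.mulVec w)} ≤ p) :
    (P.prod Q).real {q | B q.1 ∈ boundedInvertible κ ∧
      q.2 ∈ notSpreadResample a b (B q.1)⁻¹ J} ≤ 2 * p := by
  have section_le (q) : P.real {ω | B ω ∈ boundedInvertible κ ∧
      q ∈ notSpreadResample a b (B ω)⁻¹ J} ≤ 2 * p := by
    rw [two_mul]
    refine (measureReal_mono ?_ (measure_ne_top _ _)).trans ((measureReal_union_le _ _).trans
      (add_le_add (hcol (resampleDiff J Prod.fst q)) (hrow (resampleDiff J Prod.snd q))))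
    rintro ω ⟨good, hω | hω⟩
    exacts [Or.inl ⟨good, hω⟩, Or.inr ⟨good, hω⟩]
  simpa using measureReal_prod_le_of_section_le P Q
    (measurableSet_boundedInvertible_notSpreadResample J hB a b κ) MeasurableSet.empty
    (fun q _ => section_le q) (by positivity)

/-- `hS` is the conclusion of a small ball estimate for a fixed matrix with spread rows. -/
theorem measureReal_prod_boundedInvertible_le [Nonempty ι] [IsProbabilityMeasure P]
    (π : Measure (ι → ℝ × ℝ)) [IsProbabilityMeasure π] (hB : ∀ i j, Measurable fun ω => B ω i j)
    {K : ℝ} (hp : 0 ≤ p)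
    (hcol : ∀ w, P.real {ω | B ω ∈ boundedInvertible (K * √(Fintype.card ι)) ∧
      ¬ Spread a b ((B ω)⁻¹.mulVec w)} ≤ p)
    (hrow : ∀ w, P.real {ω | B ω ∈ boundedInvertible (K * √(Fintype.card ι)) ∧
      ¬ Spread a b ((B ω)⁻¹.transpose.mulVec w)} ≤ p)
    {S : Matrix ι ι ℂ → Set (ι → ℝ × ℝ)} {c η : ℝ} (hc : 0 ≤ c) (hη : 0 ≤ η) {L : ℕ}
    {J : Fin L → Finset ι}
    (hS : ∀ G : Matrix ι ι ℂ, (∀ k, Spread a b (G k)) → (∀ k, 0 < l2 (G k)) →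
      1 ≤ K ^ 2 * hsSq G →
      π.real (S G) ≤ η + √(c + ∑ l, (π.prod π).real (notSpreadResample a b G (J l))))
    (hW : MeasurableSet {q : (ι → ℝ × ℝ) × Ω |
      B q.2 ∈ boundedInvertible (K * √(Fintype.card ι)) ∧ q.1 ∈ S (B q.2)⁻¹}) :
    (π.prod P).real {q | B q.2 ∈ boundedInvertible (K * √(Fintype.card ι)) ∧
      q.1 ∈ S (B q.2)⁻¹} ≤ Fintype.card ι * p + η + √(c + L * (2 * p)) := by
  let κ := K * √(Fintype.card ι)
  let resample (l : Fin L) : Set (Ω × (ι → ℝ × ℝ) × (ι → ℝ × ℝ)) :=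
    {q | B q.1 ∈ boundedInvertible κ ∧ q.2 ∈ notSpreadResample a b (B q.1)⁻¹ (J l)}
  have resample_measurable (l) : MeasurableSet (resample l) :=
    measurableSet_boundedInvertible_notSpreadResample (J l) hB a b κ
  let g (ω : Ω) : ℝ := c + ∑ l, (π.prod π).real {q | (ω, q) ∈ resample l}
  have integrable_section (l) : Integrable (fun ω => (π.prod π).real {q | (ω, q) ∈ resample l}) P :=
    Integrable.of_bound
      (measurable_measure_prodMk_left (resample_measurable l)).ennreal_toReal.aestronglyMeasurable 1
      (Filter.Eventually.of_forall fun ω => by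
        rw [Real.norm_of_nonneg measureReal_nonneg]; exact measureReal_le_one)
  have integral_g_le : ∫ ω, g ω ∂P ≤ c + L * (2 * p) := by
    rw [integral_add (integrable_const _) (integrable_finsetSum _ fun l _ => integrable_section l),
      integral_finsetSum _ fun l _ => integrable_section l, integral_const, probReal_univ, one_smul]
    calc _ ≤ c + ∑ _l : Fin L, 2 * p := by
          gcongr with l
          rw [← measureReal_prod_eq_integral P _ (resample_measurable l)]
          exact measureReal_prod_notSpreadResample_le _ (J l) hB hp hcol hrow
      _ = _ := by rw [Finset.sum_const, Finset.card_univ, Fintype.card_fin, nsmul_eq_mul]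
  refine (measureReal_prod_le_of_section_le_sqrt π P hW
    (measurableSet_boundedInvertible_notSpread_row hB a b κ)
    ((integrable_const _).add (integrable_finsetSum _ fun l _ => integrable_section l))
    (fun ω => add_nonneg hc (Finset.sum_nonneg fun l _ => measureReal_nonneg)) hη
    fun ω hω => ?_).trans
    (by gcongr; exacts [measureReal_notSpread_row_le hrow, integral_g_le])
  by_cases good : B ω ∈ boundedInvertible κ
  · have spread (k) : Spread a b ((B ω)⁻¹ k) := by
      by_contra h
      exact hω ⟨good, k, h⟩
    have := hS (B ω)⁻¹ spread (l2_inv_row_pos good) (one_le_of_opBound_inv good.1 good.2)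
    simpa [resample, good, κ] using this
  · simp only [Set.mem_ofPred_eq, show B ω ∉ boundedInvertible (K * √(Fintype.card ι)) from good,
      false_and]
    simpa using add_nonneg hη (Real.sqrt_nonneg _)

theorem measureReal_smallSchur_le [Nonempty ι] [IsProbabilityMeasure P]
    (hB : ∀ i j, Measurable fun ω => B ω i j) {Y : Ω → ι → ℝ × ℝ} (hY : Measurable Y)
    (hYB : IndepFun Y (fun ω i j => B ω i j) P) {K : ℝ} (hp : 0 ≤ p)
    (hcol : ∀ w, P.real {ω | B ω ∈ boundedInvertible (K * √(Fintype.card ι)) ∧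
      ¬ Spread a b ((B ω)⁻¹.mulVec w)} ≤ p)
    (hrow : ∀ w, P.real {ω | B ω ∈ boundedInvertible (K * √(Fintype.card ι)) ∧
      ¬ Spread a b ((B ω)⁻¹.transpose.mulVec w)} ≤ p)
    {z : ℂ} {ε c η : ℝ} (hc : 0 ≤ c) (hη : 0 ≤ η) {L : ℕ} {J : Fin L → Finset ι}
    (hS : ∀ G : Matrix ι ι ℂ, (∀ k, Spread a b (G k)) → (∀ k, 0 < l2 (G k)) →
      1 ≤ K ^ 2 * hsSq G → (P.map Y).real (smallSchur G z ε) ≤ η +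
        √(c + ∑ l, ((P.map Y).prod (P.map Y)).real (notSpreadResample a b G (J l)))) :
    P.real {ω | B ω ∈ boundedInvertible (K * √(Fintype.card ι)) ∧ Y ω ∈ smallSchur (B ω)⁻¹ z ε}
      ≤ Fintype.card ι * p + η + √(c + L * (2 * p)) := by
  let event : Set ((ι → ℝ × ℝ) × (ι → ι → ℂ)) :=
    {q | Matrix.of q.2 ∈ boundedInvertible (K * √(Fintype.card ι)) ∧
      q.1 ∈ smallSchur (Matrix.of q.2)⁻¹ z ε}
  have event_measurable : MeasurableSet event := by
    have entries_measurable : ∀ i j,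
        Measurable fun q : (ι → ℝ × ℝ) × (ι → ι → ℂ) => Matrix.of q.2 i j := fun i j => by
      simp only [Matrix.of_apply]; fun_prop
    exact (measurableSet_boundedInvertible entries_measurable _).inter
      (measurableSet_smallSchur (measurable_inv_apply entries_measurable) measurable_fst z ε)
  have B_measurable : Measurable fun ω i j => B ω i j :=
    measurable_pi_lambda _ fun i => measurable_pi_lambda _ fun j => hB i j
  have := Measure.isProbabilityMeasure_map (μ := P) hY.aemeasurable
  exact (measureReal_indepFun_eq hY B_measurable hYB event_measurable).trans_le
    (measureReal_prod_boundedInvertible_le (P.map Y) hB hp hcol hrow hc hη hS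
      (measurable_fst.prodMk (B_measurable.comp measurable_snd) event_measurable))

end SpreadInverse

lemma one_le_rpow_mul_rpow_neg {x c s : ℝ} (hx : 0 < x) (hxc : x ≤ c) (hs : 0 ≤ s) :
    1 ≤ c ^ s * x ^ (-s) := by
  calc 1 = x ^ s * x ^ (-s) := by rw [← Real.rpow_add hx, add_neg_cancel, Real.rpow_zero]
    _ ≤ c ^ s * x ^ (-s) := by gcongr

lemma schur_bound_le {n ε C₁ C₂ L : ℝ} (hn : 1 ≤ n) (hε : 0 < ε) (hC₁ : 0 ≤ C₁) (hC₂ : 0 ≤ C₂)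
    (hL : 0 ≤ L) :
    n * (C₁ / n ^ 2) + ε ^ (1 / 8 : ℝ)
        + √(C₂ * (ε ^ (1 / 4 : ℝ) + 1 / √n) + L * (2 * (C₁ / n ^ 2)))
      ≤ (1 + C₁ + √(C₂ + 2 * L * C₁)) * (ε ^ (1 / 8 : ℝ) + n ^ (-(1 / 8) : ℝ)) := by
  let η := ε ^ (1 / 8 : ℝ)
  let ν := n ^ (-(1 / 8) : ℝ)
  have n_pos : 0 < n := by linarith
  have : 0 < η := by positivity
  have ν_pos : 0 < ν := by positivity
  have η_sq : ε ^ (1 / 4 : ℝ) = η ^ 2 := by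
    rw [← Real.rpow_mul_natCast hε.le]; norm_num
  have ν_sq : n ^ (-(1 / 4) : ℝ) = ν ^ 2 := by
    rw [← Real.rpow_mul_natCast n_pos.le]; norm_num
  have inv_le : n * (C₁ / n ^ 2) ≤ C₁ * ν := by
    rw [show n * (C₁ / n ^ 2) = C₁ * n⁻¹ by field_simp, ← Real.rpow_neg_one]
    exact mul_le_mul_of_nonneg_left (Real.rpow_le_rpow_of_exponent_le hn (by norm_num)) hC₁
  have inv_sqrt_le : 1 / √n ≤ ν ^ 2 := by
    rw [one_div, Real.sqrt_eq_rpow, ← Real.rpow_neg n_pos.le, ← ν_sq]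
    exact Real.rpow_le_rpow_of_exponent_le hn (by norm_num)
  have inv_sq_le : C₁ / n ^ 2 ≤ C₁ * ν ^ 2 := by
    rw [div_eq_mul_inv, ← Real.rpow_natCast, ← Real.rpow_neg n_pos.le, ← ν_sq]
    exact mul_le_mul_of_nonneg_left (Real.rpow_le_rpow_of_exponent_le hn (by norm_num)) hC₁
  have sqrt_le : √(C₂ * (ε ^ (1 / 4 : ℝ) + 1 / √n) + L * (2 * (C₁ / n ^ 2)))
      ≤ √(C₂ + 2 * L * C₁) * (η + ν) := by
    rw [η_sq, ← Real.sqrt_sq (by positivity : 0 ≤ η + ν), ← Real.sqrt_mul (by positivity)]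
    refine Real.sqrt_le_sqrt ?_
    calc _ ≤ C₂ * (η ^ 2 + ν ^ 2) + L * (2 * (C₁ * ν ^ 2)) := by gcongr
      _ ≤ _ := by
        have : 0 ≤ (C₂ + 2 * L * C₁) * (2 * (η * ν)) + 2 * L * C₁ * η ^ 2 := by positivity
        linarith
  have : 0 ≤ C₁ * η := by positivity
  linarith

theorem exists_schur_smallBall {ρ : ℝ} (hρ0 : 0 ≤ ρ) (hρ : ρ < 1) (M : ℝ) {K : ℝ} (hK : 0 < K) :
    ∃ C : ℝ, 0 < C ∧ ∀ (Ω : Type*) [MeasurableSpace Ω] (P : Measure Ω)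
      [IsProbabilityMeasure P] (ι : Type*) [Fintype ι] [LinearOrder ι] [Nonempty ι]
      (X : Ω → ι → ι → ℝ), EllipticEntries P X ρ M → ∀ (d : ι → ℂ) (U V : ι → Ω → ℝ),
      IndepPairs P U V ρ M →
      IndepFun (fun ω i => (U i ω, V i ω)) (fun ω i j => withDiag (X ω) d i j) P →
      ∀ (z : ℂ) (ε : ℝ), 0 < ε → ε ≤ 1 →
      P.real {ω | withDiag (X ω) d ∈ boundedInvertible (K * √(Fintype.card ι)) ∧
          (fun i => (U i ω, V i ω)) ∈ smallSchur (withDiag (X ω) d)⁻¹ z ε}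
        ≤ C * (ε ^ (1 / 8 : ℝ) + (Fintype.card ι : ℝ) ^ (-(1 / 8) : ℝ)) := by
  obtain ⟨a, b, C₁, ha, hb, hC₁, not_spread_le⟩ := exists_inv_not_spread_le hρ0 hρ M hK
  obtain ⟨C₂, L, hC₂, smallBall⟩ := exists_pairForm_smallBall hρ0 hρ M K ha hb
  refine ⟨(4 / b) ^ (1 / 8 : ℝ) + (1 + C₁ + √(C₂ + 2 * L * C₁)), by positivity,
    fun Ω _ P _ ι _ _ _ X hX d U V hUV hindep z ε hε hε1 => ?_⟩
  have one_le_card : (1 : ℝ) ≤ Fintype.card ι := Nat.one_le_cast.2 Fintype.card_pos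
  rw [add_mul]
  rcases lt_or_ge (b / 4 * Fintype.card ι) 1 with hcard | hcard
  · have card_le : (Fintype.card ι : ℝ) ≤ 4 / b := by
      rw [le_div_iff₀ hb]; linarith
    have := one_le_rpow_mul_rpow_neg (s := 1 / 8) (by linarith) card_le (by norm_num)
    refine measureReal_le_one.trans (this.trans ?_)
    rw [mul_add, add_assoc]
    exact le_add_of_nonneg_of_le (by positivity) (le_add_of_nonneg_right (by positivity))
  obtain ⟨J, smallBall⟩ := smallBall ι hcard
  have pairs_measurable (i) : Measurable fun ω => (U i ω, V i ω) :=
    (hUV.moments i).measurable_left.prodMk (hUV.moments i).measurable_right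
  have law := (iIndepFun_iff_map_fun_eq_pi_map fun i => (pairs_measurable i).aemeasurable).1
    hUV.indep
  have : ∀ i, IsProbabilityMeasure (P.map fun ω => (U i ω, V i ω)) := fun i =>
    Measure.isProbabilityMeasure_map (pairs_measurable i).aemeasurable
  refine (measureReal_smallSchur_le (J := J) (B := fun ω => withDiag (X ω) d)
    (Y := fun ω i => (U i ω, V i ω))
    (measurable_withDiag (fun i j hij => hX.measurable hij) fun i => measurable_const)
    (measurable_pi_lambda _ pairs_measurable) hindep (by positivity)
    (fun w => (not_spread_le Ω P ι X hX d w).1) (fun w => (not_spread_le Ω P ι X hX d w).2)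
    (by positivity) (by positivity) fun G spread row_pos hG => ?_).trans <|
    (schur_bound_le one_le_card hε hC₁.le hC₂.le (Nat.cast_nonneg L)).trans
      (le_add_of_nonneg_left (by positivity))
  rw [law]
  exact smallBall _ (fun i => (hUV.moments i).map) G spread row_pos hG z ε hε hε1

section ShiftedDiagonal

lemma withDiag_add_const {ι : Type*} [DecidableEq ι] (Y : ι → ι → ℝ) (d : ι → ℂ) (t : ℂ) :
    withDiag Y (fun i => d i + t) = withDiag Y d + t • (1 : Matrix ι ι ℂ) := by
  ext i j
  rcases eq_or_ne i j with rfl | hij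
  · simp [withDiag]
  · simp [withDiag, hij]

lemma minor_withDiag {ι : Type*} [DecidableEq ι] (Y : ι → ι → ℝ) (d : ι → ℂ) (k : ι) :
    minor (withDiag Y d) k
      = withDiag (fun i j : {i // i ≠ k} => Y i j) (fun i : {i // i ≠ k} => d i) := by
  ext i j
  simp [minor, withDiag, Subtype.ext_iff]

lemma finite_det_add_smul_eq_zero {ι : Type*} [Fintype ι] [DecidableEq ι] (B : Matrix ι ι ℂ) :
    {t : ℝ | (B + (t : ℂ) • (1 : Matrix ι ι ℂ)).det = 0}.Finite := by
  have eq_preimage : {t : ℝ | (B + (t : ℂ) • (1 : Matrix ι ι ℂ)).det = 0}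
      = Complex.ofReal ⁻¹' ((-B).charpoly.rootSet ℂ) := by
    ext t
    rw [Set.mem_preimage, Polynomial.mem_rootSet_of_ne (Matrix.charpoly_monic _).ne_zero,
      Set.mem_ofPred_eq, Polynomial.coe_aeval_eq_eval, Matrix.eval_charpoly, sub_neg_eq_add,
      add_comm, Matrix.scalar_apply, Matrix.smul_one_eq_diagonal]
  rw [eq_preimage]
  exact (Polynomial.rootSet_finite _ _).preimage Complex.ofReal_injective.injOn

variable {Ω : Type*} [MeasurableSpace Ω] {P : Measure Ω} {ι : Type*} [LinearOrder ι]
  {X : Ω → ι → ι → ℝ} {ρ M : ℝ}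

lemma EllipticEntries.indepPairs_border (hX : EllipticEntries P X ρ M) (k : ι) :
    IndepPairs P (fun (i : {i // i ≠ k}) ω => X ω i k) (fun i ω => X ω k i) ρ M :=
  hX.indepPairs (fun i : {i // i ≠ k} => (i : ι)) (fun _ => k) (fun i => i.2)
    fun i j hij => by grind

lemma EllipticEntries.indepFun_minor [Finite ι] (hX : EllipticEntries P X ρ M) (k : ι)
    (d : {i // i ≠ k} → ℂ) :
    IndepFun (fun ω (i : {i // i ≠ k}) => (X ω i k, X ω k i))
      (fun ω i j => withDiag (fun i j : {i // i ≠ k} => X ω i j) d i j) P := by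
  have := Fintype.ofFinite ι
  let pairs (p : {p : ι × ι // p.1 < p.2}) (ω : Ω) := (X ω p.1.1 p.1.2, X ω p.1.2 p.1.1)
  let border : Finset {p : ι × ι // p.1 < p.2} := {p | p.1.1 = k ∨ p.1.2 = k}
  have measurable_border (m : MeasurableSpace Ω) (h : ∀ p ∈ border, Measurable (pairs p)) :
      Measurable fun ω (i : {i // i ≠ k}) => (X ω i k, X ω k i) := by
    refine measurable_pi_lambda _ fun i => ?_
    rcases lt_or_gt_of_ne i.2 with hik | hki
    · exact h ⟨(i, k), hik⟩ (by simp [border])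
    · exact measurable_swap.comp (h ⟨(k, i), hki⟩ (by simp [border]))
  have measurable_minor (m : MeasurableSpace Ω) (h : ∀ p ∈ borderᶜ, Measurable (pairs p)) :
      Measurable fun ω i j => withDiag (fun i j : {i // i ≠ k} => X ω i j) d i j := by
    refine measurable_pi_lambda _ fun i => measurable_pi_lambda _ fun j =>
      measurable_withDiag (D := fun _ => d) (fun i j hij => ?_) (fun i => measurable_const) i j
    rcases lt_or_gt_of_ne (Subtype.coe_injective.ne hij) with hij | hji
    · exact measurable_fst.comp (h ⟨(i, j), hij⟩ (by simp [border, i.2, j.2]))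
    · exact measurable_snd.comp (h ⟨(j, i), hji⟩ (by simp [border, i.2, j.2]))
  have measurable_pair (s : Finset {p : ι × ι // p.1 < p.2}) (p) (hp : p ∈ s) :
      Measurable[.comap (fun ω (q : s) => pairs q ω) inferInstance] (pairs p) :=
    (measurable_pi_apply (⟨p, hp⟩ : s)).comp (comap_measurable fun ω (q : s) => pairs q ω)
  have indep : IndepFun (fun ω (p : border) => pairs p ω) (fun ω (p : ↥borderᶜ) => pairs p ω) P :=
    hX.indep.indepFun_finset border borderᶜ disjoint_compl_right fun p =>
      (hX.measurable p.2.ne).prodMk (hX.measurable p.2.ne')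
  rw [IndepFun_iff_Indep] at indep ⊢
  exact indep_of_indep_of_le_left
    (indep_of_indep_of_le_right indep (measurable_minor _ (measurable_pair _)).comap_le)
    (measurable_border _ (measurable_pair _)).comap_le

variable [Fintype ι]

lemma EllipticEntries.ae_det_minor_ne_zero [IsProbabilityMeasure P]
    (hX : EllipticEntries P X ρ M) (d : ι → ℂ) :
    ∀ᵐ t : ℝ, ∀ᵐ ω ∂P, ∀ k, (minor (withDiag (X ω) fun i => d i + (t : ℂ)) k).det ≠ 0 := by
  have measurable_entry : ∀ i j,
      Measurable fun q : Ω × ℝ => withDiag (X q.1) (fun i => d i + (q.2 : ℂ)) i j :=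
    measurable_withDiag (fun i j hij => (hX.measurable hij).comp measurable_fst)
      fun i => by fun_prop
  have event_measurable : MeasurableSet {q : Ω × ℝ |
      ∀ k, (minor (withDiag (X q.1) fun i => d i + (q.2 : ℂ)) k).det ≠ 0} := by
    rw [Set.ofPred_forall]
    exact MeasurableSet.iInter fun k => (measurable_det
      (A := fun q : Ω × ℝ => minor (withDiag (X q.1) fun i => d i + (q.2 : ℂ)) k)
      (fun i j => measurable_entry i j) (measurableSet_singleton 0)).compl
  rw [← Measure.ae_ae_comm event_measurable]
  refine Filter.Eventually.of_forall fun ω => ae_all_iff.2 fun k => ae_iff.2 ?_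
  refine measure_mono_null (fun t ht => ?_)
    ((finite_det_add_smul_eq_zero (minor (withDiag (X ω) d) k)).measure_zero volume)
  rw [Set.mem_ofPred_eq, not_not] at ht
  rwa [Set.mem_ofPred_eq, minor_withDiag, ← withDiag_add_const,
    ← minor_withDiag _ (fun i => d i + (t : ℂ))]

lemma EllipticEntries.exists_shift_det_minor_ne_zero [IsProbabilityMeasure P]
    (hX : EllipticEntries P X ρ M) (d : ι → ℂ) {τ : ℝ} (hτ : 0 < τ) :
    ∃ t ∈ Set.Ioo 0 τ, ∀ᵐ ω ∂P, ∀ k,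
      (minor (withDiag (X ω) fun i => d i + (t : ℂ)) k).det ≠ 0 := by
  refine Measure.exists_mem_of_measure_ne_zero_of_ae (μ := volume) ?_
    (ae_restrict_of_ae (hX.ae_det_minor_ne_zero d))
  rw [Real.volume_Ioo, sub_zero]
  exact (ENNReal.ofReal_pos.2 hτ).ne'

end ShiftedDiagonal

section LeastSingularValue

lemma mem_smallSchur_of_small_image {ι : Type*} [Fintype ι] [DecidableEq ι] {Y : ι → ι → ℝ}
    {d x : ι → ℂ} {k : ι} {a s ε : ℝ} (ha : 0 < a) (hs : 0 < s)
    (hdet : (minor (withDiag Y d) k).det ≠ 0) (hx : a ≤ s * ‖x k‖)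
    (himage : l2 ((withDiag Y d).mulVec x) ≤ ε / s) :
    (fun i : {i // i ≠ k} => (Y i k, Y k i))
      ∈ smallSchur (minor (withDiag Y d) k)⁻¹ (d k) (ε / a) := by
  have schur_le := norm_mul_schur_le hdet x
  have row : (fun i : {i // i ≠ k} => withDiag Y d k i) = fun i : {i // i ≠ k} => (Y k i : ℂ) := by
    funext i; simp [withDiag, i.2.symm]
  have column : (fun i : {i // i ≠ k} => withDiag Y d i k)
      = fun i : {i // i ≠ k} => (Y i k : ℂ) := by
    funext i; simp [withDiag, i.2]
  rw [row, column, show withDiag Y d k k = d k by simp [withDiag]] at schur_le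
  change ‖d k - dotProduct (fun i : {i // i ≠ k} => (Y k i : ℂ))
    ((minor (withDiag Y d) k)⁻¹.mulVec fun i => (Y i k : ℂ))‖
    ≤ ε / a * √(1 + l2 ((minor (withDiag Y d) k)⁻¹.transpose.mulVec fun i => (Y k i : ℂ)) ^ 2)
  set S := ‖d k - dotProduct (fun i : {i // i ≠ k} => (Y k i : ℂ))
    ((minor (withDiag Y d) k)⁻¹.mulVec fun i => (Y i k : ℂ))‖
  set R := √(1 + l2 ((minor (withDiag Y d) k)⁻¹.transpose.mulVec fun i => (Y k i : ℂ)) ^ 2)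
  rw [div_mul_eq_mul_div, le_div_iff₀ ha]
  calc S * a ≤ S * (s * ‖x k‖) := by gcongr
    _ = s * (‖x k‖ * S) := by ring
    _ ≤ s * (ε / s * R) := mul_le_mul_of_nonneg_left (schur_le.trans (by gcongr)) hs.le
    _ = ε * R := by field_simp

/-- Every large coordinate of `x` forces the Schur complement at that coordinate to be small, and a
spread vector has a fixed proportion of large coordinates: average over the coordinates. -/
lemma measureReal_spread_small_image_le {Ω : Type*} [MeasurableSpace Ω] {P : Measure Ω}
    [IsFiniteMeasure P] {ι : Type*} [Fintype ι] [DecidableEq ι] [Nonempty ι] {X : Ω → ι → ι → ℝ}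
    {d : ι → ℂ} {κ a b c ε : ℝ} (ha : 0 < a) (hb : 0 < b)
    (hdet : ∀ᵐ ω ∂P, ∀ k, (minor (withDiag (X ω) d) k).det ≠ 0)
    (hc : ∀ k, P.real {ω | minor (withDiag (X ω) d) k ∈ boundedInvertible κ ∧
      (fun i : {i // i ≠ k} => (X ω i k, X ω k i))
        ∈ smallSchur (minor (withDiag (X ω) d) k)⁻¹ (d k) (ε / a)} ≤ c) :
    P.real {ω | OpBound (withDiag (X ω) d) κ ∧ ∃ x, l2 x = 1 ∧ Spread a b x ∧
      l2 ((withDiag (X ω) d).mulVec x) ≤ ε / √(Fintype.card ι)} ≤ c / b := by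
  let n : ℝ := Fintype.card ι
  have n_pos : 0 < n := Nat.cast_pos.2 Fintype.card_pos
  let E (k : ι) : Set Ω := {ω | minor (withDiag (X ω) d) k ∈ boundedInvertible κ ∧
    (fun i : {i // i ≠ k} => (X ω i k, X ω k i))
      ∈ smallSchur (minor (withDiag (X ω) d) k)⁻¹ (d k) (ε / a)}
  let F : Set Ω := {ω | b * n ≤ ∑ k, (E k).indicator (fun _ => (1 : ℝ)) ω}
  have count : b * n * P.real F ≤ ∑ k, 1 * P.real (E k) :=
    mul_measureReal_le_sum Finset.univ (fun _ _ => zero_le_one) E (fun _ hω => hω) (by positivity)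
  have sum_le : ∑ k, 1 * P.real (E k) ≤ n * c := by
    simpa [n] using Finset.sum_le_card_nsmul Finset.univ _ c fun k _ => (one_mul _).trans_le (hc k)
  refine le_trans (ENNReal.toReal_mono (measure_ne_top _ F) (measure_mono_ae ?_)) ?_
  · filter_upwards [hdet] with ω hdet
    rintro ⟨hop, x, unit, spread, image⟩
    change b * n ≤ _
    refine spread.trans ?_
    rw [Finset.card_filter, Nat.cast_sum]
    refine Finset.sum_le_sum fun k _ => ?_
    split_ifs with hk
    · rw [unit, mul_one] at hk
      rw [Set.indicator_of_mem, Nat.cast_one]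
      exact ⟨⟨hop.minor k, hdet k⟩,
        mem_smallSchur_of_small_image ha (Real.sqrt_pos.2 n_pos) (hdet k) hk image⟩
    · simpa using Set.indicator_nonneg (fun _ _ => zero_le_one) ω
  · rw [le_div_iff₀' hb]
    refine le_of_mul_le_mul_left ?_ n_pos
    calc n * (b * P.real F) = b * n * P.real F := by ring
      _ ≤ n * c := count.trans sum_le

lemma rpow_neg_eighth_sub_one_le {n : ℝ} (hn : 2 ≤ n) :
    (n - 1) ^ (-(1 / 8) : ℝ) ≤ 2 * n ^ (-(1 / 8) : ℝ) := by
  calc (n - 1) ^ (-(1 / 8) : ℝ) ≤ (n / 2) ^ (-(1 / 8) : ℝ) :=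
        Real.rpow_le_rpow_of_nonpos (by linarith) (by linarith) (by norm_num)
    _ = 2 ^ (1 / 8 : ℝ) * n ^ (-(1 / 8) : ℝ) := by
        rw [div_eq_inv_mul, Real.mul_rpow (by norm_num) (by linarith), Real.inv_rpow (by norm_num),
          ← Real.rpow_neg (by norm_num), neg_neg]
    _ ≤ 2 ^ (1 : ℝ) * n ^ (-(1 / 8) : ℝ) := by
        gcongr <;> norm_num
    _ = _ := by rw [Real.rpow_one]

theorem exists_minor_schur_smallBall {ρ : ℝ} (hρ0 : 0 ≤ ρ) (hρ : ρ < 1) (M : ℝ) {K : ℝ}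
    (hK : 0 < K) :
    ∃ C : ℝ, 0 < C ∧ ∀ (Ω : Type*) [MeasurableSpace Ω] (P : Measure Ω)
      [IsProbabilityMeasure P] (ι : Type*) [Fintype ι] [LinearOrder ι]
      (X : Ω → ι → ι → ℝ), EllipticEntries P X ρ M → ∀ (d : ι → ℂ) (k : ι) (ε : ℝ), 0 < ε →
      P.real {ω | minor (withDiag (X ω) d) k ∈ boundedInvertible (K * √(Fintype.card ι)) ∧
          (fun i : {i // i ≠ k} => (X ω i k, X ω k i))
            ∈ smallSchur (minor (withDiag (X ω) d) k)⁻¹ (d k) ε}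
        ≤ C * (ε ^ (1 / 8 : ℝ) + (Fintype.card ι : ℝ) ^ (-(1 / 8) : ℝ)) := by
  obtain ⟨C, hC, smallBall⟩ := exists_schur_smallBall hρ0 hρ M (K := 2 * K) (by positivity)
  refine ⟨1 + 2 * C, by positivity, fun Ω _ P _ ι _ _ X hX d k ε hε => ?_⟩
  rcases lt_or_ge 1 ε with hε1 | hε1
  · have := Real.one_le_rpow hε1.le (by norm_num : (0 : ℝ) ≤ 1 / 8)
    refine measureReal_le_one.trans ?_
    nlinarith [Real.rpow_nonneg (Nat.cast_nonneg (Fintype.card ι)) (-(1 / 8) : ℝ)]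
  rcases le_or_gt (Fintype.card ι) 1 with hn | hn
  · have card_eq : Fintype.card ι = 1 := le_antisymm hn (Fintype.card_pos_iff.2 ⟨k⟩)
    refine measureReal_le_one.trans ?_
    rw [card_eq, Nat.cast_one, Real.one_rpow]
    nlinarith [Real.rpow_pos_of_pos hε (1 / 8)]
  have card_minor : Fintype.card {i // i ≠ k} = Fintype.card ι - 1 := Set.card_ne_eq k
  have : Nonempty {i // i ≠ k} := Fintype.card_pos_iff.1 (by omega)
  let n : ℝ := Fintype.card ι
  have two_le : 2 ≤ n := Nat.ofNat_le_cast.2 hn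
  have minor_le := smallBall Ω P {i // i ≠ k} (fun ω i j => X ω i j) (hX.restrict _) (fun i => d i)
    _ _ (hX.indepPairs_border k) (hX.indepFun_minor k fun i => d i) (d k) ε hε hε1
  rw [card_minor, Nat.cast_sub hn.le, Nat.cast_one] at minor_le
  have sqrt_le : √n ≤ 2 * √(n - 1) :=
    Real.sqrt_le_iff.2 ⟨by positivity, by rw [mul_pow, Real.sq_sqrt (by linarith)]; linarith⟩
  refine (measureReal_mono ?_ (measure_ne_top _ _)).trans (minor_le.trans ?_)
  · rintro ω ⟨⟨hop, hdet⟩, hω⟩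
    rw [minor_withDiag] at hop hdet hω
    exact ⟨⟨fun x => (hop x).trans (mul_le_mul_of_nonneg_right
      (by linarith [mul_le_mul_of_nonneg_left sqrt_le hK.le]) (l2_nonneg x)), hdet⟩, hω⟩
  · calc C * (ε ^ (1 / 8 : ℝ) + (n - 1) ^ (-(1 / 8) : ℝ))
        ≤ C * (2 * ε ^ (1 / 8 : ℝ) + 2 * n ^ (-(1 / 8) : ℝ)) := by
          gcongr
          · exact le_mul_of_one_le_left (by positivity) one_le_two
          · exact rpow_neg_eighth_sub_one_le two_le
      _ = 2 * C * (ε ^ (1 / 8 : ℝ) + n ^ (-(1 / 8) : ℝ)) := by ring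
      _ ≤ _ := by gcongr; linarith

lemma l2_mulVec_withDiag_add_const_le {ι : Type*} [Fintype ι] [DecidableEq ι] (Y : ι → ι → ℝ)
    (d x : ι → ℂ) {t : ℝ} (ht : 0 ≤ t) :
    l2 ((withDiag Y fun i => d i + (t : ℂ)).mulVec x)
      ≤ l2 ((withDiag Y d).mulVec x) + t * l2 x := by
  rw [withDiag_add_const, Matrix.add_mulVec, Matrix.smul_mulVec, Matrix.one_mulVec]
  refine (l2_add_le _ _).trans_eq ?_
  rw [l2_smul, Complex.norm_real, Real.norm_of_nonneg ht]

lemma measureReal_small_image_le_add {Ω : Type*} [MeasurableSpace Ω] {P : Measure Ω}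
    [IsFiniteMeasure P] {ι : Type*} [Fintype ι] [DecidableEq ι] {X : Ω → ι → ι → ℝ} {d : ι → ℂ}
    {t κ r : ℝ} (a b : ℝ) (ht : 0 ≤ t) (htκ : t ≤ κ) (htr : t ≤ r)
    (hr : 2 * r ≤ a * √(Fintype.card ι)) :
    P.real {ω | OpBound (withDiag (X ω) d) κ ∧
        ∃ x, l2 x = 1 ∧ l2 ((withDiag (X ω) d).mulVec x) ≤ r}
      ≤ P.real {ω | OpBound (withDiag (X ω) fun i => d i + (t : ℂ)) (2 * κ) ∧ ∃ x, l2 x = 1 ∧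
          ¬ Spread a b x ∧ l2 ((withDiag (X ω) fun i => d i + (t : ℂ)).mulVec x)
            ≤ a * √(Fintype.card ι)}
        + P.real {ω | OpBound (withDiag (X ω) fun i => d i + (t : ℂ)) (2 * κ) ∧ ∃ x, l2 x = 1 ∧
          Spread a b x ∧ l2 ((withDiag (X ω) fun i => d i + (t : ℂ)).mulVec x) ≤ 2 * r} := by
  refine (measureReal_mono ?_ (measure_ne_top _ _)).trans (measureReal_union_le _ _)
  rintro ω ⟨hop, x, unit, image⟩
  have image_shift_le (y) := l2_mulVec_withDiag_add_const_le (X ω) d y ht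
  have hop_shift : OpBound (withDiag (X ω) fun i => d i + (t : ℂ)) (2 * κ) := fun y => by
    linarith [hop y, image_shift_le y, mul_le_mul_of_nonneg_right htκ (l2_nonneg y)]
  have image_shift : l2 ((withDiag (X ω) fun i => d i + (t : ℂ)).mulVec x) ≤ 2 * r := by
    have := image_shift_le x
    rw [unit, mul_one] at this
    linarith
  by_cases hx : Spread a b x
  · exact Or.inr ⟨hop_shift, x, unit, hx, image_shift⟩
  · exact Or.inl ⟨hop_shift, x, unit, hx, image_shift.trans hr⟩

lemma small_image_bound_le {a b C₁ C₂ n ε : ℝ} (ha : 0 < a) (hb : 0 < b) (hC₁ : 0 ≤ C₁)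
    (hC₂ : 0 ≤ C₂) (hn : 1 ≤ n) (hε : 0 < ε) :
    C₁ / n ^ 2 + C₂ * ((2 * ε / a) ^ (1 / 8 : ℝ) + n ^ (-(1 / 8) : ℝ)) / b
      ≤ (C₁ + C₂ / b * ((2 / a) ^ (1 / 8 : ℝ) + 1))
        * (ε ^ (1 / 8 : ℝ) + n ^ (-(1 / 8) : ℝ)) := by
  let s := (2 / a) ^ (1 / 8 : ℝ)
  let η := ε ^ (1 / 8 : ℝ)
  let ν := n ^ (-(1 / 8) : ℝ)
  have rpow_eq : (2 * ε / a) ^ (1 / 8 : ℝ) = s * η := by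
    rw [← Real.mul_rpow (by positivity) hε.le, div_mul_eq_mul_div]
  have inv_sq_le : C₁ / n ^ 2 ≤ C₁ * ν := by
    rw [div_eq_mul_inv, ← Real.rpow_natCast, ← Real.rpow_neg (by positivity)]
    exact mul_le_mul_of_nonneg_left (Real.rpow_le_rpow_of_exponent_le hn (by norm_num)) hC₁
  rw [rpow_eq]
  calc C₁ / n ^ 2 + C₂ * (s * η + ν) / b ≤ C₁ * ν + C₂ / b * (s * η + ν) := by
        rw [mul_div_right_comm]; gcongr
    _ ≤ C₁ * ν + C₂ / b * (s * η + ν) + (C₁ * η + C₂ / b * (η + s * ν)) :=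
        le_add_of_nonneg_right (by positivity)
    _ = _ := by ring

/-- A small shift of the diagonal, which makes all the minors invertible, is absorbed by the
constants. -/
theorem exists_small_image_le {ρ : ℝ} (hρ0 : 0 ≤ ρ) (hρ : ρ < 1) (M : ℝ) {K : ℝ} (hK : 0 < K) :
    ∃ C : ℝ, 0 < C ∧ ∀ (Ω : Type*) [MeasurableSpace Ω] (P : Measure Ω)
      [IsProbabilityMeasure P] (ι : Type*) [Fintype ι] [LinearOrder ι] [Nonempty ι]
      (X : Ω → ι → ι → ℝ), EllipticEntries P X ρ M → ∀ (d : ι → ℂ) (ε : ℝ), 0 < ε →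
      P.real {ω | OpBound (withDiag (X ω) d) (K * √(Fintype.card ι)) ∧
          ∃ x, l2 x = 1 ∧ l2 ((withDiag (X ω) d).mulVec x) ≤ ε / √(Fintype.card ι)}
        ≤ C * (ε ^ (1 / 8 : ℝ) + (Fintype.card ι : ℝ) ^ (-(1 / 8) : ℝ)) := by
  obtain ⟨a, b, C₁, ha, hb, hC₁, not_spread_le⟩ :=
    exists_unit_not_spread_le hρ0 hρ M (K := 2 * K) (by positivity)
  obtain ⟨C₂, hC₂, schur_le⟩ :=
    exists_minor_schur_smallBall hρ0 hρ M (K := 2 * K) (by positivity)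
  let s := (2 / a) ^ (1 / 8 : ℝ)
  let C := C₁ + C₂ / b * (s + 1)
  have : 0 < C := by positivity
  refine ⟨s + C, by positivity, fun Ω _ P _ ι _ _ _ X hX d ε hε => ?_⟩
  let n : ℝ := Fintype.card ι
  have one_le : 1 ≤ n := Nat.one_le_cast.2 Fintype.card_pos
  have one_le_sqrt : 1 ≤ √n := Real.one_le_sqrt.2 one_le
  rw [add_mul]
  rcases lt_or_ge a (2 * ε) with large | small
  · calc _ ≤ (1 : ℝ) := measureReal_le_one
      _ ≤ (2 / a * ε) ^ (1 / 8 : ℝ) := Real.one_le_rpow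
        (by rw [div_mul_eq_mul_div]; exact (one_le_div ha).2 large.le) (by norm_num)
      _ = s * ε ^ (1 / 8 : ℝ) := Real.mul_rpow (by positivity) hε.le
      _ ≤ s * (ε ^ (1 / 8 : ℝ) + n ^ (-(1 / 8) : ℝ)) := by
        gcongr; exact le_add_of_nonneg_right (by positivity)
      _ ≤ _ := le_add_of_nonneg_right (by positivity)
  obtain ⟨t, ⟨ht, ht_lt⟩, hdet⟩ := hX.exists_shift_det_minor_ne_zero d
    (τ := min (K * √n) (ε / √n)) (by positivity)
  obtain ⟨ht_op, ht_image⟩ := lt_min_iff.1 ht_lt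
  have image_le : 2 * (ε / √n) ≤ a * √n :=
    calc 2 * (ε / √n) ≤ 2 * ε := by gcongr; exact div_le_self hε.le one_le_sqrt
      _ ≤ a := small
      _ ≤ a * √n := le_mul_of_one_le_right ha.le one_le_sqrt
  have reduction := measureReal_small_image_le_add (P := P) (X := X) (d := d) a b ht.le ht_op.le
    ht_image.le image_le
  rw [← mul_assoc, ← mul_div_assoc] at reduction
  refine (reduction.trans (add_le_add (not_spread_le Ω P ι X hX _)
    (measureReal_spread_small_image_le ha hb hdet fun k =>
      schur_le Ω P ι X hX _ k _ (by positivity)))).trans ?_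
  exact (small_image_bound_le ha hb hC₁.le hC₂.le one_le hε).trans
    (le_add_of_nonneg_left (by positivity))

end LeastSingularValue

section RandomDiagonal

lemma measurableSet_exists_small_image {Ω : Type*} [MeasurableSpace Ω] {ι : Type*} [Fintype ι]
    {A : Ω → Matrix ι ι ℂ} (hA : ∀ i j, Measurable fun ω => A ω i j) (r : ℝ) :
    MeasurableSet {ω | ∃ x, l2 x = 1 ∧ l2 ((A ω).mulVec x) ≤ r} := by
  have closed : IsClosed {B : ι → ι → ℂ | ∃ x, l2 x = 1 ∧ l2 ((Matrix.of B).mulVec x) ≤ r} := by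
    have closed_graph : IsClosed {p : (ι → ι → ℂ) × Metric.sphere (0 : EuclideanSpace ℂ ι) 1 |
        l2 ((Matrix.of p.1).mulVec p.2.1.ofLp) ≤ r} := by
      refine isClosed_le ?_ continuous_const
      simp only [l2, Matrix.mulVec, dotProduct, Matrix.of_apply]
      fun_prop
    convert isClosedMap_fst_of_compactSpace _ closed_graph using 1
    ext B
    constructor
    · rintro ⟨x, unit, image⟩
      exact ⟨(B, ⟨WithLp.toLp 2 x, by rw [mem_sphere_zero_iff_norm, ← l2_eq_norm, unit]⟩),
        image, rfl⟩
    · rintro ⟨⟨B, y⟩, image, rfl⟩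
      exact ⟨y.1.ofLp, by rw [l2_eq_norm, WithLp.toLp_ofLp, mem_sphere_zero_iff_norm.1 y.2], image⟩
  have measurable_entries : Measurable fun ω => (fun i j => A ω i j : ι → ι → ℂ) :=
    measurable_pi_lambda _ fun i => measurable_pi_lambda _ fun j => hA i j
  exact measurable_entries closed.measurableSet

lemma measureReal_randomDiag_le {Ω : Type*} [MeasurableSpace Ω] {P : Measure Ω}
    [IsProbabilityMeasure P] {ι : Type*} [Fintype ι] [DecidableEq ι] {X : Ω → ι → ι → ℝ}
    {D : Ω → ι → ℂ} {κ r c : ℝ} (hX : ∀ i j, i ≠ j → Measurable fun ω => X ω i j)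
    (hD : Measurable D)
    (hindep : IndepFun D (fun ω (p : {p : ι × ι // p.1 ≠ p.2}) => X ω p.1.1 p.1.2) P) (hc : 0 ≤ c)
    (h : ∀ d : ι → ℂ, P.real {ω | OpBound (withDiag (X ω) d) κ ∧
      ∃ x, l2 x = 1 ∧ l2 ((withDiag (X ω) d).mulVec x) ≤ r} ≤ c) :
    P.real {ω | OpBound (withDiag (X ω) (D ω)) κ ∧
      ∃ x, l2 x = 1 ∧ l2 ((withDiag (X ω) (D ω)).mulVec x) ≤ r} ≤ c := by
  let offDiag (ω : Ω) (p : {p : ι × ι // p.1 ≠ p.2}) : ℝ := X ω p.1.1 p.1.2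
  let fill (y : {p : ι × ι // p.1 ≠ p.2} → ℝ) (i j : ι) : ℝ :=
    if hij : i ≠ j then y ⟨(i, j), hij⟩ else 0
  have fill_offDiag (ω d) : withDiag (fill (offDiag ω)) d = withDiag (X ω) d := by
    ext i j
    by_cases hij : i = j <;> simp [withDiag, fill, offDiag, hij]
  have offDiag_measurable : Measurable offDiag := measurable_pi_lambda _ fun p => hX _ _ p.2
  have entry_measurable : ∀ i j,
      Measurable fun q : ({p : ι × ι // p.1 ≠ p.2} → ℝ) × (ι → ℂ) => withDiag (fill q.1) q.2 i j :=
    measurable_withDiag (fun i j hij => by simp only [fill, dif_pos hij]; fun_prop)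
      fun i => by fun_prop
  let S : Set (({p : ι × ι // p.1 ≠ p.2} → ℝ) × (ι → ℂ)) :=
    {q | OpBound (withDiag (fill q.1) q.2) κ ∧
      ∃ x, l2 x = 1 ∧ l2 ((withDiag (fill q.1) q.2).mulVec x) ≤ r}
  have S_measurable : MeasurableSet S :=
    (measurableSet_opBound entry_measurable κ).inter
      (measurableSet_exists_small_image entry_measurable r)
  have section_le (d) : (P.map offDiag).real {y | (y, d) ∈ S} ≤ c := by
    have section_measurable : MeasurableSet {y | (y, d) ∈ S} := measurable_prodMk_right S_measurable
    rw [map_measureReal_apply offDiag_measurable section_measurable]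
    simpa only [S, Set.preimage_ofPred_eq, Set.mem_ofPred_eq, fill_offDiag] using h d
  have := Measure.isProbabilityMeasure_map (μ := P) offDiag_measurable.aemeasurable
  calc _ = P.real {ω | (offDiag ω, D ω) ∈ S} := by
        simp only [S, Set.mem_ofPred_eq, fill_offDiag]
    _ = ((P.map offDiag).prod P).real {q | (q.1, D q.2) ∈ S} :=
        measureReal_indepFun_eq offDiag_measurable hD hindep.symm S_measurable
    _ ≤ P.real ∅ + c := measureReal_prod_le_of_section_le _ P
        ((measurable_fst.prodMk (hD.comp measurable_snd)) S_measurable) MeasurableSet.empty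
        (fun ω _ => section_le (D ω)) hc
    _ = c := by rw [measureReal_empty, zero_add]

end RandomDiagonal

lemma exists_l2_mulVec_eq_smallestSingularValue {n : ℕ} (hn : 1 ≤ n)
    (A : Matrix (Fin n) (Fin n) ℂ) :
    ∃ x, l2 x = 1 ∧ l2 (A.mulVec x) = smallestSingularValue A := by
  let T := Matrix.toEuclideanLin A
  have lt_finrank : n - 1 < Module.finrank ℂ (EuclideanSpace ℂ (Fin n)) := by
    rw [finrank_euclideanSpace_fin]; omega
  obtain ⟨v, hv⟩ :=
    (T.hasEigenvalue_adjoint_comp_self_sq_singularValues lt_finrank).exists_hasEigenvector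
  have norm_pos : 0 < ‖v‖ := norm_pos_iff.2 hv.2
  have image_sq : ‖T v‖ ^ 2 = (T.singularValues (n - 1) * ‖v‖) ^ 2 := by
    have inner_eq : inner ℂ v ((LinearMap.adjoint T ∘ₗ T) v) = inner ℂ (T v) (T v) := by
      rw [LinearMap.comp_apply, LinearMap.adjoint_inner_right]
    rw [hv.apply_eq_smul, inner_smul_right, inner_self_eq_norm_sq_to_K,
      inner_self_eq_norm_sq_to_K] at inner_eq
    rw [mul_pow]
    exact_mod_cast inner_eq.symm
  have image : l2 (A.mulVec v.ofLp) = smallestSingularValue A * ‖v‖ := by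
    rw [l2_eq_norm]
    have scaled_nonneg := mul_nonneg (T.singularValues_nonneg (n - 1)) norm_pos.le
    exact (sq_eq_sq₀ (norm_nonneg _) scaled_nonneg).1 image_sq
  have norm_scalar : ‖((‖v‖⁻¹ : ℝ) : ℂ)‖ = ‖v‖⁻¹ := by
    rw [Complex.norm_real, norm_inv, norm_norm]
  refine ⟨((‖v‖⁻¹ : ℝ) : ℂ) • v.ofLp, ?_, ?_⟩
  · rw [l2_smul, norm_scalar, l2_eq_norm, WithLp.toLp_ofLp, inv_mul_cancel₀ norm_pos.ne']
  · rw [Matrix.mulVec_smul, l2_smul, norm_scalar, image, mul_comm,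
      mul_inv_cancel_right₀ norm_pos.ne']

lemma opBound_spectralNorm2 {n : ℕ} (A : Matrix (Fin n) (Fin n) ℂ) :
    OpBound A (spectralNorm2 A) := fun x => by
  rw [l2_eq_norm, l2_eq_norm]
  exact (Matrix.toEuclideanCLM (n := Fin n) (𝕜 := ℂ) A).le_opNorm (WithLp.toLp 2 x)

lemma shiftedMatrix_eq_withDiag {n : ℕ} (X : Matrix (Fin n) (Fin n) ℝ) (z : ℂ) :
    shiftedMatrix X z = withDiag X fun i => X i i - z := by
  ext i j
  rcases eq_or_ne i j with rfl | hij
  · simp [shiftedMatrix, withDiag]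
  · simp [shiftedMatrix, withDiag, hij]

lemma ConditionC0.ellipticEntries {Ω : Type*} [MeasurableSpace Ω] {P : Measure Ω} {n : ℕ}
    {X : Ω → Matrix (Fin n) (Fin n) ℝ} {ρ M₄ : ℝ} (hX : ConditionC0 P X ρ M₄) :
    EllipticEntries P (fun ω i j => X ω i j) |ρ| M₄ where
  indep := hX.pairs_indep
  moments i j hij :=
    { measurable_left := hX.measurable i j
      measurable_right := hX.measurable j i
      memLp_left := hX.memLp_four i j hij
      memLp_right := hX.memLp_four j i hij.symm
      mean_left := hX.mean_eq_zero i j hij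
      mean_right := hX.mean_eq_zero j i hij.symm
      var_left := hX.second_moment i j hij
      var_right := hX.second_moment j i hij.symm
      fourth_left := hX.fourth_moment i j hij
      fourth_right := hX.fourth_moment j i hij.symm
      corr := by rw [hX.correlation i j hij] }

theorem mainTheorem2_general {ρ : ℝ} (hρ0 : 0 ≤ ρ) (hρ : ρ < 1) (M : ℝ) {K : ℝ} (hK : 0 < K) :
    ∃ C C₁ : ℝ, 0 < C ∧ 0 < C₁ ∧
      ∀ (Ω : Type*) [MeasurableSpace Ω] (P : Measure Ω) [IsProbabilityMeasure P]
        (n : ℕ) (_ : 1 ≤ n) (X : Ω → Fin n → Fin n → ℝ) (_ : EllipticEntries P X ρ M)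
        (D : Ω → Fin n → ℂ) (_ : Measurable D)
        (_ : IndepFun D (fun ω (p : {p : Fin n × Fin n // p.1 ≠ p.2}) => X ω p.1.1 p.1.2) P)
        (ε : ℝ) (_ : 0 < ε),
        P.real {ω | smallestSingularValue (withDiag (X ω) (D ω)) ≤ ε * (n : ℝ) ^ (-(1 / 2) : ℝ) ∧
            spectralNorm2 (withDiag (X ω) (D ω)) ≤ K * √(n : ℝ)}
          ≤ C * ε ^ (1 / 8 : ℝ) + C₁ * (n : ℝ) ^ (-(1 / 8) : ℝ) := by
  obtain ⟨C, hC, small_image_le⟩ := exists_small_image_le hρ0 hρ M hK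
  refine ⟨C, C, hC, hC, fun Ω _ P _ n hn X hX D hD hindep ε hε => ?_⟩
  have : Nonempty (Fin n) := ⟨⟨0, hn⟩⟩
  have randomDiag_le := measureReal_randomDiag_le (fun i j hij => hX.measurable hij) hD hindep
    (by positivity) fun d => small_image_le Ω P (Fin n) X hX d ε hε
  rw [Fintype.card_fin, mul_add] at randomDiag_le
  refine (measureReal_mono ?_ (measure_ne_top _ _)).trans randomDiag_le
  rintro ω ⟨singular_le, norm_le⟩
  obtain ⟨x, unit, image⟩ := exists_l2_mulVec_eq_smallestSingularValue hn (withDiag (X ω) (D ω))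
  refine ⟨fun y => (opBound_spectralNorm2 _ y).trans
    (mul_le_mul_of_nonneg_right norm_le (l2_nonneg y)), x, unit, ?_⟩
  rwa [image, div_eq_mul_inv, Real.sqrt_eq_rpow, ← Real.rpow_neg (Nat.cast_nonneg n)]

theorem mainTheorem2 (ρ K M₄ : ℝ) (hρ : |ρ| < 1) (hK : 1 < K) :
    ∃ C C₁ : ℝ, 0 < C ∧ 0 < C₁ ∧
      ∀ (Ω : Type*) [MeasurableSpace Ω] (P : Measure Ω) [IsProbabilityMeasure P]
        (n : ℕ) (_ : 1 ≤ n) (X : Ω → Matrix (Fin n) (Fin n) ℝ) (_ : ConditionC0 P X ρ M₄)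
        (z : ℂ) (ε : ℝ) (_ : 0 < ε),
        P.real {ω | smallestSingularValue (shiftedMatrix (X ω) z) ≤ ε * (n : ℝ) ^ (-(1 / 2) : ℝ) ∧
            spectralNorm2 (shiftedMatrix (X ω) z) ≤ 3 * K * √(n : ℝ)}
          ≤ C * ε ^ (1 / 8 : ℝ) + C₁ * (n : ℝ) ^ (-(1 / 8) : ℝ) := by
  obtain ⟨C, C₁, hC, hC₁, bound⟩ :=
    mainTheorem2_general (abs_nonneg ρ) hρ M₄ (K := 3 * K) (by positivity)
  refine ⟨C, C₁, hC, hC₁, fun Ω _ P _ n hn X hX z ε hε => ?_⟩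
  have shifted_diag : Measurable fun (d : Fin n → ℝ) i => (d i : ℂ) - z := by fun_prop
  simp only [shiftedMatrix_eq_withDiag]
  exact bound Ω P n hn _ hX.ellipticEntries _
    (shifted_diag.comp (measurable_pi_lambda _ fun i => hX.measurable i i))
    (hX.diag_indep_offDiag.comp shifted_diag measurable_id) ε hε
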